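/- **Emergent linear gravitational waves.** Work on Minkowski space with signature $(-,+,+,+)$, units $8\pi G=c=1$, in the linearized theory $g_{\mu\nu}=\eta_{\mu\nu}+h_{\mu\nu}$, and expand all fields in plane waves $e^{2\pi i k\cdot x}$ (amplitudes are complex; physical fields are real parts). *Defect distributions.* A physical laminar plane wave is given by $s=(\omega,\vec K,\hat d,v)$ with $\vec K\neq0$, $|\hat d|=1$, $\hat d\perp\vec K$, $v\ge0$, $\omega^2+v^2\le|\vec K|^2$: parallel line defects of direction $\hat d$ and velocity $\vec v=\omega\vec K/|\vec K|^2+v\,\vec K\times\hat d/|\vec K|^2$, of speed at most $1$, whose energy density is a plane wave with wave vector $k^\mu=(\omega,\vec K)$. So $k^2=k_\mu k^\mu\ge0$. With $u^\mu=(1,\vec v)$ and $d^\mu=(0,\hat d)$ its energy–momentum amplitude is $$\hat T_{\mu\nu}=u_\mu u_\nu+u^2d_\mu d_\nu ,$$ and its metric amplitude is, for $k^2\ne0$, $$\hat h_{\mu\nu}=\frac1{2\pi^2k^2}\Big[\hat T_{\mu\nu}-\tfrac12\Big(\eta_{\mu\nu}-\frac{k_\mu k_\nu}{k^2}\Big)\eta^{\alpha\beta}\hat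 T_{\alpha\beta}\Big],$$ while for $k^2=0$ (so $v=0$) $\hat h$ is the limit as $t\downarrow1$ of the amplitudes of $(\omega,t\vec K,\hat d,0)$. A defect distribution $\rho$ is a complex measure on the set of physical laminar plane waves. It is a *$k$-mode* if it is concentrated on waves with wave vector $k$; then $T_{\mu\nu}[\rho]=\int\hat T_{\mu\nu}\,d\rho$ and $h_{\mu\nu}[\rho]=\int\hat h_{\mu\nu}\,d\rho$. For a general $\rho$ the fields are $T_{\mu\nu}[\rho](x)=\int\hat T_{\mu\nu}e^{2\pi ik\cdot x}d\rho$ and $h_{\mu\nu}[\rho](x)=\int\hat h_{\mu\nu}e^{2\pi ik\cdot x}d\rho$, the latter when the integral converges absolutely. The following hold. 1. For every $k$ and every $k$-mode $\rho$, $h[\rho]$ is symmetric, satisfies the gauge condition $k^\mu h_{\mu\nu}=0$, and solves the linearized Einstein equation with source $T[\rho]$ at wave vector $k$. 2. (*Non-null modes.*) If $k^2\neq0$, then $h[\rho]$ is determined by $T[\rho]$: it is the only symmetric solution $H$ with $k^\mu H_{\mu\nu}=0$ of the linearized Einstein equation with source $T[\rho]$, and $k$-modes with equal energy–momentum have equal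 metric perturbation. 3. For every lightlike laminar wave the limit defining $\hat h$ exists. If a sequence of physical waves with $k^2>0$ converges to it and their metric amplitudes converge, the limit is $\hat h_{\mu\nu}+k_\mu\xi_\nu+\xi_\mu k_\nu$ for some $\xi$ with $k^\mu\xi_\mu=0$. 4. (*Lightlike modes.*) Let $k\ne0$, $k^2=0$. The set of all $h[\rho]$, $\rho$ a $k$-mode with $T[\rho]=0$, is exactly the space of symmetric $H$ with $H_{0\nu}=0$, $k^\mu H_{\mu\nu}=0$ and $\eta^{\mu\nu}H_{\mu\nu}=0$; it has complex dimension $2$. If $e_1,e_2$ are orthonormal spatial vectors orthogonal to $\vec K$ and one writes $\hat d=-\sin\phi\,e_1+\cos\phi\,e_2$, then for each such $\rho$ $$h[\rho]=\frac1{2\pi^2\omega^2}\big[r_{20}(e_1\otimes e_1-e_2\otimes e_2)+\tilde r_{20}(e_1\otimes e_2+e_2\otimes e_1)\big],\qquad r_{20}=\tfrac12\!\int\!\cos2\phi\,d\rho,\quad \tilde r_{20}=\tfrac12\!\int\!\sin2\phi\,d\rho ,$$ and every pair $(r_{20},\tilde r_{20})\in\mathbb C^2$ occurs. For $k=(\omega,\omega,0,0)$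 and $e_1=\hat y$, $e_2=\hat z$ these are the $+$ and $\times$ polarizations. 5. (*All vacuum modes.*) For every $k\neq0$ and every symmetric solution $H$ of the vacuum linearized Einstein equation at wave vector $k$ there are a $k$-mode $\rho$ with $T[\rho]=0$ and a $\xi$ with $H_{\mu\nu}=h_{\mu\nu}[\rho]+k_\mu\xi_\nu+\xi_\mu k_\nu$. 6. (*All vacuum solutions.*) Let $h_{\mu\nu}(x)=\int A_{\mu\nu}(k)e^{2\pi ik\cdot x}\,dm(k)$ with $m$ a measure on $\mathbb R^4$, $A$ symmetric, and $A$ and $|k|_{\mathrm{Eucl}}^2A$ $m$-integrable. If $h$ solves the vacuum linearized Einstein equation, then there are a defect distribution $\rho$ concentrated on lightlike waves, with absolutely convergent $h[\rho](x)$ and $T[\rho](x)=0$ for all $x$, and a $C^1$ field $\xi_\mu$, such that $h_{\mu\nu}=h_{\mu\nu}[\rho]+\partial_\mu\xi_\nu+\partial_\nu\xi_\mu$ everywhere. -/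

import Mathlib

open MeasureTheory Filter Topology Matrix

noncomputable section

namespace LineDefects

/-! ### Minkowski space, signature `(-,+,+,+)`, index `0` is time -/

/-- The Minkowski metric `η_{μν}` (it is its own inverse). -/
def eta : Matrix (Fin 4) (Fin 4) ℝ := Matrix.diagonal ![-1, 1, 1, 1]

/-- Lowering an index: `v_μ = η_{μν} v^ν`. -/
def lower (v : Fin 4 → ℝ) : Fin 4 → ℝ := eta *ᵥ v

/-- The Minkowski product `v_μ w^μ`. -/
def mdot (v w : Fin 4 → ℝ) : ℝ := lower v ⬝ᵥ w

/-- The 4-vector with time component `t` and spatial part `a`. -/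
def fourVec (t : ℝ) (a : Fin 3 → ℝ) : Fin 4 → ℝ := Fin.cons t a

/-- The plane wave `exp(2πi k_μ x^μ)`. -/
def phase (k x : Fin 4 → ℝ) : ℂ := Complex.exp (2 * Real.pi * Complex.I * (mdot k x : ℂ))

/-- A real tensor regarded as a complex one. -/
def toC (A : Matrix (Fin 4) (Fin 4) ℝ) : Matrix (Fin 4) (Fin 4) ℂ := A.map (fun r => (r : ℂ))

/-- The trace `η^{μν} H_{μν}`. -/
def etaTrace (H : Matrix (Fin 4) (Fin 4) ℂ) : ℂ := ∑ μ, (eta μ μ : ℂ) * H μ μ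

/-- The contraction `k^α H_{αν}`. -/
def contract (k : Fin 4 → ℝ) (H : Matrix (Fin 4) (Fin 4) ℂ) : Fin 4 → ℂ :=
  fun ν => ∑ α, (k α : ℂ) * H α ν

/-! ### Linearized gravity about Minkowski space (units `8πG = c = 1`) -/

/-- The partial derivative `∂_μ f`. -/
def pd (μ : Fin 4) (f : (Fin 4 → ℝ) → ℂ) (x : Fin 4 → ℝ) : ℂ :=
  fderiv ℝ f x (Pi.single μ 1)

/-- The linearized Ricci tensor
`½ (∂^α∂_μ h_{αν} + ∂^α∂_ν h_{αμ} - ∂^α∂_α h_{μν} - ∂_μ∂_ν h^α_α)` of the metric `η + h`. -/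
def linRicci (h : (Fin 4 → ℝ) → Matrix (Fin 4) (Fin 4) ℂ) (x : Fin 4 → ℝ) :
    Matrix (Fin 4) (Fin 4) ℂ := fun μ ν =>
  (1 / 2) * ∑ α, (eta α α : ℂ) *
    (pd α (pd μ fun y => h y α ν) x + pd α (pd ν fun y => h y α μ) x
      - pd α (pd α fun y => h y μ ν) x - pd μ (pd ν fun y => h y α α) x)

/-- The linearized Einstein tensor of the metric `η + h`. -/
def linEinstein (h : (Fin 4 → ℝ) → Matrix (Fin 4) (Fin 4) ℂ) (x : Fin 4 → ℝ) :
    Matrix (Fin 4) (Fin 4) ℂ :=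
  linRicci h x - ((1 / 2 : ℂ) * etaTrace (linRicci h x)) • toC eta

/-- The linearized Ricci tensor on the Fourier mode `H exp(2πi k·x)` (`∂_μ` becomes `2πi k_μ`). -/
def linRicciMode (k : Fin 4 → ℝ) (H : Matrix (Fin 4) (Fin 4) ℂ) :
    Matrix (Fin 4) (Fin 4) ℂ := fun μ ν =>
  -(2 * (Real.pi : ℂ) ^ 2) *
    ((lower k μ : ℂ) * contract k H ν + (lower k ν : ℂ) * contract k H μ
      - (mdot k k : ℂ) * H μ ν - (lower k μ : ℂ) * (lower k ν : ℂ) * etaTrace H)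

/-- The linearized Einstein tensor on the Fourier mode `H exp(2πi k·x)`. -/
def linEinsteinMode (k : Fin 4 → ℝ) (H : Matrix (Fin 4) (Fin 4) ℂ) :
    Matrix (Fin 4) (Fin 4) ℂ :=
  linRicciMode k H - ((1 / 2 : ℂ) * etaTrace (linRicciMode k H)) • toC eta

/-- The symmetric tensor `k_μ ξ_ν + ξ_μ k_ν`: an infinitesimal coordinate change of a mode. -/
def gaugeMode (k : Fin 4 → ℝ) (ξ : Fin 4 → ℂ) : Matrix (Fin 4) (Fin 4) ℂ := fun μ ν =>
  (lower k μ : ℂ) * ξ ν + ξ μ * (lower k ν : ℂ)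

/-- A field `h` of symmetric tensors that is an absolutely convergent superposition of plane waves
`∫ A(k) exp(2πi k·x) dm(k)`, with finite second moments (so that `h` is twice continuously
differentiable).  `m` may be singular, e.g. carried by the light cone or by finitely many `k`. -/
def IsPlaneWaveSuperposition (h : (Fin 4 → ℝ) → Matrix (Fin 4) (Fin 4) ℂ) : Prop :=
  ∃ (m : Measure (Fin 4 → ℝ)) (A : (Fin 4 → ℝ) → Matrix (Fin 4) (Fin 4) ℂ),
    (∀ k, (A k).IsSymm) ∧
    (∀ μ ν, Integrable (fun k => A k μ ν) m) ∧
    (∀ μ ν, Integrable (fun k => ((k ⬝ᵥ k : ℝ) : ℂ) * A k μ ν) m) ∧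
    ∀ x μ ν, h x μ ν = ∫ k, A k μ ν * phase k x ∂m

/-- Transverse-traceless amplitudes for the wave vector `k`: symmetric, purely spatial
(`H_{0ν} = 0`), transverse (`k^α H_{αν} = 0`) and traceless. -/
def transverseTraceless (k : Fin 4 → ℝ) : Submodule ℂ (Matrix (Fin 4) (Fin 4) ℂ) where
  carrier := {H | H.IsSymm ∧ (∀ ν, H 0 ν = 0) ∧ contract k H = 0 ∧ etaTrace H = 0}
  add_mem' := by
    rintro A B ⟨a1, a2, a3, a4⟩ ⟨b1, b2, b3, b4⟩
    refine ⟨a1.add b1, fun ν => by simp [a2, b2], ?_, ?_⟩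
    · have : contract k (A + B) = contract k A + contract k B := by
        funext ν; simp [contract, mul_add, Finset.sum_add_distrib]
      rw [this, a3, b3, add_zero]
    · have : etaTrace (A + B) = etaTrace A + etaTrace B := by
        simp [etaTrace, mul_add, Finset.sum_add_distrib]
      rw [this, a4, b4, add_zero]
  zero_mem' := by
    refine ⟨Matrix.isSymm_zero, fun ν => rfl, ?_, ?_⟩
    · funext ν; simp [contract]
    · simp [etaTrace]
  smul_mem' := by
    rintro c A ⟨a1, a2, a3, a4⟩
    refine ⟨a1.smul c, fun ν => by simp [a2], ?_, ?_⟩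
    · have : contract k (c • A) = c • contract k A := by
        funext ν; simp [contract, Finset.mul_sum, mul_left_comm]
      rw [this, a3, smul_zero]
    · have : etaTrace (c • A) = c • etaTrace A := by
        simp [etaTrace, Finset.mul_sum, mul_left_comm]
      rw [this, a4, smul_zero]

/-- The `+` polarization tensor `e₁ ⊗ e₁ - e₂ ⊗ e₂` of two spatial vectors. -/
def plusPol (e₁ e₂ : Fin 3 → ℝ) : Matrix (Fin 4) (Fin 4) ℂ := fun μ ν =>
  ((fourVec 0 e₁ μ * fourVec 0 e₁ ν - fourVec 0 e₂ μ * fourVec 0 e₂ ν : ℝ) : ℂ)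

/-- The `×` polarization tensor `e₁ ⊗ e₂ + e₂ ⊗ e₁` of two spatial vectors. -/
def crossPol (e₁ e₂ : Fin 3 → ℝ) : Matrix (Fin 4) (Fin 4) ℂ := fun μ ν =>
  ((fourVec 0 e₁ μ * fourVec 0 e₂ ν + fourVec 0 e₂ μ * fourVec 0 e₁ ν : ℝ) : ℂ)

/-! ### Laminar plane waves of line defects -/

/-- Parameters of a laminar plane wave: parallel straight line defects with direction `d` and a
common velocity, whose energy density varies as a plane wave with spatial wave vector `K` and
frequency `ω`; `v` is the velocity parameter orthogonal to `K` and `d`. -/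
structure WaveParam where
  ω : ℝ
  K : Fin 3 → ℝ
  d : Fin 3 → ℝ
  v : ℝ

namespace WaveParam

/-- The parameters as a tuple; it carries the topology and the Borel structure over. -/
def tuple (s : WaveParam) : ℝ × (Fin 3 → ℝ) × (Fin 3 → ℝ) × ℝ := (s.ω, s.K, s.d, s.v)

instance : TopologicalSpace WaveParam := TopologicalSpace.induced tuple inferInstance

instance : MeasurableSpace WaveParam := MeasurableSpace.comap tuple inferInstance

/-- The wave 4-vector `k^μ = (ω, K)`. -/
def wave (s : WaveParam) : Fin 4 → ℝ := fourVec s.ω s.K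

/-- The velocity of the defects, `ω K / |K|² + v (K × d) / |K|²`. -/
def velocity (s : WaveParam) : Fin 3 → ℝ :=
  (s.ω / (s.K ⬝ᵥ s.K)) • s.K + (s.v / (s.K ⬝ᵥ s.K)) • (crossProduct s.K s.d)

/-- `u^μ = (1, velocity)`; with `d^μ = (0, d)` it spans the world sheets of the defects. -/
def u (s : WaveParam) : Fin 4 → ℝ := fourVec 1 s.velocity

/-- `d^μ = (0, d)`. -/
def dir (s : WaveParam) : Fin 4 → ℝ := fourVec 0 s.d

/-- Physical laminar plane waves: `d` is a unit vector orthogonal to `K ≠ 0`, the sign of `d` is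
chosen so that `v ≥ 0`, and the speed `√(ω² + v²) / |K|` of the defects is at most that of light.
(For `v = 0` the parameters `d` and `-d` describe the same wave; all tensors below agree on
them.) -/
def IsPhysical (s : WaveParam) : Prop :=
  s.K ≠ 0 ∧ s.d ⬝ᵥ s.d = 1 ∧ s.K ⬝ᵥ s.d = 0 ∧ 0 ≤ s.v ∧ s.ω ^ 2 + s.v ^ 2 ≤ s.K ⬝ᵥ s.K

/-- The amplitude `u_μ u_ν + u² d_μ d_ν` of the energy-momentum tensor of a laminar plane wave with
unit energy density amplitude (a static string has energy density equal to its tension). -/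
def energyMomentum (s : WaveParam) : Matrix (Fin 4) (Fin 4) ℝ := fun μ ν =>
  lower s.u μ * lower s.u ν + mdot s.u s.u * (lower s.dir μ * lower s.dir ν)

/-- For `k² ≠ 0`: the amplitude
`(2π²k²)⁻¹ (T_{μν} - ½ (η_{μν} - k_μ k_ν / k²) η^{αβ} T_{αβ})` of the metric perturbation obtained
by inverting the linearized Einstein equation in the gauge `∂^μ h_{μν} = 0`. -/
def nonNullMetric (s : WaveParam) : Matrix (Fin 4) (Fin 4) ℝ := fun μ ν =>
  1 / (2 * Real.pi ^ 2 * mdot s.wave s.wave) *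
    (s.energyMomentum μ ν - (1 / 2) *
      (eta μ ν - lower s.wave μ * lower s.wave ν / mdot s.wave s.wave) *
        ∑ α, eta α α * s.energyMomentum α α)

/-- The spacelike neighbour `(ω, t K, d, 0)`, `t > 1`, of a lightlike wave `(ω, K, d, 0)`. -/
def stretch (s : WaveParam) (t : ℝ) : WaveParam := ⟨s.ω, t • s.K, s.d, 0⟩

/-- The amplitude of the metric perturbation of a laminar plane wave.  The linearized Einstein
equation is not invertible on lightlike modes; there the perturbation is the limit of those of the
spacelike waves `(ω, t K, d, 0)` as `t` decreases to `1`. -/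
def metric (s : WaveParam) : Matrix (Fin 4) (Fin 4) ℝ :=
  open Classical in
  if mdot s.wave s.wave = 0 then limUnder (𝓝[>] (1 : ℝ)) (fun t => (s.stretch t).nonNullMetric)
  else s.nonNullMetric

end WaveParam

/-- The space of physical laminar plane waves (with non-zero wave vector). -/
abbrev LaminarWave : Type := {s : WaveParam // s.IsPhysical}

/-- A distribution of defects in the weak-field continuum limit: a complex measure
`density · measure` on the space of physical laminar plane waves.  Energy densities of either sign
occur; as usual with plane waves, amplitudes are complex and physical fields are real parts. -/
structure DefectDistribution where
  measure : Measure LaminarWave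
  density : LaminarWave → ℂ
  integrable : Integrable density measure

namespace DefectDistribution

/-- The superposition `∫ F(s) dρ(s)`. -/
def superpose (ρ : DefectDistribution) (F : LaminarWave → Matrix (Fin 4) (Fin 4) ℂ) :
    Matrix (Fin 4) (Fin 4) ℂ := fun μ ν => ∫ s, ρ.density s * F s μ ν ∂ρ.measure

/-- The distribution consists of waves with wave vector `k` only. -/
def IsMode (ρ : DefectDistribution) (k : Fin 4 → ℝ) : Prop := ∀ᵐ s ∂ρ.measure, s.1.wave = k

/-- For a distribution with a single wave vector `k`: the amplitude `T_{μν}(k)`. -/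
def modeT (ρ : DefectDistribution) : Matrix (Fin 4) (Fin 4) ℂ :=
  ρ.superpose fun s => toC s.1.energyMomentum

/-- For a distribution with a single wave vector `k`: the amplitude `h_{μν}(k)`. -/
def modeH (ρ : DefectDistribution) : Matrix (Fin 4) (Fin 4) ℂ :=
  ρ.superpose fun s => toC s.1.metric

/-- The energy-momentum tensor field `T_{μν}(x)`. -/
def fieldT (ρ : DefectDistribution) (x : Fin 4 → ℝ) : Matrix (Fin 4) (Fin 4) ℂ :=
  ρ.superpose fun s => phase s.1.wave x • toC s.1.energyMomentum

/-- The metric perturbation field `h_{μν}(x)`. -/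
def fieldH (ρ : DefectDistribution) (x : Fin 4 → ℝ) : Matrix (Fin 4) (Fin 4) ℂ :=
  ρ.superpose fun s => phase s.1.wave x • toC s.1.metric

/-- The superposition defining the metric perturbation field converges absolutely. -/
def HasMetric (ρ : DefectDistribution) : Prop :=
  ∀ μ ν, Integrable (fun s => ρ.density s * toC s.1.metric μ ν) ρ.measure

/-- The moment `r₂₀ = ½ ∫ cos 2φ dρ`, where `d = -sin φ e₁ + cos φ e₂`. -/
def cosMoment (ρ : DefectDistribution) (e₁ e₂ : Fin 3 → ℝ) : ℂ :=
  (1 / 2) * ∫ s, ρ.density s * (((s.1.d ⬝ᵥ e₂) ^ 2 - (s.1.d ⬝ᵥ e₁) ^ 2 : ℝ) : ℂ) ∂ρ.measure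

/-- The moment `r̃₂₀ = ½ ∫ sin 2φ dρ`, where `d = -sin φ e₁ + cos φ e₂`. -/
def sinMoment (ρ : DefectDistribution) (e₁ e₂ : Fin 3 → ℝ) : ℂ :=
  (1 / 2) * ∫ s, ρ.density s * ((-2 * (s.1.d ⬝ᵥ e₁) * (s.1.d ⬝ᵥ e₂) : ℝ) : ℂ) ∂ρ.measure

end DefectDistribution

end LineDefects

end

noncomputable section

namespace LineDefects

/-! ### Algebra of plane-wave modes -/

/-! Everything is done one wave vector at a time. In the gauge `k^α H_{αν} = 0` the linearized Ricci
tensor of a mode is `2π² (k² H_{μν} + k_μ k_ν tr H)`. For `k² ≠ 0` this can be inverted by taking a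
trace, which gives uniqueness. Existence needs only conservation: both `u` and `d` are orthogonal to
`k`.

The light cone is where waves without source come from. There the speed bound forces `v = 0`, so `u
= k/ω` is null and the energy-momentum is `k_μ k_ν / ω²`, whatever the direction `d`
(`energyMomentum_of_null`). The metric amplitude does see `d`: it is `(P - d ⊗ d)/(2π²ω²)`, where
`P` is the projector to the plane transverse to `K` (`stretch_nonNullMetric`, `metric_of_null`).
Hence `T[ρ] = 0` says only that the total weight of `ρ` vanishes, while `h[ρ]` retains the second
moments of `d`, that is the averages of `cos 2φ` and `sin 2φ`, which are the coefficients of the two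
polarizations (`modeH_eq_polarizations`).

Conversely, a transverse-traceless `B` is produced by four directions at angles 0°, 90°, 45°, -45°
with weights proportional to `B(d,d)`: the weights add up to a multiple of the trace, which is zero,
and `∑ B(d,d) d ⊗ d = B` (`sum_coneDir_form`, `sum_coneDir_form_mul`). The frame is measurable in
`k`, so a whole family of amplitudes on the cone is realized at once (`exists_defectDistribution`);
a single mode is the case of a Dirac mass.

A vacuum mode is pure gauge if `k² ≠ 0`, and transverse-traceless plus gauge if `k² = 0` and `k ≠
0`. The gauge covector is given by one formula on both sets, `gaugeVec`, rational in `k` and linear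
in the amplitude. For a field, injectivity of the Fourier transform of finite measures turns the
vacuum equation into an equation for almost every `k` (`ae_eq_zero_of_integral_phase`). The
amplitude is then split into its gauge-fixed part on the cone, a gauge part, and a possible constant
from `k = 0`, which is the gauge term of a linear `ξ`. -/

theorem eta_apply_self_mul_self (μ : Fin 4) : eta μ μ * eta μ μ = 1 := by
  fin_cases μ <;> simp [eta]

theorem eta_apply_of_ne {μ ν : Fin 4} (h : μ ≠ ν) : eta μ ν = 0 := by
  simp [eta, h]

theorem lower_apply (v : Fin 4 → ℝ) (μ : Fin 4) : lower v μ = eta μ μ * v μ := by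
  simp [lower, eta, mulVec_diagonal]

@[simp] theorem lower_zero (v : Fin 4 → ℝ) : lower v 0 = -v 0 := by
  simp [lower_apply, eta]

@[simp] theorem lower_succ (v : Fin 4 → ℝ) (i : Fin 3) : lower v i.succ = v i.succ := by
  fin_cases i <;> simp [lower_apply, eta]

theorem eta_mul_lower (v : Fin 4 → ℝ) (μ : Fin 4) : eta μ μ * lower v μ = v μ := by
  rw [lower_apply, ← mul_assoc, eta_apply_self_mul_self, one_mul]

theorem mdot_eq (v w : Fin 4 → ℝ) :
    mdot v w = -(v 0 * w 0) + v 1 * w 1 + v 2 * w 2 + v 3 * w 3 := by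
  simp [mdot, dotProduct, Fin.sum_univ_four, lower_apply, eta]

theorem mdot_comm (v w : Fin 4 → ℝ) : mdot v w = mdot w v := by
  simp only [mdot_eq]; ring

theorem sum_mul_lower (v w : Fin 4 → ℝ) : ∑ α, v α * lower w α = mdot v w := by
  rw [mdot_comm, mdot, dotProduct]; exact Finset.sum_congr rfl fun α _ => mul_comm _ _

theorem sum_mul_lowerC (v w : Fin 4 → ℝ) : ∑ α, (v α : ℂ) * (lower w α : ℂ) = mdot v w := by
  exact_mod_cast congrArg (fun r : ℝ => (r : ℂ)) (sum_mul_lower v w)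

theorem sum_eta_mul_lower_mul_lowerC (k : Fin 4 → ℝ) :
    ∑ α, (eta α α : ℂ) * ((lower k α : ℂ) * (lower k α : ℂ)) = mdot k k := by
  rw [← sum_mul_lowerC]
  refine Finset.sum_congr rfl fun α _ => ?_
  rw [← eta_mul_lower k α]; push_cast; ring

theorem sum_eta_mul_eta : ∑ α, (eta α α : ℂ) * (eta α α : ℂ) = 4 := by
  have : ∀ α, (eta α α : ℂ) * (eta α α : ℂ) = 1 := fun α => by
    exact_mod_cast congrArg (fun r : ℝ => (r : ℂ)) (eta_apply_self_mul_self α)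
  simp [this]

theorem etaTrace_add (A B : Matrix (Fin 4) (Fin 4) ℂ) :
    etaTrace (A + B) = etaTrace A + etaTrace B := by
  simp [etaTrace, mul_add, Finset.sum_add_distrib]

theorem etaTrace_smul (c : ℂ) (A : Matrix (Fin 4) (Fin 4) ℂ) :
    etaTrace (c • A) = c * etaTrace A := by
  simp [etaTrace, Finset.mul_sum, mul_left_comm]

theorem etaTrace_toC_eta : etaTrace (toC eta) = 4 := sum_eta_mul_eta

theorem contract_add (k : Fin 4 → ℝ) (A B : Matrix (Fin 4) (Fin 4) ℂ) :
    contract k (A + B) = contract k A + contract k B := by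
  funext ν; simp [contract, mul_add, Finset.sum_add_distrib]

theorem contract_smul (k : Fin 4 → ℝ) (c : ℂ) (A : Matrix (Fin 4) (Fin 4) ℂ) :
    contract k (c • A) = c • contract k A := by
  funext ν; simp [contract, Finset.mul_sum, mul_left_comm]

theorem linRicciMode_add (k : Fin 4 → ℝ) (A B : Matrix (Fin 4) (Fin 4) ℂ) :
    linRicciMode k (A + B) = linRicciMode k A + linRicciMode k B := by
  ext μ ν
  simp only [linRicciMode, contract_add, etaTrace_add, Matrix.add_apply, Pi.add_apply]; ring

theorem linRicciMode_smul (k : Fin 4 → ℝ) (c : ℂ) (A : Matrix (Fin 4) (Fin 4) ℂ) :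
    linRicciMode k (c • A) = c • linRicciMode k A := by
  ext μ ν
  simp only [linRicciMode, contract_smul, etaTrace_smul, Matrix.smul_apply, Pi.smul_apply,
    smul_eq_mul]; ring

/-- An entry of the linearized Einstein tensor of a mode, as a linear functional. -/
def linEinsteinEntry (k : Fin 4 → ℝ) (μ ν : Fin 4) : Matrix (Fin 4) (Fin 4) ℂ →ₗ[ℂ] ℂ where
  toFun H := linEinsteinMode k H μ ν
  map_add' A B := by
    simp only [linEinsteinMode, linRicciMode_add, etaTrace_add, Matrix.add_apply,
      Matrix.sub_apply, Matrix.smul_apply, smul_eq_mul]; ring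
  map_smul' c A := by
    simp only [linEinsteinMode, linRicciMode_smul, etaTrace_smul,
      Matrix.sub_apply, Matrix.smul_apply, smul_eq_mul, RingHom.id_apply]; ring

/-- An entry of the contraction with `k`, as a linear functional. -/
def contractEntry (k : Fin 4 → ℝ) (ν : Fin 4) : Matrix (Fin 4) (Fin 4) ℂ →ₗ[ℂ] ℂ where
  toFun H := contract k H ν
  map_add' A B := by rw [contract_add, Pi.add_apply]
  map_smul' c A := by rw [contract_smul]; rfl

theorem linEinsteinMode_sub (k : Fin 4 → ℝ) (A B : Matrix (Fin 4) (Fin 4) ℂ) :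
    linEinsteinMode k (A - B) = linEinsteinMode k A - linEinsteinMode k B := by
  ext μ ν; exact (linEinsteinEntry k μ ν).map_sub A B

theorem contract_sub (k : Fin 4 → ℝ) (A B : Matrix (Fin 4) (Fin 4) ℂ) :
    contract k (A - B) = contract k A - contract k B := by
  ext ν; exact (contractEntry k ν).map_sub A B

/-- A mode with vanishing linearized Einstein tensor has vanishing linearized Ricci tensor. -/
theorem linRicciMode_eq_zero {k : Fin 4 → ℝ} {H : Matrix (Fin 4) (Fin 4) ℂ}
    (h : linEinsteinMode k H = 0) : linRicciMode k H = 0 := by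
  have ht : etaTrace (linRicciMode k H) = 0 := by
    have h1 : linRicciMode k H = ((1 / 2 : ℂ) * etaTrace (linRicciMode k H)) • toC eta :=
      sub_eq_zero.mp h
    have h2 := congrArg etaTrace h1
    rw [etaTrace_smul, etaTrace_toC_eta] at h2
    linear_combination -h2
  rw [linEinsteinMode, ht] at h
  simpa using h

theorem linRicciMode_of_contract_eq_zero {k : Fin 4 → ℝ} {H : Matrix (Fin 4) (Fin 4) ℂ}
    (h : contract k H = 0) (μ ν : Fin 4) : linRicciMode k H μ ν =
      2 * (Real.pi : ℂ) ^ 2 * ((mdot k k : ℂ) * H μ ν + lower k μ * lower k ν * etaTrace H) := by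
  simp only [linRicciMode, h, Pi.zero_apply]; ring

theorem etaTrace_linRicciMode_of_contract_eq_zero {k : Fin 4 → ℝ}
    {H : Matrix (Fin 4) (Fin 4) ℂ} (h : contract k H = 0) : etaTrace (linRicciMode k H) =
      4 * (Real.pi : ℂ) ^ 2 * (mdot k k : ℂ) * etaTrace H := by
  have h1 : etaTrace (linRicciMode k H) = 2 * (Real.pi : ℂ) ^ 2 * ((mdot k k : ℂ) * etaTrace H +
      (∑ α, (eta α α : ℂ) * ((lower k α : ℂ) * (lower k α : ℂ))) * etaTrace H) := by
    rw [etaTrace]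
    simp only [linRicciMode_of_contract_eq_zero h]
    simp only [etaTrace, Fin.sum_univ_four]
    ring
  rw [h1, sum_eta_mul_lower_mul_lowerC]; ring

theorem pi_sq_ne_zero : (Real.pi : ℂ) ^ 2 ≠ 0 :=
  pow_ne_zero _ (by exact_mod_cast Real.pi_ne_zero)

/-- Non-null vacuum modes in the gauge `k^α H_{αν} = 0` vanish. -/
theorem eq_zero_of_linEinsteinMode_eq_zero {k : Fin 4 → ℝ} {H : Matrix (Fin 4) (Fin 4) ℂ}
    (hk : mdot k k ≠ 0) (hc : contract k H = 0) (h : linEinsteinMode k H = 0) : H = 0 := by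
  have hR := linRicciMode_eq_zero h
  have hk' : (mdot k k : ℂ) ≠ 0 := by exact_mod_cast hk
  have ht : etaTrace H = 0 := by
    have h1 := etaTrace_linRicciMode_of_contract_eq_zero hc
    rw [hR] at h1
    have h0 : etaTrace (0 : Matrix (Fin 4) (Fin 4) ℂ) = 0 := by simp [etaTrace]
    rw [h0] at h1
    have h2 : 4 * (Real.pi : ℂ) ^ 2 * (mdot k k : ℂ) ≠ 0 :=
      mul_ne_zero (mul_ne_zero (by norm_num) pi_sq_ne_zero) hk'
    exact (mul_eq_zero.mp h1.symm).resolve_left h2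
  ext μ ν
  have h1 := linRicciMode_of_contract_eq_zero hc μ ν
  rw [hR, ht] at h1
  have h2 : 2 * (Real.pi : ℂ) ^ 2 * (mdot k k : ℂ) ≠ 0 :=
    mul_ne_zero (mul_ne_zero (by norm_num) pi_sq_ne_zero) hk'
  refine (mul_eq_zero.mp (?_ : 2 * (Real.pi : ℂ) ^ 2 * (mdot k k : ℂ) * H μ ν = 0)).resolve_left h2
  rw [Matrix.zero_apply] at h1
  linear_combination -h1

/-- The covector `ξ` recovered from `H = k ξ + ξ k`. -/
def gaugeVec (k : Fin 4 → ℝ) (H : Matrix (Fin 4) (Fin 4) ℂ) : Fin 4 → ℂ := fun ν =>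
  ((k ⬝ᵥ k : ℝ) : ℂ)⁻¹ * (∑ α, (lower k α : ℂ) * H α ν -
    lower k ν * (((k ⬝ᵥ k : ℝ) : ℂ)⁻¹ / 2 *
      ∑ α, ∑ β, (lower k α : ℂ) * (lower k β : ℂ) * H α β))

/-- The part of a mode that is left when the gauge term `gaugeVec` is removed. -/
def gaugeFixed (k : Fin 4 → ℝ) (H : Matrix (Fin 4) (Fin 4) ℂ) : Matrix (Fin 4) (Fin 4) ℂ :=
  H - gaugeMode k (gaugeVec k H)

theorem gaugeMode_isSymm (k : Fin 4 → ℝ) (ξ : Fin 4 → ℂ) : (gaugeMode k ξ).IsSymm := by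
  ext μ ν; simp only [transpose_apply, gaugeMode]; ring

theorem gaugeVec_add (k : Fin 4 → ℝ) (A B : Matrix (Fin 4) (Fin 4) ℂ) :
    gaugeVec k (A + B) = gaugeVec k A + gaugeVec k B := by
  funext ν
  simp only [gaugeVec, Matrix.add_apply, mul_add, Finset.sum_add_distrib, Pi.add_apply]
  ring

theorem dotProduct_self_lower (k : Fin 4 → ℝ) : ∑ α, lower k α * lower k α = k ⬝ᵥ k := by
  simp [Fin.sum_univ_four, lower_apply, eta, dotProduct]

theorem dotProduct_self_ne_zero {n : ℕ} {k : Fin n → ℝ} (hk : k ≠ 0) : k ⬝ᵥ k ≠ 0 := by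
  rwa [Ne, dotProduct_self_eq_zero]

/-- With `l` the lowered `k`, contracting a gauge mode once with `l` in the Euclidean product gives
`|k|² ξ + (l·ξ) l`, and contracting twice gives `2|k|² (l·ξ)`; these are solved for `ξ`. The
Euclidean norm is used because it does not degenerate on the light cone. -/
theorem gaugeVec_gaugeMode {k : Fin 4 → ℝ} (hk : k ≠ 0) (ξ : Fin 4 → ℂ) :
    gaugeVec k (gaugeMode k ξ) = ξ := by
  have hN : ((k ⬝ᵥ k : ℝ) : ℂ) ≠ 0 := by exact_mod_cast dotProduct_self_ne_zero hk
  have hs : ∑ α, (lower k α : ℂ) * (lower k α : ℂ) = ((k ⬝ᵥ k : ℝ) : ℂ) := by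
    exact_mod_cast congrArg (fun r : ℝ => (r : ℂ)) (dotProduct_self_lower k)
  set N : ℂ := ((k ⬝ᵥ k : ℝ) : ℂ) with hNdef
  set l : Fin 4 → ℂ := fun α => (lower k α : ℂ)
  change ∑ α, l α * l α = N at hs
  have h1 : ∀ ν, ∑ α, l α * gaugeMode k ξ α ν = N * ξ ν + (∑ α, l α * ξ α) * l ν := by
    intro ν
    rw [← hs, Finset.sum_mul, Finset.sum_mul, ← Finset.sum_add_distrib]
    refine Finset.sum_congr rfl fun α _ => ?_
    simp only [gaugeMode, l]; ring
  have h2 : ∑ α, ∑ β, l α * l β * gaugeMode k ξ α β = 2 * N * ∑ α, l α * ξ α := by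
    rw [Finset.sum_comm]
    have : ∀ β, ∑ α, l α * l β * gaugeMode k ξ α β =
        l β * ξ β * N + (∑ α, l α * ξ α) * (l β * l β) := by
      intro β
      have := congrArg (l β * ·) (h1 β)
      simp only [Finset.mul_sum] at this
      calc _ = ∑ i, l β * (l i * gaugeMode k ξ i β) :=
            Finset.sum_congr rfl fun _ _ => by ring
        _ = _ := by rw [this]; ring
    rw [Finset.sum_congr rfl fun β _ => this β, Finset.sum_add_distrib, ← Finset.sum_mul,
      ← Finset.mul_sum, hs]
    ring
  funext ν
  change N⁻¹ * (∑ α, l α * gaugeMode k ξ α ν - l ν * (N⁻¹ / 2 *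
      ∑ α, ∑ β, l α * l β * gaugeMode k ξ α β)) = ξ ν
  rw [h1, h2]
  field_simp
  ring

theorem contract_gaugeMode (k : Fin 4 → ℝ) (ξ : Fin 4 → ℂ) (ν : Fin 4) :
    contract k (gaugeMode k ξ) ν =
      mdot k k * ξ ν + (∑ α, (k α : ℂ) * ξ α) * lower k ν := by
  rw [← sum_mul_lowerC, contract, Finset.sum_mul, Finset.sum_mul, ← Finset.sum_add_distrib]
  refine Finset.sum_congr rfl fun α _ => ?_
  simp only [gaugeMode]; ring

theorem etaTrace_gaugeMode (k : Fin 4 → ℝ) (ξ : Fin 4 → ℂ) :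
    etaTrace (gaugeMode k ξ) = 2 * ∑ α, (k α : ℂ) * ξ α := by
  rw [etaTrace, Finset.mul_sum]
  refine Finset.sum_congr rfl fun α _ => ?_
  rw [← eta_mul_lower k α]
  simp only [gaugeMode]; push_cast; ring

/-- Gauge modes solve the vacuum equation. -/
theorem linRicciMode_gaugeMode (k : Fin 4 → ℝ) (ξ : Fin 4 → ℂ) :
    linRicciMode k (gaugeMode k ξ) = 0 := by
  ext μ ν
  simp only [linRicciMode, contract_gaugeMode, etaTrace_gaugeMode, gaugeMode, Matrix.zero_apply]
  ring

/-- The vacuum equation expresses `k² H` through `k_μ k^α H_{αν}`, its transpose and `k_μ k_ν tr H`,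
all of them gauge modes. Division by `k²` gives the witness; the trace term is shared equally
between the two factors. -/
theorem gaugeMode_of_nonNull {k : Fin 4 → ℝ} (hk : mdot k k ≠ 0) {H : Matrix (Fin 4) (Fin 4) ℂ}
    (hR : linRicciMode k H = 0) : ∃ ξ, H = gaugeMode k ξ := by
  have hk' : (mdot k k : ℂ) ≠ 0 := by exact_mod_cast hk
  refine ⟨fun ν => (mdot k k : ℂ)⁻¹ * (contract k H ν - lower k ν * etaTrace H / 2), ?_⟩
  ext μ ν
  have h1 := congrFun (congrFun hR μ) ν
  have h2 : -(2 * (Real.pi : ℂ) ^ 2) ≠ 0 := neg_ne_zero.mpr (mul_ne_zero (by norm_num) pi_sq_ne_zero)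
  have h3 := (mul_eq_zero.mp h1).resolve_left h2
  simp only [gaugeMode]
  field_simp
  linear_combination -2 * h3

theorem zero_ne_zero_of_null {k : Fin 4 → ℝ} (hk : mdot k k = 0) (h0 : k ≠ 0) : k 0 ≠ 0 := by
  intro h
  apply h0
  rw [mdot_eq, h] at hk
  have h1 : k 1 = 0 := by nlinarith [sq_nonneg (k 1), sq_nonneg (k 2), sq_nonneg (k 3)]
  have h2 : k 2 = 0 := by nlinarith [sq_nonneg (k 1), sq_nonneg (k 2), sq_nonneg (k 3)]
  have h3 : k 3 = 0 := by nlinarith [sq_nonneg (k 1), sq_nonneg (k 2), sq_nonneg (k 3)]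
  funext i; fin_cases i <;> assumption

/-- On the cone `k 0 ≠ 0`, so a gauge term can remove all components `H_{0ν}`. The `00` component of
the vacuum equation then kills the trace, and the `0ν` components give transversality. -/
theorem transverseTraceless_add_gaugeMode {k : Fin 4 → ℝ} (hk : mdot k k = 0) (h0 : k ≠ 0)
    {H : Matrix (Fin 4) (Fin 4) ℂ} (hs : H.IsSymm) (hR : linRicciMode k H = 0) :
    ∃ B ∈ transverseTraceless k, ∃ ξ, H = B + gaugeMode k ξ := by
  have hw := zero_ne_zero_of_null hk h0
  have hw' : (k 0 : ℂ) ≠ 0 := by exact_mod_cast hw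
  -- This solves `H_{0ν} = k_0 ξ_ν + ξ_0 k_ν`: first for `ξ_0` at `ν = 0`, then for the rest. The
  -- signs come from `k_0 = -k^0`.
  set ξ : Fin 4 → ℂ := fun ν => -H 0 ν / k 0 - H 0 0 * lower k ν / (2 * (k 0 : ℂ) ^ 2) with hξ
  have hB0 : ∀ ν, (H - gaugeMode k ξ) 0 ν = 0 := by
    intro ν
    simp only [Matrix.sub_apply, gaugeMode, hξ, lower_zero]
    push_cast
    field_simp
    ring
  have hBs : (H - gaugeMode k ξ).IsSymm := hs.sub (gaugeMode_isSymm k ξ)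
  set B := H - gaugeMode k ξ with hB
  have hHB : H = B + gaugeMode k ξ := by rw [hB, sub_add_cancel]
  have hRB : linRicciMode k B = 0 := by
    rw [hHB, linRicciMode_add, linRicciMode_gaugeMode, add_zero] at hR; exact hR
  have h2 : -(2 * (Real.pi : ℂ) ^ 2) ≠ 0 := neg_ne_zero.mpr (mul_ne_zero (by norm_num) pi_sq_ne_zero)
  have hc0 : contract k B 0 = 0 := by
    simp only [contract]
    exact Finset.sum_eq_zero fun α _ => by rw [← hBs.apply, hB0, mul_zero]
  have key : ∀ ν, lower k 0 * contract k B ν - lower k 0 * lower k ν * etaTrace B = 0 := by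
    intro ν
    have h3 := (mul_eq_zero.mp (congrFun (congrFun hRB 0) ν)).resolve_left h2
    rw [hc0, hk, hB0] at h3
    push_cast at h3 ⊢
    linear_combination h3
  have ht : etaTrace B = 0 := by
    have := key 0
    rw [hc0, lower_zero] at this
    push_cast at this
    have h4 : (k 0 : ℂ) ^ 2 * etaTrace B = 0 := by linear_combination -this
    exact (mul_eq_zero.mp h4).resolve_left (pow_ne_zero _ hw')
  refine ⟨B, ⟨hBs, hB0, ?_, ht⟩, ξ, hHB⟩
  funext ν
  have := key ν
  rw [ht, lower_zero] at this
  push_cast at this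
  have h4 : (k 0 : ℂ) * contract k B ν = 0 := by linear_combination -this
  exact (mul_eq_zero.mp h4).resolve_left hw'

/-- For a purely spatial tensor, raising or lowering the index of `k` makes no difference, so the
Euclidean contractions in `gaugeVec` vanish by Minkowski transversality. -/
theorem gaugeVec_of_transverseTraceless {k : Fin 4 → ℝ} {B : Matrix (Fin 4) (Fin 4) ℂ}
    (hB : B ∈ transverseTraceless k) : gaugeVec k B = 0 := by
  obtain ⟨-, h0, hc, -⟩ := hB
  have h1 : ∀ ν, ∑ α, (lower k α : ℂ) * B α ν = 0 := by
    intro ν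
    have := congrFun hc ν
    simp only [contract, Fin.sum_univ_succ (n := 3), h0, mul_zero, zero_add, Pi.zero_apply] at this
    simpa only [Fin.sum_univ_succ (n := 3), h0, mul_zero, zero_add, lower_succ] using this
  funext ν
  have h2 : ∑ α, ∑ β, (lower k α : ℂ) * (lower k β : ℂ) * B α β = 0 := by
    rw [Finset.sum_comm]
    refine Finset.sum_eq_zero fun β _ => ?_
    rw [← mul_zero (lower k β : ℂ), ← h1 β, Finset.mul_sum]
    exact Finset.sum_congr rfl fun α _ => by ring
  simp [gaugeVec, h1, h2]

theorem gaugeFixed_of_nonNull {k : Fin 4 → ℝ} (hk : mdot k k ≠ 0)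
    {H : Matrix (Fin 4) (Fin 4) ℂ} (h : linRicciMode k H = 0) : gaugeFixed k H = 0 := by
  obtain ⟨ξ, rfl⟩ := gaugeMode_of_nonNull hk h
  have h0 : k ≠ 0 := by rintro rfl; simp [mdot_eq] at hk
  rw [gaugeFixed, gaugeVec_gaugeMode h0, sub_self]

/-- `gaugeVec` is additive, kills the transverse-traceless part and inverts `gaugeMode`. The
explicit `gaugeFixed` therefore recovers exactly the part `B` of the existential decomposition, with
no measurable selection needed later. -/
theorem gaugeFixed_mem_transverseTraceless {k : Fin 4 → ℝ} (hk : mdot k k = 0) (h0 : k ≠ 0)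
    {H : Matrix (Fin 4) (Fin 4) ℂ} (hs : H.IsSymm) (h : linRicciMode k H = 0) :
    gaugeFixed k H ∈ transverseTraceless k := by
  obtain ⟨B, hB, ξ, rfl⟩ := transverseTraceless_add_gaugeMode hk h0 hs h
  rw [gaugeFixed, gaugeVec_add, gaugeVec_of_transverseTraceless hB, zero_add,
    gaugeVec_gaugeMode h0, add_sub_cancel_right]
  exact hB

/-! ### Laminar waves -/

@[simp] theorem fourVec_apply_zero (t : ℝ) (a : Fin 3 → ℝ) : fourVec t a 0 = t := rfl

@[simp] theorem fourVec_apply_succ (t : ℝ) (a : Fin 3 → ℝ) (i : Fin 3) :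
    fourVec t a i.succ = a i := rfl

@[simp] theorem eta_zero_zero : eta 0 0 = -1 := by simp [eta]

@[simp] theorem eta_zero_succ (i : Fin 3) : eta 0 i.succ = 0 :=
  eta_apply_of_ne (Fin.succ_ne_zero i).symm

@[simp] theorem eta_succ_zero (i : Fin 3) : eta i.succ 0 = 0 :=
  eta_apply_of_ne (Fin.succ_ne_zero i)

@[simp] theorem eta_succ_succ (i j : Fin 3) :
    eta i.succ j.succ = (1 : Matrix (Fin 3) (Fin 3) ℝ) i j := by
  fin_cases i <;> fin_cases j <;> simp [eta]

theorem mdot_fourVec (s t : ℝ) (a b : Fin 3 → ℝ) :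
    mdot (fourVec s a) (fourVec t b) = -(s * t) + a ⬝ᵥ b := by
  simp [mdot, dotProduct, Fin.sum_univ_succ (n := 3)]

theorem contract_toC (k : Fin 4 → ℝ) (A : Matrix (Fin 4) (Fin 4) ℝ) (ν : Fin 4) :
    contract k (toC A) ν = ((∑ α, k α * A α ν : ℝ) : ℂ) := by
  simp [contract, toC]

theorem etaTrace_toC (A : Matrix (Fin 4) (Fin 4) ℝ) :
    etaTrace (toC A) = ((∑ α, eta α α * A α α : ℝ) : ℂ) := by
  simp [etaTrace, toC]

theorem eta_comm (μ ν : Fin 4) : eta μ ν = eta ν μ := by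
  by_cases h : μ = ν
  · rw [h]
  · rw [eta_apply_of_ne h, eta_apply_of_ne (Ne.symm h)]

theorem abs_lower (v : Fin 4 → ℝ) (μ : Fin 4) : |lower v μ| = |v μ| := by
  refine Fin.cases ?_ (fun i => ?_) μ <;> simp

/-- The completeness relation of a pair of dual bases of `ℝ³`. -/
theorem sum_dual_eq_one {a b c a' b' c' : Fin 3 → ℝ}
    (h1 : a ⬝ᵥ a' = 1) (h2 : a ⬝ᵥ b' = 0) (h3 : a ⬝ᵥ c' = 0)
    (h4 : b ⬝ᵥ a' = 0) (h5 : b ⬝ᵥ b' = 1) (h6 : b ⬝ᵥ c' = 0)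
    (h7 : c ⬝ᵥ a' = 0) (h8 : c ⬝ᵥ b' = 0) (h9 : c ⬝ᵥ c' = 1) (i j : Fin 3) :
    a' i * a j + b' i * b j + c' i * c j = (1 : Matrix (Fin 3) (Fin 3) ℝ) i j := by
  have h : of ![a, b, c] * (of ![a', b', c'])ᵀ = 1 := by
    ext i j
    fin_cases i <;> fin_cases j
    exacts [h1, h2, h3, h4, h5, h6, h7, h8, h9]
  rw [mul_eq_one_comm] at h
  rw [← h, Matrix.mul_apply, Fin.sum_univ_three]
  rfl

/-- Completeness of an orthogonal frame `K, e₁, e₂` with `e₁, e₂` of unit length. -/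
theorem frame_complete {K e₁ e₂ : Fin 3 → ℝ} (hK : K ≠ 0) (h11 : e₁ ⬝ᵥ e₁ = 1)
    (h22 : e₂ ⬝ᵥ e₂ = 1) (h12 : e₁ ⬝ᵥ e₂ = 0) (h1 : K ⬝ᵥ e₁ = 0) (h2 : K ⬝ᵥ e₂ = 0)
    (i j : Fin 3) : K i * K j / (K ⬝ᵥ K) + e₁ i * e₁ j + e₂ i * e₂ j =
      (1 : Matrix (Fin 3) (Fin 3) ℝ) i j := by
  have hW := dotProduct_self_ne_zero hK
  have := sum_dual_eq_one (a := (K ⬝ᵥ K)⁻¹ • K) (b := e₁) (c := e₂) (a' := K) (b' := e₁) (c' := e₂)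
    (by simp [hW]) (by simp [h1]) (by simp [h2]) (by rw [dotProduct_comm, h1]) h11 h12
    (by rw [dotProduct_comm, h2]) (by rw [dotProduct_comm, h12]) h22 i j
  rw [← this]
  simp only [Pi.smul_apply, smul_eq_mul]
  ring

theorem cross_complete {K d : Fin 3 → ℝ} (hK : K ≠ 0) (hd : d ⬝ᵥ d = 1) (hKd : K ⬝ᵥ d = 0)
    (i j : Fin 3) : K i * K j / (K ⬝ᵥ K) + d i * d j +
      crossProduct K d i * crossProduct K d j / (K ⬝ᵥ K) =
      (1 : Matrix (Fin 3) (Fin 3) ℝ) i j := by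
  have hW := dotProduct_self_ne_zero hK
  have hc : crossProduct K d ⬝ᵥ crossProduct K d = K ⬝ᵥ K := by
    rw [cross_dot_cross, hd, hKd]; ring
  have hcK : crossProduct K d ⬝ᵥ K = 0 := by rw [dotProduct_comm, dot_self_cross]
  have hcd : crossProduct K d ⬝ᵥ d = 0 := by rw [dotProduct_comm, dot_cross_self]
  have := sum_dual_eq_one (a := (K ⬝ᵥ K)⁻¹ • K) (b := d) (c := (K ⬝ᵥ K)⁻¹ • crossProduct K d)
    (a' := K) (b' := d) (c' := crossProduct K d)
    (by simp [hW]) (by simp [hKd]) (by simp) (by rw [dotProduct_comm, hKd]) hd (by simp)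
    (by simp [hcK]) (by simp [hcd]) (by simp [hc, hW]) i j
  rw [← this]
  simp only [Pi.smul_apply, smul_eq_mul]
  ring

/-! ### Kinematics and amplitudes of a single laminar wave -/

namespace WaveParam

@[simp] theorem wave_zero (s : WaveParam) : s.wave 0 = s.ω := rfl
@[simp] theorem wave_succ (s : WaveParam) (i : Fin 3) : s.wave i.succ = s.K i := rfl
@[simp] theorem u_zero (s : WaveParam) : s.u 0 = 1 := rfl
@[simp] theorem u_succ (s : WaveParam) (i : Fin 3) : s.u i.succ = s.velocity i := rfl
@[simp] theorem dir_zero (s : WaveParam) : s.dir 0 = 0 := rfl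
@[simp] theorem dir_succ (s : WaveParam) (i : Fin 3) : s.dir i.succ = s.d i := rfl

theorem velocity_apply (s : WaveParam) (i : Fin 3) : s.velocity i =
    s.ω / (s.K ⬝ᵥ s.K) * s.K i + s.v / (s.K ⬝ᵥ s.K) * crossProduct s.K s.d i := rfl

theorem mdot_wave (s : WaveParam) : mdot s.wave s.wave = -s.ω ^ 2 + s.K ⬝ᵥ s.K := by
  rw [wave, mdot_fourVec]; ring

theorem mdot_dir (s : WaveParam) : mdot s.dir s.dir = s.d ⬝ᵥ s.d := by
  rw [dir, mdot_fourVec]; ring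

theorem energyMomentum_symm (s : WaveParam) (μ ν : Fin 4) :
    s.energyMomentum μ ν = s.energyMomentum ν μ := by
  simp only [energyMomentum]; ring

theorem trace_energyMomentum (s : WaveParam) (hd : s.d ⬝ᵥ s.d = 1) :
    ∑ α, eta α α * s.energyMomentum α α = 2 * mdot s.u s.u := by
  have h1 := sum_mul_lower s.u s.u
  have h2 := sum_mul_lower s.dir s.dir
  rw [mdot_dir, hd] at h2
  calc ∑ α, eta α α * s.energyMomentum α α
      = ∑ α, s.u α * lower s.u α + mdot s.u s.u * ∑ α, s.dir α * lower s.dir α := by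
        rw [Finset.mul_sum, ← Finset.sum_add_distrib]
        refine Finset.sum_congr rfl fun α _ => ?_
        rw [← eta_mul_lower s.u α, ← eta_mul_lower s.dir α]
        simp only [energyMomentum]; ring
    _ = _ := by rw [h1, h2]; ring

theorem nonNullMetric_apply (s : WaveParam) (hd : s.d ⬝ᵥ s.d = 1) (μ ν : Fin 4) :
    s.nonNullMetric μ ν = 1 / (2 * Real.pi ^ 2 * mdot s.wave s.wave) *
      (s.energyMomentum μ ν - (eta μ ν - lower s.wave μ * lower s.wave ν / mdot s.wave s.wave) *
        mdot s.u s.u) := by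
  rw [nonNullMetric, trace_energyMomentum s hd]; ring


theorem dot_self_pos {s : WaveParam} (hs : s.IsPhysical) : 0 < s.K ⬝ᵥ s.K :=
  lt_of_le_of_ne (by rw [dotProduct]; exact Finset.sum_nonneg fun i _ => mul_self_nonneg _)
    (dotProduct_self_ne_zero hs.1).symm

theorem K_dot_velocity {s : WaveParam} (hs : s.IsPhysical) : s.K ⬝ᵥ s.velocity = s.ω := by
  have := (dot_self_pos hs).ne'
  rw [velocity, dotProduct_add, dotProduct_smul, dotProduct_smul, dot_self_cross]
  simp [this]

theorem velocity_dot_velocity {s : WaveParam} (hs : s.IsPhysical) :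
    s.velocity ⬝ᵥ s.velocity = (s.ω ^ 2 + s.v ^ 2) / (s.K ⬝ᵥ s.K) := by
  have h := (dot_self_pos hs).ne'
  have hc : crossProduct s.K s.d ⬝ᵥ crossProduct s.K s.d = s.K ⬝ᵥ s.K := by
    rw [cross_dot_cross, hs.2.1, hs.2.2.1]; ring
  rw [velocity]
  simp only [dotProduct_add, add_dotProduct, dotProduct_smul, smul_dotProduct, dot_self_cross, hc,
    dotProduct_comm (crossProduct s.K s.d) s.K, smul_eq_mul]
  field_simp
  ring

theorem mdot_u {s : WaveParam} (hs : s.IsPhysical) :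
    mdot s.u s.u = -1 + (s.ω ^ 2 + s.v ^ 2) / (s.K ⬝ᵥ s.K) := by
  rw [u, mdot_fourVec, velocity_dot_velocity hs]; ring

theorem mdot_wave_u {s : WaveParam} (hs : s.IsPhysical) : mdot s.wave s.u = 0 := by
  rw [u, wave, mdot_fourVec, K_dot_velocity hs]; ring

theorem mdot_wave_dir {s : WaveParam} (hs : s.IsPhysical) : mdot s.wave s.dir = 0 := by
  rw [dir, wave, mdot_fourVec, hs.2.2.1]; ring

/-- Conservation holds because `u` and `d` are both orthogonal to `k`: the velocity has component
`ω/|K|` along `K`, so the density pattern is carried along with the defects. -/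
theorem contract_energyMomentum {s : WaveParam} (hs : s.IsPhysical) :
    contract s.wave (toC s.energyMomentum) = 0 := by
  funext ν
  have h1 := sum_mul_lower s.wave s.u
  have h2 := sum_mul_lower s.wave s.dir
  rw [mdot_wave_u hs] at h1
  rw [mdot_wave_dir hs] at h2
  have : ∑ α, s.wave α * s.energyMomentum α ν = 0 := by
    calc _ = (∑ α, s.wave α * lower s.u α) * lower s.u ν +
          mdot s.u s.u * (∑ α, s.wave α * lower s.dir α) * lower s.dir ν := by
          rw [Finset.mul_sum, Finset.sum_mul, Finset.sum_mul, ← Finset.sum_add_distrib]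
          refine Finset.sum_congr rfl fun α _ => ?_
          simp only [energyMomentum]; ring
      _ = 0 := by rw [h1, h2]; ring
  rw [contract_toC, this]; simp

theorem etaTrace_energyMomentum (s : WaveParam) (hd : s.d ⬝ᵥ s.d = 1) :
    etaTrace (toC s.energyMomentum) = 2 * (mdot s.u s.u : ℂ) := by
  rw [etaTrace_toC, trace_energyMomentum s hd]; push_cast; rfl

/-- The term `k_μ k_ν` is half the gauge mode with covector `k`, so the general formulas for
contraction and trace of a gauge mode apply to it. -/
theorem toC_nonNullMetric (s : WaveParam) (hd : s.d ⬝ᵥ s.d = 1) :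
    toC s.nonNullMetric = (1 / (2 * (Real.pi : ℂ) ^ 2 * mdot s.wave s.wave)) •
      (toC s.energyMomentum + (-(mdot s.u s.u : ℂ)) • toC eta +
        ((mdot s.u s.u : ℂ) / (2 * mdot s.wave s.wave)) •
          gaugeMode s.wave (fun ν => (lower s.wave ν : ℂ))) := by
  ext μ ν
  simp only [toC, map_apply, nonNullMetric_apply s hd, Matrix.smul_apply, Matrix.add_apply,
    gaugeMode, smul_eq_mul]
  push_cast
  ring

theorem contract_eta (k : Fin 4 → ℝ) (ν : Fin 4) : contract k (toC eta) ν = lower k ν := by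
  rw [contract, Finset.sum_eq_single ν, lower_apply]
  · simp [toC, mul_comm]
  · intro α _ h; simp [toC, eta_apply_of_ne h]
  · simp

theorem contract_nonNullMetric {s : WaveParam} (hs : s.IsPhysical)
    (hk : mdot s.wave s.wave ≠ 0) : contract s.wave (toC s.nonNullMetric) = 0 := by
  have hk' : (mdot s.wave s.wave : ℂ) ≠ 0 := by exact_mod_cast hk
  rw [toC_nonNullMetric s hs.2.1]
  funext ν
  simp only [contract_smul, contract_add, contract_energyMomentum hs, Pi.smul_apply, Pi.add_apply,
    contract_eta, contract_gaugeMode, sum_mul_lowerC, smul_eq_mul, Pi.zero_apply]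
  field_simp
  ring

theorem linEinsteinMode_nonNullMetric {s : WaveParam} (hs : s.IsPhysical)
    (hk : mdot s.wave s.wave ≠ 0) :
    linEinsteinMode s.wave (toC s.nonNullMetric) = toC s.energyMomentum := by
  have hk' : (mdot s.wave s.wave : ℂ) ≠ 0 := by exact_mod_cast hk
  have hpi := pi_sq_ne_zero
  have hc := contract_nonNullMetric hs hk
  have ht : etaTrace (toC s.nonNullMetric) =
      -(mdot s.u s.u : ℂ) / (2 * (Real.pi : ℂ) ^ 2 * mdot s.wave s.wave) := by
    rw [toC_nonNullMetric s hs.2.1]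
    simp only [etaTrace_smul, etaTrace_add, etaTrace_energyMomentum s hs.2.1, etaTrace_toC_eta,
      etaTrace_gaugeMode, sum_mul_lowerC]
    field_simp
    ring
  ext μ ν
  rw [linEinsteinMode, Matrix.sub_apply, Matrix.smul_apply,
    etaTrace_linRicciMode_of_contract_eq_zero hc, linRicciMode_of_contract_eq_zero hc, ht]
  rw [toC_nonNullMetric s hs.2.1]
  simp only [toC, map_apply, Matrix.smul_apply, Matrix.add_apply, gaugeMode, smul_eq_mul]
  field_simp
  ring

/-- The closed form of the metric amplitude of a lightlike wave: the projection to the spatial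
direction orthogonal to `K` and `d`, divided by `2π²ω²`. -/
def nullMetric (s : WaveParam) : Matrix (Fin 4) (Fin 4) ℝ := fun μ ν =>
  1 / (2 * Real.pi ^ 2 * s.ω ^ 2) * (eta μ ν + fourVec 1 0 μ * fourVec 1 0 ν -
    fourVec 0 s.K μ * fourVec 0 s.K ν / (s.K ⬝ᵥ s.K) - s.dir μ * s.dir ν)

theorem nullMetric_symm (s : WaveParam) (μ ν : Fin 4) : s.nullMetric μ ν = s.nullMetric ν μ := by
  simp only [nullMetric, eta_comm μ ν]; ring

@[simp] theorem nullMetric_zero_left (s : WaveParam) (ν : Fin 4) : s.nullMetric 0 ν = 0 := by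
  refine Fin.cases ?_ (fun j => ?_) ν <;> simp [nullMetric]

@[simp] theorem nullMetric_zero_right (s : WaveParam) (ν : Fin 4) : s.nullMetric ν 0 = 0 := by
  rw [nullMetric_symm, nullMetric_zero_left]

theorem nullMetric_succ (s : WaveParam) (i j : Fin 3) : s.nullMetric i.succ j.succ =
    1 / (2 * Real.pi ^ 2 * s.ω ^ 2) * ((1 : Matrix (Fin 3) (Fin 3) ℝ) i j -
      s.K i * s.K j / (s.K ⬝ᵥ s.K) - s.d i * s.d j) := by
  simp [nullMetric]

theorem stretch_ω (s : WaveParam) (t : ℝ) : (s.stretch t).ω = s.ω := rfl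
theorem stretch_K (s : WaveParam) (t : ℝ) : (s.stretch t).K = t • s.K := rfl
theorem stretch_d (s : WaveParam) (t : ℝ) : (s.stretch t).d = s.d := rfl

/-- The stretched wave has velocity `K/(ωt)`, hence `u² = -(t² - 1)/t²` and `k² = (t² - 1)ω²`. The
vanishing factor `t² - 1` cancels everywhere, leaving a fixed tensor times `t⁻²`, so the limit `t ↓
1` is immediate. -/
theorem stretch_nonNullMetric {s : WaveParam} (hs : s.IsPhysical) (hk : mdot s.wave s.wave = 0)
    {t : ℝ} (ht : 1 < t) :
    (s.stretch t).nonNullMetric = (1 / t ^ 2) • s.nullMetric := by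
  have hW := dot_self_pos hs
  have hω : s.ω ^ 2 = s.K ⬝ᵥ s.K := by rw [mdot_wave] at hk; linarith
  have hω0 : s.ω ≠ 0 := by rintro h; rw [h] at hω; simp at hω; exact hW.ne hω
  have ht0 : t ≠ 0 := by positivity
  have ht1 : t ^ 2 - 1 ≠ 0 := by nlinarith
  have hvel : ∀ i, (s.stretch t).velocity i = s.K i / (s.ω * t) := by
    intro i
    simp only [velocity_apply, stretch, smul_dotProduct, dotProduct_smul, smul_eq_mul, ← hω,
      Pi.smul_apply]
    field_simp
    ring
  have hu : mdot (s.stretch t).u (s.stretch t).u = -1 + 1 / t ^ 2 := by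
    have : (s.stretch t).velocity = (1 / (s.ω * t)) • s.K := by
      funext i; rw [hvel]; simp only [Pi.smul_apply, smul_eq_mul]; ring
    rw [u, mdot_fourVec, this, smul_dotProduct, dotProduct_smul, ← hω, smul_eq_mul, smul_eq_mul]
    field_simp
  have hq : mdot (s.stretch t).wave (s.stretch t).wave = (t ^ 2 - 1) * s.ω ^ 2 := by
    rw [mdot_wave]
    simp only [stretch, smul_dotProduct, dotProduct_smul, smul_eq_mul, ← hω]; ring
  have hd : (s.stretch t).d ⬝ᵥ (s.stretch t).d = 1 := hs.2.1
  have hpi := Real.pi_ne_zero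
  ext μ ν
  rw [nonNullMetric_apply _ hd, energyMomentum, hu, hq]
  refine Fin.cases ?_ (fun i => ?_) μ <;> refine Fin.cases ?_ (fun j => ?_) ν
  all_goals
    simp only [lower_zero, lower_succ, u_zero, u_succ, dir_zero, dir_succ, wave_zero, wave_succ,
      eta_zero_zero, eta_zero_succ, eta_succ_zero, eta_succ_succ, hvel, stretch_ω, stretch_K,
      stretch_d, Pi.smul_apply, smul_eq_mul, Matrix.smul_apply, nullMetric_zero_left,
      nullMetric_zero_right, nullMetric_succ, ← hω]
    field_simp
    ring

theorem mdot_stretch_ne_zero {s : WaveParam} (hs : s.IsPhysical) (hk : mdot s.wave s.wave = 0)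
    {t : ℝ} (ht : 1 < t) : mdot (s.stretch t).wave (s.stretch t).wave ≠ 0 := by
  have hW := dot_self_pos hs
  rw [mdot_wave] at hk ⊢
  simp only [stretch, smul_dotProduct, dotProduct_smul, smul_eq_mul]
  nlinarith [mul_pos hW (sub_pos.mpr ht)]

theorem tendsto_stretch_nonNullMetric {s : WaveParam} (hs : s.IsPhysical)
    (hk : mdot s.wave s.wave = 0) :
    Tendsto (fun t => (s.stretch t).nonNullMetric) (𝓝[>] (1 : ℝ)) (𝓝 s.nullMetric) := by
  have h1 : Tendsto (fun t : ℝ => (1 / t ^ 2) • s.nullMetric) (𝓝[>] (1 : ℝ))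
      (𝓝 ((1 / (1 : ℝ) ^ 2) • s.nullMetric)) := by
    refine Tendsto.smul_const (tendsto_nhdsWithin_of_tendsto_nhds ?_) _
    exact ContinuousAt.tendsto (f := fun t : ℝ => 1 / t ^ 2)
      (by fun_prop (disch := norm_num))
  rw [one_pow, div_one, one_smul] at h1
  refine h1.congr' ?_
  filter_upwards [self_mem_nhdsWithin] with t ht
  exact (stretch_nonNullMetric hs hk ht).symm

theorem metric_of_null {s : WaveParam} (hs : s.IsPhysical) (hk : mdot s.wave s.wave = 0) :
    s.metric = s.nullMetric := by
  rw [metric, if_pos hk]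
  exact (tendsto_stretch_nonNullMetric hs hk).limUnder_eq

theorem metric_of_nonNull {s : WaveParam} (hk : mdot s.wave s.wave ≠ 0) :
    s.metric = s.nonNullMetric := by
  rw [metric, if_neg hk]

theorem tendsto_stretch_metric {s : WaveParam} (hs : s.IsPhysical)
    (hk : mdot s.wave s.wave = 0) :
    Tendsto (fun t => (s.stretch t).metric) (𝓝[>] (1 : ℝ)) (𝓝 s.metric) := by
  rw [metric_of_null hs hk]
  refine (tendsto_stretch_nonNullMetric hs hk).congr' ?_
  filter_upwards [self_mem_nhdsWithin] with t ht
  rw [metric_of_nonNull (mdot_stretch_ne_zero hs hk ht)]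

theorem metric_symm {s : WaveParam} (hs : s.IsPhysical) (μ ν : Fin 4) :
    s.metric μ ν = s.metric ν μ := by
  by_cases hk : mdot s.wave s.wave = 0
  · rw [metric_of_null hs hk, nullMetric_symm]
  · rw [metric_of_nonNull hk]
    simp only [nonNullMetric, eta_comm μ ν, s.energyMomentum_symm μ ν]; ring

/-- At `ω² = |K|²` the speed bound leaves no room for `v`, the defects move with the speed of light
along `K`, and `u = k/ω` is null. The term with `d` carries the factor `u² = 0`, so the source is
blind to the direction of the defects. -/
theorem energyMomentum_of_null {s : WaveParam} (hs : s.IsPhysical) (hk : mdot s.wave s.wave = 0)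
    (μ ν : Fin 4) : s.energyMomentum μ ν = lower s.wave μ * lower s.wave ν / s.ω ^ 2 := by
  have hW := dot_self_pos hs
  have hω : s.ω ^ 2 = s.K ⬝ᵥ s.K := by rw [mdot_wave] at hk; linarith
  have hω0 : s.ω ≠ 0 := by rintro h; rw [h] at hω; simp at hω; exact hW.ne hω
  have hv : s.v = 0 := by
    have := hs.2.2.2.2
    rw [hω] at this
    nlinarith
  have hu : mdot s.u s.u = 0 := by
    rw [mdot_u hs, hv, ← hω]; field_simp; ring
  have hvel : ∀ i, s.velocity i = s.K i / s.ω := by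
    intro i
    rw [velocity_apply, hv, ← hω]; field_simp; ring
  rw [energyMomentum, hu]
  refine Fin.cases ?_ (fun i => ?_) μ <;> refine Fin.cases ?_ (fun j => ?_) ν <;>
    simp [hvel] <;> field_simp

theorem contract_metric {s : WaveParam} (hs : s.IsPhysical) :
    contract s.wave (toC s.metric) = 0 := by
  by_cases hk : mdot s.wave s.wave = 0
  · rw [metric_of_null hs hk]
    funext ν
    refine Fin.cases ?_ (fun j => ?_) ν
    · simp [contract, toC]
    · have hW := (dot_self_pos hs).ne'
      have h0 : ∑ i, s.K i * s.nullMetric i.succ j.succ = 0 := by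
        have h1 : ∑ i, s.K i * (1 : Matrix (Fin 3) (Fin 3) ℝ) i j = s.K j := by
          simp [Matrix.one_apply]
        calc _ = 1 / (2 * Real.pi ^ 2 * s.ω ^ 2) *
              ((∑ i, s.K i * (1 : Matrix (Fin 3) (Fin 3) ℝ) i j) -
                (s.K ⬝ᵥ s.K) * s.K j / (s.K ⬝ᵥ s.K) - (s.K ⬝ᵥ s.d) * s.d j) := by
              simp only [nullMetric_succ, dotProduct, Fin.sum_univ_three]; ring
          _ = 0 := by rw [h1, hs.2.2.1]; field_simp; ring
      have h2 : ∑ α, s.wave α * s.nullMetric α j.succ = 0 := by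
        rw [Fin.sum_univ_succ]; simpa using h0
      rw [contract_toC, h2]; simp
  · rw [metric_of_nonNull hk, contract_nonNullMetric hs hk]

theorem etaTrace_nullMetric {s : WaveParam} (hs : s.IsPhysical) :
    etaTrace (toC s.nullMetric) = 1 / (2 * (Real.pi : ℂ) ^ 2 * s.ω ^ 2) := by
  have hW := (dot_self_pos hs).ne'
  have h : ∑ α, eta α α * s.nullMetric α α = 1 / (2 * Real.pi ^ 2 * s.ω ^ 2) := by
    rw [Fin.sum_univ_succ]
    calc _ = 1 / (2 * Real.pi ^ 2 * s.ω ^ 2) *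
        (3 - (s.K ⬝ᵥ s.K) / (s.K ⬝ᵥ s.K) - s.d ⬝ᵥ s.d) := by
          simp only [nullMetric_succ, nullMetric_zero_left, eta_succ_succ, Matrix.one_apply_eq,
            dotProduct, Fin.sum_univ_three]; ring
      _ = _ := by rw [div_self hW, hs.2.1]; ring
  rw [etaTrace_toC, h]; push_cast; rfl

/-- On the cone only `2π² k_μ k_ν tr h` survives of the Ricci tensor, and its trace vanishes. Since
`h` is `1/(2π²ω²)` times a projector of rank one, this is `k_μ k_ν / ω²`, the energy-momentum of a
lightlike wave. -/
theorem linEinsteinMode_metric {s : WaveParam} (hs : s.IsPhysical) :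
    linEinsteinMode s.wave (toC s.metric) = toC s.energyMomentum := by
  by_cases hk : mdot s.wave s.wave = 0
  · have hc := contract_metric hs
    have ht := etaTrace_nullMetric hs
    rw [← metric_of_null hs hk] at ht
    have hpi := pi_sq_ne_zero
    ext μ ν
    rw [linEinsteinMode, Matrix.sub_apply, Matrix.smul_apply,
      etaTrace_linRicciMode_of_contract_eq_zero hc, linRicciMode_of_contract_eq_zero hc, ht, hk]
    simp only [toC, map_apply, energyMomentum_of_null hs hk]
    push_cast
    field_simp
    simp
  · rw [metric_of_nonNull hk, linEinsteinMode_nonNullMetric hs hk]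

/-- The components of the metric amplitude of a spacelike wave transverse to `K`. -/
theorem transverse_nonNullMetric {s : WaveParam} (hs : s.IsPhysical)
    (hk : mdot s.wave s.wave ≠ 0) (i j : Fin 3) :
    s.nonNullMetric i.succ j.succ + s.ω / (s.K ⬝ᵥ s.K) *
        (s.K i * s.nonNullMetric 0 j.succ + s.K j * s.nonNullMetric 0 i.succ) +
      s.ω ^ 2 * (s.K i * s.K j) / (s.K ⬝ᵥ s.K) ^ 2 * s.nonNullMetric 0 0 =
    1 / (2 * Real.pi ^ 2 * (s.K ⬝ᵥ s.K)) * ((1 : Matrix (Fin 3) (Fin 3) ℝ) i j -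
      s.K i * s.K j / (s.K ⬝ᵥ s.K) - s.d i * s.d j) := by
  have hW := (dot_self_pos hs).ne'
  have hpi := Real.pi_ne_zero
  -- The left side is `h` on the vectors `e_i + (ω K_i/|K|²) e_0`. On these `k` is proportional to
  -- `k²` and `u` reduces to its part along `K × d`. Resolving the identity along `K`, `d`, `K × d`
  -- leaves only the last direction, with a factor `k²` that cancels the pole, and `v` drops out.
  have hc := cross_complete hs.1 hs.2.1 hs.2.2.1 i j
  have hu := mdot_u hs
  simp only [nonNullMetric_apply s hs.2.1, energyMomentum, lower_zero, lower_succ, u_zero, u_succ,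
    dir_zero, dir_succ, wave_zero, wave_succ, eta_zero_zero, eta_zero_succ, eta_succ_succ,
    velocity_apply, hu, ← hc]
  rw [mdot_wave] at hk ⊢
  generalize crossProduct s.K s.d i = a
  generalize crossProduct s.K s.d j = b
  generalize s.K ⬝ᵥ s.K = W at *
  have hk2 : W - s.ω ^ 2 ≠ 0 := by intro h; apply hk; linarith
  have : -s.ω ^ 2 + W = W - s.ω ^ 2 := by ring
  rw [this]
  field_simp
  ring

end WaveParam

/-! ### Limits of spacelike waves -/

namespace WaveParam

theorem continuous_tuple : Continuous tuple := continuous_induced_dom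

@[fun_prop] theorem continuous_ω : Continuous (fun s : LaminarWave => s.1.ω) :=
  (continuous_fst.comp continuous_tuple).comp continuous_subtype_val

@[fun_prop] theorem continuous_K (i : Fin 3) : Continuous (fun s : LaminarWave => s.1.K i) :=
  ((continuous_apply i).comp (continuous_fst.comp (continuous_snd.comp continuous_tuple))).comp
    continuous_subtype_val

@[fun_prop] theorem continuous_d (i : Fin 3) : Continuous (fun s : LaminarWave => s.1.d i) :=
  ((continuous_apply i).comp (continuous_fst.comp (continuous_snd.comp
    (continuous_snd.comp continuous_tuple)))).comp continuous_subtype_val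

theorem measurable_tuple : Measurable tuple := comap_measurable _

@[fun_prop] theorem measurable_ω : Measurable (fun s : LaminarWave => s.1.ω) :=
  (measurable_fst.comp measurable_tuple).comp measurable_subtype_coe

@[fun_prop] theorem measurable_K (i : Fin 3) : Measurable (fun s : LaminarWave => s.1.K i) :=
  ((measurable_pi_apply i).comp (measurable_fst.comp (measurable_snd.comp measurable_tuple))).comp
    measurable_subtype_coe

@[fun_prop] theorem measurable_d (i : Fin 3) : Measurable (fun s : LaminarWave => s.1.d i) :=
  ((measurable_pi_apply i).comp (measurable_fst.comp (measurable_snd.comp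
    (measurable_snd.comp measurable_tuple)))).comp measurable_subtype_coe

@[fun_prop] theorem measurable_v : Measurable (fun s : LaminarWave => s.1.v) :=
  (measurable_snd.comp (measurable_snd.comp (measurable_snd.comp measurable_tuple))).comp
    measurable_subtype_coe

/-- A limit of metric amplitudes of spacelike waves at a lightlike wave agrees with the metric
amplitude of that wave up to a residual gauge term. -/
theorem limit_metric_eq_add_gaugeMode (s : LaminarWave) (hk : mdot s.1.wave s.1.wave = 0)
    (σ : ℕ → LaminarWave) (hσ : ∀ n, 0 < mdot (σ n).1.wave (σ n).1.wave)
    (hlim : Tendsto σ atTop (𝓝 s)) (H : Matrix (Fin 4) (Fin 4) ℝ)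
    (hH : Tendsto (fun n => (σ n).1.metric) atTop (𝓝 H)) :
    ∃ ξ : Fin 4 → ℂ, ∑ α, (s.1.wave α : ℂ) * ξ α = 0 ∧
      toC H = toC s.1.metric + gaugeMode s.1.wave ξ := by
  have hs := s.2
  have hW := dot_self_pos hs
  have hω : s.1.ω ^ 2 = s.1.K ⬝ᵥ s.1.K := by rw [mdot_wave] at hk; linarith
  have hω0 : s.1.ω ≠ 0 := by rintro h; rw [h] at hω; simp at hω; exact hW.ne hω
  have hpi := Real.pi_ne_zero
  have hHe : ∀ μ ν, Tendsto (fun n => (σ n).1.metric μ ν) atTop (𝓝 (H μ ν)) := fun μ ν =>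
    (tendsto_pi_nhds.mp (tendsto_pi_nhds.mp hH μ)) ν
  have hsymm : ∀ μ ν, H μ ν = H ν μ := fun μ ν =>
    tendsto_nhds_unique (hHe μ ν) ((hHe ν μ).congr fun n => metric_symm (σ n).2 ν μ)
  have lω : Tendsto (fun n => (σ n).1.ω) atTop (𝓝 s.1.ω) :=
    (continuous_ω.tendsto s).comp hlim
  have lK : ∀ i, Tendsto (fun n => (σ n).1.K i) atTop (𝓝 (s.1.K i)) := fun i =>
    ((continuous_K i).tendsto s).comp hlim
  have ld : ∀ i, Tendsto (fun n => (σ n).1.d i) atTop (𝓝 (s.1.d i)) := fun i =>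
    ((continuous_d i).tendsto s).comp hlim
  have lW : Tendsto (fun n => (σ n).1.K ⬝ᵥ (σ n).1.K) atTop (𝓝 (s.1.K ⬝ᵥ s.1.K)) :=
    tendsto_finsetSum _ fun i _ => (lK i).mul (lK i)
  have hcon : ∀ ν, ∑ α, s.1.wave α * H α ν = 0 := by
    intro ν
    have l1 : Tendsto (fun n => ∑ α, (σ n).1.wave α * (σ n).1.metric α ν) atTop
        (𝓝 (∑ α, s.1.wave α * H α ν)) := by
      refine tendsto_finsetSum _ fun α _ => Tendsto.mul ?_ (hHe α ν)
      refine Fin.cases ?_ (fun i => ?_) α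
      · exact lω
      · exact lK i
    refine tendsto_nhds_unique l1 ((tendsto_const_nhds (x := (0 : ℝ))).congr fun n => ?_)
    have := congrFun (contract_metric (σ n).2) ν
    rw [contract_toC] at this
    rw [Pi.zero_apply] at this
    exact_mod_cast this.symm
  -- By `transverse_nonNullMetric` this combination depends on `ω`, `K`, `d` alone and has no pole
  -- at `k² = 0`, so its limit can be evaluated at the lightlike wave.
  have hij : ∀ i j : Fin 3, H i.succ j.succ + s.1.ω / (s.1.K ⬝ᵥ s.1.K) *
        (s.1.K i * H 0 j.succ + s.1.K j * H 0 i.succ) +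
      s.1.ω ^ 2 * (s.1.K i * s.1.K j) / (s.1.K ⬝ᵥ s.1.K) ^ 2 * H 0 0 =
      s.1.nullMetric i.succ j.succ := by
    intro i j
    have l1 : Tendsto (fun n => (σ n).1.metric i.succ j.succ + (σ n).1.ω /
        ((σ n).1.K ⬝ᵥ (σ n).1.K) * ((σ n).1.K i * (σ n).1.metric 0 j.succ +
          (σ n).1.K j * (σ n).1.metric 0 i.succ) + (σ n).1.ω ^ 2 * ((σ n).1.K i * (σ n).1.K j) /
            ((σ n).1.K ⬝ᵥ (σ n).1.K) ^ 2 * (σ n).1.metric 0 0) atTop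
        (𝓝 (H i.succ j.succ + s.1.ω / (s.1.K ⬝ᵥ s.1.K) *
          (s.1.K i * H 0 j.succ + s.1.K j * H 0 i.succ) +
        s.1.ω ^ 2 * (s.1.K i * s.1.K j) / (s.1.K ⬝ᵥ s.1.K) ^ 2 * H 0 0)) :=
      ((hHe _ _).add ((lω.div lW hW.ne').mul (((lK i).mul (hHe _ _)).add
        ((lK j).mul (hHe _ _))))).add ((((lω.pow 2).mul ((lK i).mul (lK j))).div (lW.pow 2)
          (pow_ne_zero _ hW.ne')).mul (hHe _ _))
    have l2 : Tendsto (fun n => 1 / (2 * Real.pi ^ 2 * ((σ n).1.K ⬝ᵥ (σ n).1.K)) *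
        ((1 : Matrix (Fin 3) (Fin 3) ℝ) i j -
          (σ n).1.K i * (σ n).1.K j / ((σ n).1.K ⬝ᵥ (σ n).1.K) - (σ n).1.d i * (σ n).1.d j)) atTop
        (𝓝 (1 / (2 * Real.pi ^ 2 * (s.1.K ⬝ᵥ s.1.K)) * ((1 : Matrix (Fin 3) (Fin 3) ℝ) i j -
      s.1.K i * s.1.K j / (s.1.K ⬝ᵥ s.1.K) - s.1.d i * s.1.d j))) :=
      (tendsto_const_nhds.div (tendsto_const_nhds.mul lW)
        (mul_ne_zero (by positivity) hW.ne')).mul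
        ((tendsto_const_nhds.sub (((lK i).mul (lK j)).div lW hW.ne')).sub ((ld i).mul (ld j)))
    rw [nullMetric_succ, hω]
    rw [hω] at l1
    refine tendsto_nhds_unique l1 (l2.congr fun n => ?_)
    rw [metric_of_nonNull (hσ n).ne', transverse_nonNullMetric (σ n).2 (hσ n).ne']
  have hω0' : (s.1.ω : ℂ) ≠ 0 := by exact_mod_cast hω0
  -- The gauge covector that removes the components `H_{0ν}`, as for vacuum modes. Once they are
  -- removed, the transverse combination is all that is left of the tensor.
  refine ⟨fun ν => ((-H 0 ν / s.1.ω - H 0 0 * lower s.1.wave ν / (2 * s.1.ω ^ 2) : ℝ) : ℂ), ?_, ?_⟩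
  · have h1 : ∑ α, s.1.wave α * (-H 0 α / s.1.ω - H 0 0 * lower s.1.wave α / (2 * s.1.ω ^ 2)) =
        0 := by
      calc _ = -(∑ α, s.1.wave α * H α 0) / s.1.ω -
          H 0 0 * (∑ α, s.1.wave α * lower s.1.wave α) / (2 * s.1.ω ^ 2) := by
            simp only [hsymm _ 0, Fin.sum_univ_four]; ring
        _ = 0 := by rw [hcon, sum_mul_lower, hk]; simp
    simp only
    exact_mod_cast h1
  · rw [metric_of_null hs hk]
    have h1 : ∀ μ ν, H μ ν = s.1.nullMetric μ ν + (lower s.1.wave μ *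
        (-H 0 ν / s.1.ω - H 0 0 * lower s.1.wave ν / (2 * s.1.ω ^ 2)) +
        (-H 0 μ / s.1.ω - H 0 0 * lower s.1.wave μ / (2 * s.1.ω ^ 2)) * lower s.1.wave ν) := by
      intro μ ν
      refine Fin.cases ?_ (fun i => ?_) μ <;> refine Fin.cases ?_ (fun j => ?_) ν
      · rw [nullMetric_zero_left, lower_zero, wave_zero]; field_simp; ring
      · rw [nullMetric_zero_left, lower_zero, lower_succ, wave_zero, wave_succ]; field_simp; ring
      · rw [nullMetric_zero_right, lower_zero, lower_succ, wave_zero, wave_succ, hsymm i.succ 0]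
        field_simp; ring
      · rw [← hij, lower_succ, lower_succ, wave_succ, wave_succ, ← hω]; field_simp; ring
    ext μ ν
    simp only [toC, map_apply, Matrix.add_apply, gaugeMode]
    exact_mod_cast congrArg (fun r : ℝ => (r : ℂ)) (h1 μ ν)

/-! ### Measurability and bounds of the amplitudes -/

@[fun_prop] theorem measurable_dot_self : Measurable (fun s : LaminarWave => s.1.K ⬝ᵥ s.1.K) := by
  simp only [dotProduct]; fun_prop

@[fun_prop] theorem measurable_wave : Measurable (fun s : LaminarWave => s.1.wave) := by
  refine measurable_pi_lambda _ fun α => Fin.cases ?_ (fun i => ?_) α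
  · exact measurable_ω
  · exact measurable_K i

@[fun_prop] theorem measurable_wave_apply (α : Fin 4) :
    Measurable (fun s : LaminarWave => s.1.wave α) := (measurable_pi_apply α).comp measurable_wave

@[fun_prop] theorem measurable_dir (α : Fin 4) : Measurable (fun s : LaminarWave => s.1.dir α) := by
  refine Fin.cases ?_ (fun i => ?_) α
  · simp
  · exact measurable_d i

@[fun_prop] theorem measurable_velocity (i : Fin 3) :
    Measurable (fun s : LaminarWave => s.1.velocity i) := by
  simp only [velocity_apply]
  refine Measurable.add (by fun_prop) (Measurable.mul (by fun_prop) ?_)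
  fin_cases i <;> simp [cross_apply] <;> fun_prop

@[fun_prop] theorem measurable_u (α : Fin 4) : Measurable (fun s : LaminarWave => s.1.u α) := by
  refine Fin.cases ?_ (fun i => ?_) α
  · simp
  · exact measurable_velocity i

@[fun_prop] theorem measurable_energyMomentum (μ ν : Fin 4) :
    Measurable (fun s : LaminarWave => s.1.energyMomentum μ ν) := by
  simp only [energyMomentum, mdot_eq, lower_apply]
  fun_prop

@[fun_prop] theorem measurable_mdot_wave :
    Measurable (fun s : LaminarWave => mdot s.1.wave s.1.wave) := by
  simp only [mdot_eq]; fun_prop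

theorem measurable_nullMetric (μ ν : Fin 4) :
    Measurable (fun s : LaminarWave => s.1.nullMetric μ ν) := by
  have h : ∀ α, Measurable (fun s : LaminarWave => fourVec 0 s.1.K α) := fun α => by
    refine Fin.cases ?_ (fun i => ?_) α
    · simp
    · exact measurable_K i
  have h1 := h μ
  have h2 := h ν
  simp only [nullMetric]
  fun_prop

theorem measurable_nonNullMetric (μ ν : Fin 4) :
    Measurable (fun s : LaminarWave => s.1.nonNullMetric μ ν) := by
  simp only [nonNullMetric, lower_apply]
  fun_prop

-- The definition by a limit is replaced by the two closed forms, glued along the measurable set `k²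
-- = 0`.
@[fun_prop] theorem measurable_metric (μ ν : Fin 4) :
    Measurable (fun s : LaminarWave => s.1.metric μ ν) := by
  classical
  have : (fun s : LaminarWave => s.1.metric μ ν) = fun s : LaminarWave =>
      if mdot s.1.wave s.1.wave = 0 then s.1.nullMetric μ ν else s.1.nonNullMetric μ ν := by
    funext s
    split_ifs with h
    · rw [metric_of_null s.2 h]
    · rw [metric_of_nonNull h]
  rw [this]
  exact Measurable.ite (measurable_mdot_wave (measurableSet_singleton 0))
    (measurable_nullMetric μ ν) (measurable_nonNullMetric μ ν)

theorem abs_apply_le_one_of_dot_self_le {n : ℕ} {a : Fin n → ℝ} (h : a ⬝ᵥ a ≤ 1) (i : Fin n) :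
    |a i| ≤ 1 := by
  rw [← sq_le_one_iff_abs_le_one]
  refine le_trans ?_ h
  rw [sq]
  exact Finset.single_le_sum (f := fun i => a i * a i) (fun i _ => mul_self_nonneg _)
    (Finset.mem_univ i)

theorem abs_d_le {s : WaveParam} (hs : s.IsPhysical) (i : Fin 3) : |s.d i| ≤ 1 :=
  abs_apply_le_one_of_dot_self_le hs.2.1.le i

theorem velocity_dot_velocity_le {s : WaveParam} (hs : s.IsPhysical) :
    s.velocity ⬝ᵥ s.velocity ≤ 1 := by
  rw [velocity_dot_velocity hs]
  exact div_le_one_of_le₀ hs.2.2.2.2 (dot_self_pos hs).le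

theorem abs_u_le {s : WaveParam} (hs : s.IsPhysical) (μ : Fin 4) : |lower s.u μ| ≤ 1 := by
  rw [abs_lower]
  refine Fin.cases ?_ (fun i => ?_) μ
  · simp
  · exact abs_apply_le_one_of_dot_self_le (velocity_dot_velocity_le hs) i

theorem abs_dir_le {s : WaveParam} (hs : s.IsPhysical) (μ : Fin 4) : |lower s.dir μ| ≤ 1 := by
  rw [abs_lower]
  refine Fin.cases ?_ (fun i => ?_) μ
  · simp
  · exact abs_d_le hs i

theorem abs_mdot_u_le {s : WaveParam} (hs : s.IsPhysical) : |mdot s.u s.u| ≤ 1 := by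
  have h1 : mdot s.u s.u = -1 + s.velocity ⬝ᵥ s.velocity := by rw [u, mdot_fourVec]; ring
  have h2 := velocity_dot_velocity_le hs
  have h3 : 0 ≤ s.velocity ⬝ᵥ s.velocity :=
    Finset.sum_nonneg fun i _ => mul_self_nonneg _
  rw [h1, abs_le]
  constructor <;> linarith

theorem abs_energyMomentum_le {s : WaveParam} (hs : s.IsPhysical) (μ ν : Fin 4) :
    |s.energyMomentum μ ν| ≤ 2 := by
  have h1 : |lower s.u μ * lower s.u ν| ≤ 1 := by
    rw [abs_mul]; exact mul_le_one₀ (abs_u_le hs μ) (abs_nonneg _) (abs_u_le hs ν)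
  have h2 : |mdot s.u s.u * (lower s.dir μ * lower s.dir ν)| ≤ 1 := by
    rw [abs_mul, abs_mul]
    exact mul_le_one₀ (abs_mdot_u_le hs) (by positivity)
      (mul_le_one₀ (abs_dir_le hs μ) (abs_nonneg _) (abs_dir_le hs ν))
  exact (abs_add_le _ _).trans (by linarith)

theorem abs_nullMetric_le {s : WaveParam} (hs : s.IsPhysical) (μ ν : Fin 4) :
    |s.nullMetric μ ν| ≤ 3 / (2 * Real.pi ^ 2 * s.ω ^ 2) := by
  have h0 : 0 ≤ 3 / (2 * Real.pi ^ 2 * s.ω ^ 2) := by positivity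
  refine Fin.cases ?_ (fun i => ?_) μ
  · simpa using h0
  refine Fin.cases ?_ (fun j => ?_) ν
  · simpa using h0
  have hW := dot_self_pos hs
  have h1 : |(1 : Matrix (Fin 3) (Fin 3) ℝ) i j| ≤ 1 := by
    rw [Matrix.one_apply]; split_ifs <;> simp
  have h2 : |s.K i * s.K j / (s.K ⬝ᵥ s.K)| ≤ 1 := by
    have h : ∀ i, s.K i ^ 2 ≤ s.K ⬝ᵥ s.K := fun i => by
      rw [sq]
      exact Finset.single_le_sum (f := fun i => s.K i * s.K i) (fun i _ => mul_self_nonneg _)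
        (Finset.mem_univ i)
    rw [abs_div, abs_of_pos hW, div_le_one hW, abs_le]
    constructor <;> nlinarith [h i, h j, sq_nonneg (s.K i + s.K j), sq_nonneg (s.K i - s.K j)]
  have h3 : |s.d i * s.d j| ≤ 1 := by
    rw [abs_mul]; exact mul_le_one₀ (abs_d_le hs i) (abs_nonneg _) (abs_d_le hs j)
  have h4 : |(1 : Matrix (Fin 3) (Fin 3) ℝ) i j - s.K i * s.K j / (s.K ⬝ᵥ s.K) - s.d i * s.d j| ≤
      3 := by
    generalize (1 : Matrix (Fin 3) (Fin 3) ℝ) i j = a at h1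
    generalize s.K i * s.K j / (s.K ⬝ᵥ s.K) = b at h2
    rw [abs_le] at *
    constructor <;> linarith
  rw [nullMetric_succ, abs_mul, abs_of_nonneg (by positivity), div_mul_eq_mul_div, one_mul]
  gcongr

/-- With `k` fixed the factors `1/k²` or `1/ω²` are constants and the rest is bounded by the speed
limit. This makes `h[ρ]` absolutely convergent for every mode; a bound uniform in `k` is impossible.
-/
theorem exists_metric_bound (k : Fin 4 → ℝ) : ∃ C : ℝ, ∀ s : WaveParam, s.IsPhysical →
    s.wave = k → ∀ μ ν, |s.metric μ ν| ≤ C := by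
  by_cases hk : mdot k k = 0
  · refine ⟨3 / (2 * Real.pi ^ 2 * k 0 ^ 2), ?_⟩
    rintro s hs rfl μ ν
    rw [metric_of_null hs hk]
    exact abs_nullMetric_le hs μ ν
  · refine ⟨|1 / (2 * Real.pi ^ 2 * mdot k k)| *
      (2 + ∑ α, ∑ β, |eta α β - lower k α * lower k β / mdot k k|), ?_⟩
    rintro s hs rfl μ ν
    rw [metric_of_nonNull hk, nonNullMetric_apply s hs.2.1, abs_mul]
    gcongr
    refine (abs_sub _ _).trans (add_le_add (abs_energyMomentum_le hs μ ν) ?_)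
    rw [abs_mul]
    refine (mul_le_of_le_one_right (abs_nonneg _) (abs_mdot_u_le hs)).trans ?_
    refine (Finset.single_le_sum
      (f := fun β => |eta μ β - lower s.wave μ * lower s.wave β / mdot s.wave s.wave|)
      (fun _ _ => abs_nonneg _) (Finset.mem_univ ν)).trans ?_
    exact Finset.single_le_sum (f := fun α => ∑ β, |eta α β - lower s.wave α * lower s.wave β /
      mdot s.wave s.wave|) (fun _ _ => Finset.sum_nonneg fun _ _ => abs_nonneg _)
      (Finset.mem_univ μ)

end WaveParam

/-! ### Modes -/

theorem linearMap_eq_sum (L : Matrix (Fin 4) (Fin 4) ℂ →ₗ[ℂ] ℂ) (M : Matrix (Fin 4) (Fin 4) ℂ) :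
    L M = ∑ μ, ∑ ν, L (Matrix.single μ ν 1) * M μ ν := by
  conv_lhs => rw [Matrix.matrix_eq_sum_single M]
  simp only [map_sum]
  refine Finset.sum_congr rfl fun μ _ => Finset.sum_congr rfl fun ν _ => ?_
  have : Matrix.single μ ν (M μ ν) = M μ ν • Matrix.single μ ν (1 : ℂ) := by
    rw [Matrix.smul_single, smul_eq_mul, mul_one]
  rw [this, map_smul, smul_eq_mul, mul_comm]

/-- Superpositions are defined entry by entry; expanding in matrix units exchanges the integral with
any linear functional, in particular with the entries of the Einstein tensor and of the contraction.
-/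
theorem linearMap_integral {α : Type*} [MeasurableSpace α] {m : Measure α}
    (L : Matrix (Fin 4) (Fin 4) ℂ →ₗ[ℂ] ℂ) {F : α → Matrix (Fin 4) (Fin 4) ℂ}
    (hF : ∀ μ ν, Integrable (fun s => F s μ ν) m) :
    L (Matrix.of fun μ ν => ∫ s, F s μ ν ∂m) = ∫ s, L (F s) ∂m := by
  simp only [linearMap_eq_sum L (F _)]
  rw [linearMap_eq_sum, integral_finsetSum _ fun μ _ => integrable_finsetSum _ fun ν _ =>
    (hF μ ν).const_mul _]
  refine Finset.sum_congr rfl fun μ _ => ?_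
  rw [integral_finsetSum _ fun ν _ => (hF μ ν).const_mul _]
  exact Finset.sum_congr rfl fun ν _ => (integral_const_mul _ _).symm

namespace DefectDistribution

variable {ρ : DefectDistribution} {k : Fin 4 → ℝ}

theorem IsMode.hasMetric (h : ρ.IsMode k) : ρ.HasMetric := by
  intro μ ν
  obtain ⟨C, hC⟩ := WaveParam.exists_metric_bound k
  refine ρ.integrable.mul_bdd (c := C) (Measurable.aestronglyMeasurable
    (Complex.measurable_ofReal.comp (WaveParam.measurable_metric μ ν))) ?_
  filter_upwards [h] with s hs
  simpa [toC] using hC s.1 s.2 hs μ ν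

theorem linearMap_modeH (h : ρ.IsMode k) (L : Matrix (Fin 4) (Fin 4) ℂ →ₗ[ℂ] ℂ) :
    L ρ.modeH = ∫ s, ρ.density s * L (toC s.1.metric) ∂ρ.measure := by
  have := linearMap_integral L (F := fun s => ρ.density s • toC s.1.metric) (m := ρ.measure)
    h.hasMetric
  simp only [map_smul, smul_eq_mul] at this
  exact this

theorem modeH_isSymm (ρ : DefectDistribution) : ρ.modeH.IsSymm := by
  ext μ ν
  simp only [transpose_apply, modeH, superpose]
  congr 1
  funext s
  simp only [toC, map_apply, WaveParam.metric_symm s.2 μ ν]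

theorem contract_modeH (h : ρ.IsMode k) : contract k ρ.modeH = 0 := by
  funext ν
  refine (linearMap_modeH h (contractEntry k ν)).trans ?_
  refine integral_eq_zero_of_ae ?_
  filter_upwards [h] with s hs
  have : contractEntry k ν (toC s.1.metric) = 0 := by
    rw [← hs]; exact congrFun (WaveParam.contract_metric s.2) ν
  rw [this, mul_zero]; rfl

theorem linEinsteinMode_modeH (h : ρ.IsMode k) : linEinsteinMode k ρ.modeH = ρ.modeT := by
  ext μ ν
  refine (linearMap_modeH h (linEinsteinEntry k μ ν)).trans ?_
  refine integral_congr_ae ?_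
  filter_upwards [h] with s hs
  have : linEinsteinEntry k μ ν (toC s.1.metric) = toC s.1.energyMomentum μ ν := by
    rw [← hs]; exact congrFun (congrFun (WaveParam.linEinsteinMode_metric s.2) μ) ν
  rw [this]

theorem eq_modeH (hk : mdot k k ≠ 0) (h : ρ.IsMode k) {H : Matrix (Fin 4) (Fin 4) ℂ}
    (hc : contract k H = 0) (hE : linEinsteinMode k H = ρ.modeT) : H = ρ.modeH := by
  refine sub_eq_zero.mp (eq_zero_of_linEinsteinMode_eq_zero hk ?_ ?_)
  · rw [contract_sub, hc, contract_modeH h, sub_zero]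
  · rw [linEinsteinMode_sub, hE, linEinsteinMode_modeH h, sub_self]

end DefectDistribution

/-! ### Transverse frames and transverse-traceless tensors -/

/-- A unit vector orthogonal to `K`. -/
def frameFst (K : Fin 3 → ℝ) : Fin 3 → ℝ :=
  open Classical in
  -- A continuous choice for all `K ≠ 0` does not exist (the sphere has no nowhere vanishing tangent
  -- field); measurability is all that is required.
  if K 0 ^ 2 + K 1 ^ 2 = 0 then ![1, 0, 0]
  else (Real.sqrt (K 0 ^ 2 + K 1 ^ 2))⁻¹ • ![-K 1, K 0, 0]

/-- The unit vector orthogonal to `K` and `frameFst K`. -/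
def frameSnd (K : Fin 3 → ℝ) : Fin 3 → ℝ :=
  (Real.sqrt (K ⬝ᵥ K))⁻¹ • crossProduct K (frameFst K)

theorem frameFst_dot_self (K : Fin 3 → ℝ) : frameFst K ⬝ᵥ frameFst K = 1 := by
  rw [frameFst]
  split_ifs with h
  · simp
  · have h0 : 0 ≤ K 0 ^ 2 + K 1 ^ 2 := by positivity
    have h1 := Real.sq_sqrt h0
    have h2 : Real.sqrt (K 0 ^ 2 + K 1 ^ 2) ≠ 0 := by
      rw [Real.sqrt_ne_zero']; exact lt_of_le_of_ne h0 (Ne.symm h)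
    simp only [dotProduct_smul, smul_dotProduct, smul_eq_mul]
    have h3 : ![-K 1, K 0, 0] ⬝ᵥ ![-K 1, K 0, 0] = Real.sqrt (K 0 ^ 2 + K 1 ^ 2) ^ 2 := by
      rw [h1]; simp; ring
    rw [h3]
    field_simp

theorem dot_frameFst (K : Fin 3 → ℝ) : K ⬝ᵥ frameFst K = 0 := by
  rw [frameFst]
  split_ifs with h
  · have : K 0 = 0 := by nlinarith [sq_nonneg (K 0), sq_nonneg (K 1)]
    simp [dotProduct, Fin.sum_univ_three, this]
  · simp [dotProduct, Fin.sum_univ_three]; ring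

theorem dot_frameSnd (K : Fin 3 → ℝ) : K ⬝ᵥ frameSnd K = 0 := by
  rw [frameSnd, dotProduct_smul, dot_self_cross, smul_zero]

theorem frameFst_dot_frameSnd (K : Fin 3 → ℝ) : frameFst K ⬝ᵥ frameSnd K = 0 := by
  rw [frameSnd, dotProduct_smul, dot_cross_self, smul_zero]

theorem frameSnd_dot_self {K : Fin 3 → ℝ} (hK : K ≠ 0) : frameSnd K ⬝ᵥ frameSnd K = 1 := by
  have h0 : 0 ≤ K ⬝ᵥ K := Finset.sum_nonneg fun i _ => mul_self_nonneg _
  have h1 := Real.sq_sqrt h0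
  have h2 : Real.sqrt (K ⬝ᵥ K) ≠ 0 := by
    rw [Real.sqrt_ne_zero']; exact lt_of_le_of_ne h0 (dotProduct_self_ne_zero hK).symm
  rw [frameSnd, dotProduct_smul, smul_dotProduct, cross_dot_cross, frameFst_dot_self,
    dot_frameFst, smul_eq_mul, smul_eq_mul]
  field_simp
  rw [h1]; ring

@[fun_prop] theorem measurable_frameFst (i : Fin 3) : Measurable fun K => frameFst K i := by
  classical
  have : (fun K => frameFst K i) = fun K : Fin 3 → ℝ => if K 0 ^ 2 + K 1 ^ 2 = 0 then
      (![1, 0, 0] : Fin 3 → ℝ) i else (Real.sqrt (K 0 ^ 2 + K 1 ^ 2))⁻¹ *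
        (![-K 1, K 0, 0] : Fin 3 → ℝ) i := by
    funext K
    rw [frameFst]
    split_ifs <;> simp
  rw [this]
  refine Measurable.ite ?_ measurable_const ?_
  · have : Measurable fun K : Fin 3 → ℝ => K 0 ^ 2 + K 1 ^ 2 := by fun_prop
    exact this (measurableSet_singleton 0)
  · refine Measurable.mul (by fun_prop) ?_
    fin_cases i <;> simp <;> fun_prop

@[fun_prop] theorem measurable_frameSnd (i : Fin 3) : Measurable fun K => frameSnd K i := by
  have h : Measurable fun K : Fin 3 → ℝ => K ⬝ᵥ K := by simp only [dotProduct]; fun_prop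
  simp only [frameSnd, Pi.smul_apply, smul_eq_mul]
  refine Measurable.mul (by fun_prop) ?_
  fin_cases i <;> simp [cross_apply] <;> fun_prop

/-- The bilinear form of the spatial part of a tensor. -/
def spatialForm (B : Matrix (Fin 4) (Fin 4) ℂ) (x y : Fin 3 → ℝ) : ℂ :=
  ∑ a, ∑ b, (x a : ℂ) * (y b : ℂ) * B a.succ b.succ

section Frame

variable {K e₁ e₂ : Fin 3 → ℝ} (hK : K ≠ 0) (h11 : e₁ ⬝ᵥ e₁ = 1)
  (h22 : e₂ ⬝ᵥ e₂ = 1) (h12 : e₁ ⬝ᵥ e₂ = 0) (h1 : K ⬝ᵥ e₁ = 0) (h2 : K ⬝ᵥ e₂ = 0)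

include hK h11 h22 h12 h1 h2 in
theorem eq_of_transverse {w : Fin 3 → ℂ} (hw : ∑ a, (K a : ℂ) * w a = 0) (b : Fin 3) :
    w b = (e₁ b : ℂ) * ∑ a, (e₁ a : ℂ) * w a + (e₂ b : ℂ) * ∑ a, (e₂ a : ℂ) * w a := by
  have hc : ∀ a, (((1 : Matrix (Fin 3) (Fin 3) ℝ) b a : ℝ) : ℂ) =
      (K b : ℂ) * (K a : ℂ) / ((K ⬝ᵥ K : ℝ) : ℂ) + (e₁ b : ℂ) * e₁ a + (e₂ b : ℂ) * e₂ a := by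
    intro a
    rw [← frame_complete hK h11 h22 h12 h1 h2 b a]; push_cast; rfl
  have h : w b = ∑ a, (((1 : Matrix (Fin 3) (Fin 3) ℝ) b a : ℝ) : ℂ) * w a := by
    simp [Matrix.one_apply, apply_ite (fun r : ℝ => (r : ℂ))]
  rw [h]
  simp only [hc]
  calc _ = (K b : ℂ) / ((K ⬝ᵥ K : ℝ) : ℂ) * (∑ a, (K a : ℂ) * w a) +
      ((e₁ b : ℂ) * ∑ a, (e₁ a : ℂ) * w a + (e₂ b : ℂ) * ∑ a, (e₂ a : ℂ) * w a) := by
        simp only [Fin.sum_univ_three]; ring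
    _ = _ := by rw [hw]; ring

end Frame

theorem sum_tail_mul_of_transverseTraceless {k : Fin 4 → ℝ} {B : Matrix (Fin 4) (Fin 4) ℂ}
    (hB : B ∈ transverseTraceless k) (ν : Fin 4) :
    ∑ a : Fin 3, (Fin.tail k a : ℂ) * B a.succ ν = 0 := by
  have := congrFun hB.2.2.1 ν
  rw [contract, Fin.sum_univ_succ, hB.2.1, mul_zero, zero_add] at this
  exact this

theorem tail_ne_zero_of_null {k : Fin 4 → ℝ} (hk : mdot k k = 0) (h0 : k ≠ 0) :
    Fin.tail k ≠ 0 := by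
  intro h
  have hw := zero_ne_zero_of_null hk h0
  have h1 : k 1 = 0 := congrFun h 0
  have h2 : k 2 = 0 := congrFun h 1
  have h3 : k 3 = 0 := congrFun h 2
  rw [mdot_eq, h1, h2, h3] at hk
  apply hw
  simpa using hk

theorem tail_dot_tail_of_null {k : Fin 4 → ℝ} (hk : mdot k k = 0) :
    Fin.tail k ⬝ᵥ Fin.tail k = k 0 ^ 2 := by
  rw [mdot_eq] at hk
  simp only [dotProduct, Fin.sum_univ_three, Fin.tail]
  change k 1 * k 1 + k 2 * k 2 + k 3 * k 3 = _
  linarith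

/-! ### Expansion of transverse-traceless tensors in a transverse frame -/

section TT

variable {k : Fin 4 → ℝ} {B : Matrix (Fin 4) (Fin 4) ℂ} {e₁ e₂ : Fin 3 → ℝ}

theorem spatialForm_comm (hB : B.IsSymm) (x y : Fin 3 → ℝ) :
    spatialForm B x y = spatialForm B y x := by
  rw [spatialForm, spatialForm, Finset.sum_comm]
  refine Finset.sum_congr rfl fun a _ => Finset.sum_congr rfl fun b _ => ?_
  rw [hB.apply]; ring

theorem spatialForm_add_smul (B : Matrix (Fin 4) (Fin 4) ℂ) (c s : ℝ) (hB : B.IsSymm) :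
    spatialForm B (c • e₁ + s • e₂) (c • e₁ + s • e₂) =
      (c : ℂ) ^ 2 * spatialForm B e₁ e₁ + 2 * (c : ℂ) * s * spatialForm B e₁ e₂ +
        (s : ℂ) ^ 2 * spatialForm B e₂ e₂ := by
  have h : 2 * (c : ℂ) * s * spatialForm B e₁ e₂ = (c : ℂ) * s * spatialForm B e₁ e₂ +
      (c : ℂ) * s * spatialForm B e₂ e₁ := by rw [spatialForm_comm hB e₂ e₁]; ring
  rw [h]
  simp only [spatialForm, Finset.mul_sum, ← Finset.sum_add_distrib]
  refine Finset.sum_congr rfl fun a _ => Finset.sum_congr rfl fun b _ => ?_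
  simp only [Pi.add_apply, Pi.smul_apply, smul_eq_mul]
  push_cast
  ring

variable (hk : mdot k k = 0) (h0 : k ≠ 0) (hB : B ∈ transverseTraceless k)
  (h11 : e₁ ⬝ᵥ e₁ = 1) (h22 : e₂ ⬝ᵥ e₂ = 1) (h12 : e₁ ⬝ᵥ e₂ = 0)
  (h1 : Fin.tail k ⬝ᵥ e₁ = 0) (h2 : Fin.tail k ⬝ᵥ e₂ = 0)

include hk h0 hB h11 h22 h12 h1 h2

theorem apply_succ_of_transverseTraceless (a b : Fin 3) : B a.succ b.succ =
    (e₁ a : ℂ) * e₁ b * spatialForm B e₁ e₁ + (e₁ a : ℂ) * e₂ b * spatialForm B e₁ e₂ +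
      (e₂ a : ℂ) * e₁ b * spatialForm B e₂ e₁ + (e₂ a : ℂ) * e₂ b * spatialForm B e₂ e₂ := by
  have hK := tail_ne_zero_of_null hk h0
  have hsym := hB.1
  -- The second index is expanded after pairing the first with an arbitrary `x`; the resulting
  -- vector is still transverse because `B` is symmetric.
  have step : ∀ x : Fin 3 → ℝ, ∑ c, (x c : ℂ) * B c.succ b.succ =
      (e₁ b : ℂ) * spatialForm B x e₁ + (e₂ b : ℂ) * spatialForm B x e₂ := by
    intro x
    have hw : ∑ c, (Fin.tail k c : ℂ) * (∑ a, (x a : ℂ) * B a.succ c.succ) = 0 := by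
      simp only [Finset.mul_sum]
      rw [Finset.sum_comm]
      refine Finset.sum_eq_zero fun a _ => ?_
      rw [← mul_zero (x a : ℂ), ← sum_tail_mul_of_transverseTraceless hB a.succ, Finset.mul_sum]
      refine Finset.sum_congr rfl fun c _ => ?_
      rw [hsym.apply]; ring
    rw [eq_of_transverse hK h11 h22 h12 h1 h2 hw b]
    simp only [spatialForm, Finset.mul_sum]
    congr 1
    · rw [Finset.sum_comm]
      exact Finset.sum_congr rfl fun _ _ => Finset.sum_congr rfl fun _ _ => by ring
    · rw [Finset.sum_comm]
      exact Finset.sum_congr rfl fun _ _ => Finset.sum_congr rfl fun _ _ => by ring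
  rw [eq_of_transverse hK h11 h22 h12 h1 h2 (w := fun a => B a.succ b.succ)
    (sum_tail_mul_of_transverseTraceless hB b.succ) a, step, step]
  ring

theorem spatialForm_add_spatialForm : spatialForm B e₁ e₁ + spatialForm B e₂ e₂ = 0 := by
  have ht : ∑ a : Fin 3, B a.succ a.succ = 0 := by
    have := hB.2.2.2
    rw [etaTrace, Fin.sum_univ_succ, hB.2.1, mul_zero, zero_add] at this
    simpa using this
  have c11 : ∑ a, (e₁ a : ℂ) * e₁ a = 1 := by exact_mod_cast h11
  have c22 : ∑ a, (e₂ a : ℂ) * e₂ a = 1 := by exact_mod_cast h22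
  have c12 : ∑ a, (e₁ a : ℂ) * e₂ a = 0 := by exact_mod_cast h12
  simp only [apply_succ_of_transverseTraceless hk h0 hB h11 h22 h12 h1 h2] at ht
  have : ∑ a, ((e₁ a : ℂ) * e₁ a * spatialForm B e₁ e₁ + (e₁ a : ℂ) * e₂ a * spatialForm B e₁ e₂ +
      (e₂ a : ℂ) * e₁ a * spatialForm B e₂ e₁ + (e₂ a : ℂ) * e₂ a * spatialForm B e₂ e₂) =
      (∑ a, (e₁ a : ℂ) * e₁ a) * spatialForm B e₁ e₁ +
      (∑ a, (e₁ a : ℂ) * e₂ a) * (spatialForm B e₁ e₂ + spatialForm B e₂ e₁) +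
      (∑ a, (e₂ a : ℂ) * e₂ a) * spatialForm B e₂ e₂ := by
    simp only [Fin.sum_univ_three]; ring
  rw [this, c11, c22, c12] at ht
  linear_combination ht

theorem eq_plusPol_add_crossPol : B = spatialForm B e₁ e₁ • plusPol e₁ e₂ +
    spatialForm B e₁ e₂ • crossPol e₁ e₂ := by
  have hs := spatialForm_add_spatialForm hk h0 hB h11 h22 h12 h1 h2
  have hB0 := hB.2.1
  ext μ ν
  refine Fin.cases ?_ (fun a => ?_) μ
  · rw [hB0]; simp [plusPol, crossPol]
  refine Fin.cases ?_ (fun b => ?_) ν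
  · rw [hB.1.apply, hB0]; simp [plusPol, crossPol]
  rw [apply_succ_of_transverseTraceless hk h0 hB h11 h22 h12 h1 h2, spatialForm_comm hB.1 e₂ e₁]
  simp only [Matrix.add_apply, Matrix.smul_apply, plusPol, crossPol, fourVec_apply_succ,
    smul_eq_mul]
  push_cast
  linear_combination (e₂ a : ℂ) * e₂ b * hs

end TT

/-! ### The two polarization tensors as a basis -/

section Polarizations

variable {k : Fin 4 → ℝ} {e₁ e₂ : Fin 3 → ℝ} (h11 : e₁ ⬝ᵥ e₁ = 1) (h22 : e₂ ⬝ᵥ e₂ = 1)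
  (h12 : e₁ ⬝ᵥ e₂ = 0) (h1 : Fin.tail k ⬝ᵥ e₁ = 0) (h2 : Fin.tail k ⬝ᵥ e₂ = 0)

include h1 h2 h11 h22 in
theorem plusPol_mem_transverseTraceless : plusPol e₁ e₂ ∈ transverseTraceless k := by
  refine ⟨?_, fun ν => by simp [plusPol], ?_, ?_⟩
  · ext μ ν; simp only [transpose_apply, plusPol]; push_cast; ring
  · funext ν
    have c1 : ∑ a, (Fin.tail k a : ℂ) * (e₁ a : ℂ) = 0 := by exact_mod_cast h1
    have c2 : ∑ a, (Fin.tail k a : ℂ) * (e₂ a : ℂ) = 0 := by exact_mod_cast h2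
    rw [contract, Fin.sum_univ_succ]
    calc _ = (∑ a, (Fin.tail k a : ℂ) * (e₁ a : ℂ)) * (fourVec 0 e₁ ν : ℂ) -
        (∑ a, (Fin.tail k a : ℂ) * (e₂ a : ℂ)) * (fourVec 0 e₂ ν : ℂ) := by
          simp only [plusPol, fourVec_apply_zero, fourVec_apply_succ, Fin.sum_univ_three, Fin.tail]
          push_cast; ring
      _ = 0 := by rw [c1, c2]; ring
  · have c11 : ∑ a, (e₁ a : ℂ) * e₁ a = 1 := by exact_mod_cast h11
    have c22 : ∑ a, (e₂ a : ℂ) * e₂ a = 1 := by exact_mod_cast h22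
    rw [etaTrace, Fin.sum_univ_succ]
    calc _ = (∑ a, (e₁ a : ℂ) * e₁ a) - ∑ a, (e₂ a : ℂ) * e₂ a := by
          simp only [plusPol, fourVec_apply_zero, fourVec_apply_succ, Fin.sum_univ_three,
            eta_succ_succ, Matrix.one_apply_eq]
          push_cast; ring
      _ = 0 := by rw [c11, c22]; ring

include h12 h1 h2 in
theorem crossPol_mem_transverseTraceless : crossPol e₁ e₂ ∈ transverseTraceless k := by
  refine ⟨?_, fun ν => by simp [crossPol], ?_, ?_⟩
  · ext μ ν; simp only [transpose_apply, crossPol]; push_cast; ring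
  · funext ν
    have c1 : ∑ a, (Fin.tail k a : ℂ) * (e₁ a : ℂ) = 0 := by exact_mod_cast h1
    have c2 : ∑ a, (Fin.tail k a : ℂ) * (e₂ a : ℂ) = 0 := by exact_mod_cast h2
    rw [contract, Fin.sum_univ_succ]
    calc _ = (∑ a, (Fin.tail k a : ℂ) * (e₁ a : ℂ)) * (fourVec 0 e₂ ν : ℂ) +
        (∑ a, (Fin.tail k a : ℂ) * (e₂ a : ℂ)) * (fourVec 0 e₁ ν : ℂ) := by
          simp only [crossPol, fourVec_apply_zero, fourVec_apply_succ, Fin.sum_univ_three,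
            Fin.tail]
          push_cast; ring
      _ = 0 := by rw [c1, c2]; ring
  · have c12 : ∑ a, (e₁ a : ℂ) * e₂ a = 0 := by exact_mod_cast h12
    rw [etaTrace, Fin.sum_univ_succ]
    calc _ = 2 * (∑ a, (e₁ a : ℂ) * e₂ a) := by
          simp only [crossPol, fourVec_apply_zero, fourVec_apply_succ, Fin.sum_univ_three,
            eta_succ_succ, Matrix.one_apply_eq]
          push_cast; ring
      _ = 0 := by rw [c12]; ring

include h11 h12 in
-- Together with `spatialForm_fst_snd` this reads off the two coefficients, which gives linear
-- independence of the polarizations and, later, equality of moments from equality of metrics.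
theorem spatialForm_fst_fst (a b : ℂ) :
    spatialForm (a • plusPol e₁ e₂ + b • crossPol e₁ e₂) e₁ e₁ = a := by
  have c11 : ∑ a, (e₁ a : ℂ) * e₁ a = 1 := by exact_mod_cast h11
  have c12 : ∑ a, (e₁ a : ℂ) * e₂ a = 0 := by exact_mod_cast h12
  calc _ = a * ((∑ a, (e₁ a : ℂ) * e₁ a) ^ 2 - (∑ a, (e₁ a : ℂ) * e₂ a) ^ 2) +
        2 * b * (∑ a, (e₁ a : ℂ) * e₁ a) * (∑ a, (e₁ a : ℂ) * e₂ a) := by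
        simp only [spatialForm, Matrix.add_apply, Matrix.smul_apply, plusPol, crossPol,
          fourVec_apply_succ, smul_eq_mul, Fin.sum_univ_three]
        push_cast; ring
    _ = a := by rw [c11, c12]; ring

include h11 h22 h12 in
theorem spatialForm_fst_snd (a b : ℂ) :
    spatialForm (a • plusPol e₁ e₂ + b • crossPol e₁ e₂) e₁ e₂ = b := by
  have c11 : ∑ a, (e₁ a : ℂ) * e₁ a = 1 := by exact_mod_cast h11
  have c22 : ∑ a, (e₂ a : ℂ) * e₂ a = 1 := by exact_mod_cast h22
  have c12 : ∑ a, (e₁ a : ℂ) * e₂ a = 0 := by exact_mod_cast h12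
  calc _ = a * ((∑ a, (e₁ a : ℂ) * e₁ a) * (∑ a, (e₁ a : ℂ) * e₂ a) -
        (∑ a, (e₁ a : ℂ) * e₂ a) * (∑ a, (e₂ a : ℂ) * e₂ a)) +
        b * ((∑ a, (e₁ a : ℂ) * e₁ a) * (∑ a, (e₂ a : ℂ) * e₂ a) +
          (∑ a, (e₁ a : ℂ) * e₂ a) ^ 2) := by
        simp only [spatialForm, Matrix.add_apply, Matrix.smul_apply, plusPol, crossPol,
          fourVec_apply_succ, smul_eq_mul, Fin.sum_univ_three]
        push_cast; ring
    _ = b := by rw [c11, c12, c22]; ring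

end Polarizations

theorem finrank_transverseTraceless {k : Fin 4 → ℝ} (hk : mdot k k = 0) (h0 : k ≠ 0) :
    Module.finrank ℂ (transverseTraceless k) = 2 := by
  have hK := tail_ne_zero_of_null hk h0
  set e₁ := frameFst (Fin.tail k)
  set e₂ := frameSnd (Fin.tail k)
  have h11 : e₁ ⬝ᵥ e₁ = 1 := frameFst_dot_self _
  have h22 : e₂ ⬝ᵥ e₂ = 1 := frameSnd_dot_self hK
  have h12 : e₁ ⬝ᵥ e₂ = 0 := frameFst_dot_frameSnd _
  have h1 : Fin.tail k ⬝ᵥ e₁ = 0 := dot_frameFst _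
  have h2 : Fin.tail k ⬝ᵥ e₂ = 0 := dot_frameSnd _
  let f : ℂ × ℂ →ₗ[ℂ] transverseTraceless k :=
    { toFun := fun p => ⟨p.1 • plusPol e₁ e₂ + p.2 • crossPol e₁ e₂,
        add_mem (Submodule.smul_mem _ _ (plusPol_mem_transverseTraceless h11 h22 h1 h2))
          (Submodule.smul_mem _ _ (crossPol_mem_transverseTraceless h12 h1 h2))⟩
      map_add' := fun p q => by
        apply Subtype.ext
        simp only [Prod.fst_add, Prod.snd_add, add_smul, Submodule.coe_add]; abel
      map_smul' := fun c p => by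
        apply Subtype.ext
        simp [smul_smul] }
  have hf : Function.Bijective f := by
    constructor
    · intro p q hpq
      have h : p.1 • plusPol e₁ e₂ + p.2 • crossPol e₁ e₂ =
          q.1 • plusPol e₁ e₂ + q.2 • crossPol e₁ e₂ := congrArg Subtype.val hpq
      refine Prod.ext ?_ ?_
      · rw [← spatialForm_fst_fst h11 h12 p.1 p.2, h, spatialForm_fst_fst h11 h12]
      · rw [← spatialForm_fst_snd h11 h22 h12 p.1 p.2, h, spatialForm_fst_snd h11 h22 h12]
    · rintro ⟨B, hB⟩
      exact ⟨(spatialForm B e₁ e₁, spatialForm B e₁ e₂), Subtype.ext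
        (eq_plusPol_add_crossPol hk h0 hB h11 h22 h12 h1 h2).symm⟩
  rw [← (LinearEquiv.ofBijective f hf).finrank_eq]
  simp

/-! ### Vacuum distributions with prescribed transverse-traceless amplitudes -/

/-- Cosines of the four transverse directions used to build vacuum distributions. -/
def coneCos : Fin 4 → ℝ := ![1, 0, Real.sqrt 2 / 2, Real.sqrt 2 / 2]

/-- Sines of the four transverse directions used to build vacuum distributions. -/
def coneSin : Fin 4 → ℝ := ![0, 1, Real.sqrt 2 / 2, -(Real.sqrt 2 / 2)]

theorem half_sqrt_two_mul_self : Real.sqrt 2 / 2 * (Real.sqrt 2 / 2) = 1 / 2 := by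
  have := Real.mul_self_sqrt (show (0 : ℝ) ≤ 2 by norm_num)
  linarith

theorem coneCos_sq_add_coneSin_sq (i : Fin 4) : coneCos i ^ 2 + coneSin i ^ 2 = 1 := by
  have := half_sqrt_two_mul_self
  fin_cases i <;> simp [coneCos, coneSin] <;> linarith

/-- The transverse direction number `i` for the spatial wave vector `K`. -/
def coneDir (i : Fin 4) (K : Fin 3 → ℝ) : Fin 3 → ℝ :=
  coneCos i • frameFst K + coneSin i • frameSnd K

theorem coneDir_dot_self (i : Fin 4) {K : Fin 3 → ℝ} (hK : K ≠ 0) :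
    coneDir i K ⬝ᵥ coneDir i K = 1 := by
  have h := coneCos_sq_add_coneSin_sq i
  simp only [coneDir, dotProduct_add, add_dotProduct, dotProduct_smul, smul_dotProduct,
    frameFst_dot_self, frameSnd_dot_self hK, frameFst_dot_frameSnd,
    dotProduct_comm (frameSnd K) (frameFst K), smul_eq_mul]
  linarith

theorem dot_coneDir (i : Fin 4) (K : Fin 3 → ℝ) : K ⬝ᵥ coneDir i K = 0 := by
  simp [coneDir, dotProduct_add, dotProduct_smul, dot_frameFst, dot_frameSnd]

@[fun_prop] theorem measurable_coneDir (i : Fin 4) (a : Fin 3) :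
    Measurable fun K => coneDir i K a := by
  simp only [coneDir, Pi.add_apply, Pi.smul_apply, smul_eq_mul]
  fun_prop

/-- The directions at 0°, 90° and at ±45° are two orthonormal bases of the transverse plane, and
each basis contributes one trace. -/
theorem sum_coneDir_form (B : Matrix (Fin 4) (Fin 4) ℂ) (hB : B.IsSymm) (K : Fin 3 → ℝ) :
    ∑ i, spatialForm B (coneDir i K) (coneDir i K) =
      2 * (spatialForm B (frameFst K) (frameFst K) + spatialForm B (frameSnd K) (frameSnd K)) := by
  have h : ((Real.sqrt 2 / 2 : ℝ) : ℂ) * ((Real.sqrt 2 / 2 : ℝ) : ℂ) = 1 / 2 := by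
    rw [← Complex.ofReal_mul, half_sqrt_two_mul_self]; norm_num
  simp only [coneDir, spatialForm_add_smul _ _ _ hB, Fin.sum_univ_four]
  simp only [coneCos, coneSin, Matrix.cons_val]
  rw [Complex.ofReal_neg]
  generalize ((Real.sqrt 2 / 2 : ℝ) : ℂ) = r at *
  push_cast
  linear_combination (2 * spatialForm B (frameFst K) (frameFst K) +
    2 * spatialForm B (frameSnd K) (frameSnd K)) * h

/-- A traceless form has value `P cos 2θ + Q sin 2θ` in the direction of angle `θ`, so the four
weights are `P, -P, Q, -Q`. The difference of `d ⊗ d` within the first pair is the `+` tensor, and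
within the second pair the `×` tensor. -/
theorem sum_coneDir_form_mul (B : Matrix (Fin 4) (Fin 4) ℂ) (hB : B.IsSymm) (K : Fin 3 → ℝ)
    (h0 : spatialForm B (frameFst K) (frameFst K) + spatialForm B (frameSnd K) (frameSnd K) = 0)
    (a b : Fin 3) :
    ∑ i, spatialForm B (coneDir i K) (coneDir i K) * (coneDir i K a * coneDir i K b : ℝ) =
      spatialForm B (frameFst K) (frameFst K) * (frameFst K a * frameFst K b -
        frameSnd K a * frameSnd K b : ℝ) + spatialForm B (frameFst K) (frameSnd K) *
        (frameFst K a * frameSnd K b + frameSnd K a * frameFst K b : ℝ) := by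
  have h : ((Real.sqrt 2 / 2 : ℝ) : ℂ) * ((Real.sqrt 2 / 2 : ℝ) : ℂ) = 1 / 2 := by
    rw [← Complex.ofReal_mul, half_sqrt_two_mul_self]; norm_num
  have h4 : ((Real.sqrt 2 / 2 : ℝ) : ℂ) ^ 4 = 1 / 4 := by
    linear_combination (((Real.sqrt 2 / 2 : ℝ) : ℂ) ^ 2 + 1 / 2) * h
  simp only [coneDir, spatialForm_add_smul _ _ _ hB, Fin.sum_univ_four, Pi.add_apply,
    Pi.smul_apply, smul_eq_mul]
  simp only [coneCos, coneSin, Matrix.cons_val]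
  push_cast
  push_cast at h h4
  have e : spatialForm B (frameSnd K) (frameSnd K) = -spatialForm B (frameFst K) (frameFst K) := by
    linear_combination h0
  rw [e]
  generalize ((Real.sqrt 2 : ℝ) : ℂ) / 2 = r at *
  generalize spatialForm B (frameFst K) (frameFst K) = P
  generalize spatialForm B (frameFst K) (frameSnd K) = Q
  linear_combination 4 * Q * ((frameFst K a : ℂ) * frameSnd K b + frameSnd K a * frameFst K b) * h4

/-- A measurable retraction of `ℝ⁴` to the light cone without its apex. -/
def coneVec (k : Fin 4 → ℝ) : Fin 4 → ℝ :=
  -- The default value is an arbitrary lightlike vector. It makes `coneWave` physical for every `k`,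
  -- and it does not matter for measures carried by the cone.
  open Classical in if mdot k k = 0 ∧ k ≠ 0 then k else ![1, 1, 0, 0]

theorem coneVec_of_null {k : Fin 4 → ℝ} (h : mdot k k = 0 ∧ k ≠ 0) : coneVec k = k := by
  rw [coneVec, if_pos h]

theorem coneVec_null (k : Fin 4 → ℝ) : mdot (coneVec k) (coneVec k) = 0 := by
  rw [coneVec]
  split_ifs with h
  · exact h.1
  · simp [mdot_eq]

theorem coneVec_ne_zero (k : Fin 4 → ℝ) : coneVec k ≠ 0 := by
  rw [coneVec]
  split_ifs with h
  · exact h.2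
  · intro h; simpa using congrFun h 0

@[fun_prop] theorem measurable_mdot_self : Measurable fun k : Fin 4 → ℝ => mdot k k := by
  simp only [mdot_eq]; fun_prop

theorem measurableSet_cone : MeasurableSet {k : Fin 4 → ℝ | mdot k k = 0 ∧ k ≠ 0} :=
  (measurable_mdot_self (measurableSet_singleton 0)).inter (measurableSet_singleton 0).compl

@[fun_prop] theorem measurable_coneVec : Measurable coneVec := by
  classical
  exact Measurable.ite measurableSet_cone measurable_id measurable_const

@[fun_prop] theorem measurable_coneVec_apply (α : Fin 4) : Measurable fun k => coneVec k α :=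
  (measurable_pi_apply α).comp measurable_coneVec

/-- The lightlike wave with wave vector `k` and direction number `i`. -/
def coneWave (i : Fin 4) (k : Fin 4 → ℝ) : LaminarWave :=
  ⟨⟨coneVec k 0, Fin.tail (coneVec k), coneDir i (Fin.tail (coneVec k)), 0⟩,
    tail_ne_zero_of_null (coneVec_null k) (coneVec_ne_zero k),
    coneDir_dot_self i (tail_ne_zero_of_null (coneVec_null k) (coneVec_ne_zero k)),
    dot_coneDir i _, le_rfl, by
      have := tail_dot_tail_of_null (coneVec_null k)
      simp [this]⟩

@[fun_prop] theorem measurable_coneWave (i : Fin 4) : Measurable (coneWave i) := by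
  refine Measurable.subtype_mk (measurable_comap_iff.mpr ?_)
  have hK : Measurable fun k => Fin.tail (coneVec k) :=
    measurable_pi_lambda _ fun a => measurable_coneVec_apply a.succ
  refine (measurable_coneVec_apply 0).prodMk (hK.prodMk (Measurable.prodMk ?_ measurable_const))
  exact measurable_pi_lambda _ fun a => (measurable_coneDir i a).comp hK

theorem coneWave_wave {k : Fin 4 → ℝ} (h : mdot k k = 0 ∧ k ≠ 0) (i : Fin 4) :
    (coneWave i k).1.wave = k := by
  change fourVec (coneVec k 0) (Fin.tail (coneVec k)) = k
  rw [coneVec_of_null h]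
  exact Fin.cons_self_tail k

/-- The density that gives the transverse-traceless amplitudes `B`. -/
def coneDensity (B : (Fin 4 → ℝ) → Matrix (Fin 4) (Fin 4) ℂ) (s : LaminarWave) : ℂ :=
  -- The factor cancels the prefactor `1/(2π²ω²)` of the lightlike metric, and the sign cancels that
  -- of `-d ⊗ d`.
  -((2 * Real.pi ^ 2 * s.1.ω ^ 2 : ℝ) : ℂ) * spatialForm (B s.1.wave) s.1.d s.1.d

section Build

variable {m : Measure (Fin 4 → ℝ)} {B : (Fin 4 → ℝ) → Matrix (Fin 4) (Fin 4) ℂ}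

theorem measurable_coneDensity (hB : ∀ μ ν, Measurable fun k => B k μ ν) :
    Measurable (coneDensity B) := by
  have : ∀ μ ν, Measurable fun s : LaminarWave => B s.1.wave μ ν := fun μ ν =>
    (hB μ ν).comp WaveParam.measurable_wave
  unfold coneDensity spatialForm
  fun_prop

theorem integrable_spatialForm_mul {f : (Fin 4 → ℝ) → ℂ} {g : (Fin 4 → ℝ) → ℝ} {C : ℝ} (i : Fin 4)
    (hf : ∀ μ ν, Integrable (fun k => f k * B k μ ν) m) (hg : AEStronglyMeasurable g m)
    (hC : ∀ᵐ k ∂m, |g k| ≤ C) :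
    Integrable (fun k => f k * spatialForm (B k) (coneWave i k).1.d (coneWave i k).1.d * g k) m := by
  have hd : ∀ a, Measurable fun k => (coneWave i k).1.d a := fun a =>
    (WaveParam.measurable_d a).comp (measurable_coneWave i)
  have h1 : ∀ a b : Fin 3, Integrable (fun k => f k * B k a.succ b.succ *
      (((coneWave i k).1.d a * (coneWave i k).1.d b * g k : ℝ) : ℂ)) m := by
    intro a b
    refine (hf a.succ b.succ).mul_bdd (c := C) ?_ ?_
    · exact Complex.continuous_ofReal.comp_aestronglyMeasurable
        ((((hd a).mul (hd b)).aestronglyMeasurable).mul hg)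
    · filter_upwards [hC] with k hk
      rw [Complex.norm_real, Real.norm_eq_abs, abs_mul, abs_mul]
      refine (mul_le_of_le_one_left (abs_nonneg _) ?_).trans hk
      exact mul_le_one₀ (WaveParam.abs_d_le (coneWave i k).2 a) (abs_nonneg _)
        (WaveParam.abs_d_le (coneWave i k).2 b)
  refine (integrable_finsetSum Finset.univ fun a _ => integrable_finsetSum Finset.univ fun b _ =>
    h1 a b).congr (Eventually.of_forall fun k => ?_)
  simp only [spatialForm, Finset.mul_sum, Finset.sum_mul]
  refine Finset.sum_congr rfl fun a _ => Finset.sum_congr rfl fun b _ => ?_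
  push_cast; ring

variable (hB : ∀ μ ν, Measurable fun k => B k μ ν) (hm : ∀ᵐ k ∂m, mdot k k = 0 ∧ k ≠ 0)
  (hTT : ∀ᵐ k ∂m, B k ∈ transverseTraceless k) (hi : ∀ μ ν, Integrable (fun k => B k μ ν) m)
  (hi2 : ∀ μ ν, Integrable (fun k => (k 0 : ℂ) ^ 2 * B k μ ν) m)

include hB hm hTT hi hi2

/-- Transverse-traceless amplitudes on the light cone come from a vacuum distribution. -/
theorem exists_defectDistribution : ∃ ρ : DefectDistribution,
    (∀ P : (Fin 4 → ℝ) → Prop, MeasurableSet {k | P k} → (∀ᵐ k ∂m, P k) →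
      ∀ᵐ s ∂ρ.measure, P s.1.wave) ∧ ρ.HasMetric ∧
    ∀ φ : (Fin 4 → ℝ) → ℂ, Measurable φ → (∀ k, ‖φ k‖ ≤ 1) → ∀ μ ν,
      ∫ s, ρ.density s * (φ s.1.wave * toC s.1.energyMomentum μ ν) ∂ρ.measure = 0 ∧
      ∫ s, ρ.density s * (φ s.1.wave * toC s.1.metric μ ν) ∂ρ.measure =
        ∫ k, φ k * B k μ ν ∂m := by
  -- One copy of `m` for each of the four directions.
  set M : Measure LaminarWave := ∑ i, m.map (coneWave i) with hM
  have hdm := measurable_coneDensity hB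
  have hint : ∀ G : LaminarWave → ℂ, Measurable G →
      (∀ i, Integrable (fun k => G (coneWave i k)) m) → Integrable G M ∧
        ∫ s, G s ∂M = ∫ k, ∑ i, G (coneWave i k) ∂m := by
    intro G hG hGi
    have h1 : ∀ i ∈ Finset.univ, Integrable G (m.map (coneWave i)) := fun i _ =>
      (integrable_map_measure hG.aestronglyMeasurable (measurable_coneWave i).aemeasurable).mpr
        (hGi i)
    refine ⟨integrable_finsetSum_measure.mpr h1, ?_⟩
    rw [hM, integral_finsetSum_measure h1, integral_finsetSum _ fun i _ => hGi i]
    exact Finset.sum_congr rfl fun i _ => integral_map (measurable_coneWave i).aemeasurable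
      hG.aestronglyMeasurable
  have hpi : (Real.pi : ℝ) ≠ 0 := Real.pi_ne_zero
  have hnull : ∀ k i, mdot (coneWave i k).1.wave (coneWave i k).1.wave = 0 := by
    intro k i
    have : (coneWave i k).1.wave = coneVec k := Fin.cons_self_tail _
    rw [this, coneVec_null]
  have hω0 : ∀ k i, (coneWave i k).1.ω ≠ 0 := fun k i =>
    zero_ne_zero_of_null (coneVec_null k) (coneVec_ne_zero k)
  -- The density contains `ω²`, which is why the moment hypothesis `hi2` enters.
  have hdens : Integrable (coneDensity B) M := by
    refine (hint _ hdm fun i => ?_).1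
    have := (integrable_spatialForm_mul (m := m) i hi2 (g := fun _ => 2 * Real.pi ^ 2)
      (C := |2 * Real.pi ^ 2|) aestronglyMeasurable_const (Eventually.of_forall fun _ => le_rfl)).neg
    refine this.congr ?_
    filter_upwards [hm] with k hk
    rw [Pi.neg_apply, coneDensity, coneWave_wave hk]
    have : (coneWave i k).1.ω = k 0 := congrFun (coneWave_wave hk i) 0
    rw [this]
    push_cast; ring
  have hmetric : ∀ (φ : (Fin 4 → ℝ) → ℂ), Measurable φ → (∀ k, ‖φ k‖ ≤ 1) → ∀ μ ν,
      Integrable (fun s => coneDensity B s * (φ s.1.wave * toC s.1.metric μ ν)) M ∧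
      ∫ s, coneDensity B s * (φ s.1.wave * toC s.1.metric μ ν) ∂M = ∫ k, φ k * B k μ ν ∂m := by
    intro φ hφ hφ1 μ ν
    have hGm : Measurable fun s : LaminarWave =>
        coneDensity B s * (φ s.1.wave * toC s.1.metric μ ν) :=
      hdm.mul ((hφ.comp WaveParam.measurable_wave).mul
        (Complex.measurable_ofReal.comp (WaveParam.measurable_metric μ ν)))
    have hpt : ∀ k, mdot k k = 0 ∧ k ≠ 0 → ∀ i,
        coneDensity B (coneWave i k) * (φ (coneWave i k).1.wave *
          toC (coneWave i k).1.metric μ ν) = φ k * spatialForm (B k) (coneWave i k).1.d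
            (coneWave i k).1.d * ((-(2 * Real.pi ^ 2 * (coneWave i k).1.ω ^ 2) *
              (coneWave i k).1.metric μ ν : ℝ) : ℂ) := by
      intro k hk i
      rw [coneDensity, coneWave_wave hk, toC, map_apply]
      push_cast; ring
    -- The `ω²` of the density cancels the `1/ω²` of the metric, so the product is bounded by `3`
    -- times a sum of entries of `B`; low frequencies cause no divergence.
    have hGi : ∀ i, Integrable (fun k => coneDensity B (coneWave i k) *
        (φ (coneWave i k).1.wave * toC (coneWave i k).1.metric μ ν)) m := by
      intro i
      have := integrable_spatialForm_mul (m := m) (B := B) (f := φ)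
        (g := fun k => -(2 * Real.pi ^ 2 * (coneWave i k).1.ω ^ 2) * (coneWave i k).1.metric μ ν)
        (C := 3) i (fun μ ν => (hi μ ν).bdd_mul hφ.aestronglyMeasurable
          (Eventually.of_forall hφ1)) ?_ ?_
      · refine this.congr ?_
        filter_upwards [hm] with k hk
        rw [hpt k hk i]
      · refine Measurable.aestronglyMeasurable ?_
        have h1 := (WaveParam.measurable_metric μ ν).comp (measurable_coneWave i)
        have h2 := WaveParam.measurable_ω.comp (measurable_coneWave i)
        exact (((h2.pow_const 2).const_mul _).neg).mul h1
      · refine Eventually.of_forall fun k => ?_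
        have h1 := WaveParam.abs_nullMetric_le (coneWave i k).2 μ ν
        have h2 := hω0 k i
        have h3 : 0 < 2 * Real.pi ^ 2 * (coneWave i k).1.ω ^ 2 := by positivity
        rw [le_div_iff₀ h3] at h1
        rw [WaveParam.metric_of_null (coneWave i k).2 (hnull k i), abs_mul, abs_neg,
          abs_of_pos h3, mul_comm]
        exact h1
    obtain ⟨hG1, hG2⟩ := hint _ hGm hGi
    refine ⟨hG1, hG2.trans (integral_congr_ae ?_)⟩
    filter_upwards [hm, hTT] with k hk hT
    have hK := tail_ne_zero_of_null hk.1 hk.2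
    have hsum := spatialForm_add_spatialForm hk.1 hk.2 hT (frameFst_dot_self _)
      (frameSnd_dot_self hK) (frameFst_dot_frameSnd _) (dot_frameFst _) (dot_frameSnd _)
    have hdir : ∀ i, (coneWave i k).1.d = coneDir i (Fin.tail k) := fun i => by
      change coneDir i (Fin.tail (coneVec k)) = _
      rw [coneVec_of_null hk]
    have hK' : ∀ i, (coneWave i k).1.K = Fin.tail k := fun i => by
      change Fin.tail (coneVec k) = _
      rw [coneVec_of_null hk]
    rw [Finset.sum_congr rfl fun i _ => hpt k hk i]
    simp only [fun i => WaveParam.metric_of_null (coneWave i k).2 (hnull k i)]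
    refine Fin.cases ?_ (fun a => ?_) μ
    · simp [hT.2.1]
    refine Fin.cases ?_ (fun b => ?_) ν
    · rw [hT.1.apply]; simp [hT.2.1]
    -- Only `d ⊗ d` depends on the direction. The remaining term is common to the four waves and is
    -- multiplied by the sum of the weights, which vanishes.
    have e1 : ∀ i, -(2 * Real.pi ^ 2 * (coneWave i k).1.ω ^ 2) *
        (coneWave i k).1.nullMetric a.succ b.succ = coneDir i (Fin.tail k) a *
          coneDir i (Fin.tail k) b - ((1 : Matrix (Fin 3) (Fin 3) ℝ) a b -
            Fin.tail k a * Fin.tail k b / (Fin.tail k ⬝ᵥ Fin.tail k)) := by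
      intro i
      have h2 := hω0 k i
      rw [WaveParam.nullMetric_succ, hdir, hK']
      field_simp
      ring
    simp only [e1, hdir]
    have e2 : B k a.succ b.succ = _ := congrFun (congrFun (eq_plusPol_add_crossPol hk.1 hk.2 hT
      (frameFst_dot_self _) (frameSnd_dot_self hK) (frameFst_dot_frameSnd _) (dot_frameFst _)
      (dot_frameSnd _)) a.succ) b.succ
    have e3 := sum_coneDir_form_mul (B k) hT.1 (Fin.tail k) hsum a b
    have e4 := sum_coneDir_form (B k) hT.1 (Fin.tail k)
    rw [hsum, mul_zero] at e4
    generalize (1 : Matrix (Fin 3) (Fin 3) ℝ) a b -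
      Fin.tail k a * Fin.tail k b / (Fin.tail k ⬝ᵥ Fin.tail k) = c
    calc _ = φ k * ∑ i, spatialForm (B k) (coneDir i (Fin.tail k)) (coneDir i (Fin.tail k)) *
          (coneDir i (Fin.tail k) a * coneDir i (Fin.tail k) b : ℝ) - φ k * c *
            ∑ i, spatialForm (B k) (coneDir i (Fin.tail k)) (coneDir i (Fin.tail k)) := by
          simp only [Fin.sum_univ_four]; push_cast; ring
      _ = _ := by
          rw [e3, e4, e2]
          simp only [Matrix.add_apply, Matrix.smul_apply, plusPol, crossPol, fourVec_apply_succ,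
            smul_eq_mul]
          ring
  refine ⟨⟨M, coneDensity B, hdens⟩, ?_, ?_, ?_⟩
  · intro P hP hPm
    change ∀ᵐ s ∂M, P s.1.wave
    have hPs : MeasurableSet {s : LaminarWave | P s.1.wave} := WaveParam.measurable_wave hP
    rw [hM, ae_iff, Measure.finsetSum_apply]
    refine Finset.sum_eq_zero fun i _ => ?_
    rw [← ae_iff, ae_map_iff (measurable_coneWave i).aemeasurable hPs]
    filter_upwards [hm, hPm] with k hk hkP
    rwa [coneWave_wave hk]
  · intro μ ν
    have := (hmetric (fun _ => 1) measurable_const (by simp) μ ν).1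
    simpa using this
  · intro φ hφ hφ1 μ ν
    refine ⟨?_, (hmetric φ hφ hφ1 μ ν).2⟩
    change ∫ s, coneDensity B s * (φ s.1.wave * toC s.1.energyMomentum μ ν) ∂M = 0
    have hGm : Measurable fun s : LaminarWave =>
        coneDensity B s * (φ s.1.wave * toC s.1.energyMomentum μ ν) :=
      hdm.mul ((hφ.comp WaveParam.measurable_wave).mul
        (Complex.measurable_ofReal.comp (WaveParam.measurable_energyMomentum μ ν)))
    -- The energy-momentum is the same for all four directions, so the vanishing sum of the weights
    -- cancels it at each `k` separately.
    have hpt : ∀ k, mdot k k = 0 ∧ k ≠ 0 → ∀ i,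
        coneDensity B (coneWave i k) * (φ (coneWave i k).1.wave *
          toC (coneWave i k).1.energyMomentum μ ν) = spatialForm (B k) (coneWave i k).1.d
            (coneWave i k).1.d * (-(2 * Real.pi ^ 2) * φ k * lower k μ * lower k ν) := by
      intro k hk i
      have h2 : ((coneWave i k).1.ω : ℂ) ≠ 0 := by exact_mod_cast hω0 k i
      rw [coneDensity, coneWave_wave hk, toC, map_apply,
        WaveParam.energyMomentum_of_null (coneWave i k).2 (hnull k i), coneWave_wave hk]
      push_cast
      field_simp
    have hGi : ∀ i, Integrable (fun k => coneDensity B (coneWave i k) *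
        (φ (coneWave i k).1.wave * toC (coneWave i k).1.energyMomentum μ ν)) m := by
      intro i
      have h1 : Integrable (coneDensity B) (m.map (coneWave i)) :=
        (integrable_finsetSum_measure.mp hdens) i (Finset.mem_univ i)
      have h2 := (integrable_map_measure hdm.aestronglyMeasurable
        (measurable_coneWave i).aemeasurable).mp h1
      refine h2.mul_bdd (c := 2) ?_ ?_
      · exact (((hφ.comp WaveParam.measurable_wave).mul (Complex.measurable_ofReal.comp
          (WaveParam.measurable_energyMomentum μ ν))).comp
            (measurable_coneWave i)).aestronglyMeasurable
      · refine Eventually.of_forall fun k => ?_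
        rw [norm_mul]
        refine (mul_le_of_le_one_left (norm_nonneg _) (hφ1 _)).trans ?_
        simpa [toC] using WaveParam.abs_energyMomentum_le (coneWave i k).2 μ ν
    rw [(hint _ hGm hGi).2]
    refine integral_eq_zero_of_ae ?_
    filter_upwards [hm, hTT] with k hk hT
    have hK := tail_ne_zero_of_null hk.1 hk.2
    have hsum := spatialForm_add_spatialForm hk.1 hk.2 hT (frameFst_dot_self _)
      (frameSnd_dot_self hK) (frameFst_dot_frameSnd _) (dot_frameFst _) (dot_frameSnd _)
    have hdir : ∀ i, (coneWave i k).1.d = coneDir i (Fin.tail k) := fun i => by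
      change coneDir i (Fin.tail (coneVec k)) = _
      rw [coneVec_of_null hk]
    rw [Finset.sum_congr rfl fun i _ => hpt k hk i, ← Finset.sum_mul]
    simp only [hdir]
    rw [sum_coneDir_form _ hT.1, hsum]
    simp

end Build

/-! ### Lightlike modes -/

theorem integral_linearCombination_three {α : Type*} [MeasurableSpace α] {m : Measure α}
    {f g h : α → ℂ} (hf : Integrable f m) (hg : Integrable g m) (hh : Integrable h m) (a b c : ℂ) :
    ∫ s, (a * f s + b * g s + c * h s) ∂m = a * ∫ s, f s ∂m + b * ∫ s, g s ∂m + c * ∫ s, h s ∂m := by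
  have h1 : Integrable (fun s => a * f s) m := hf.const_mul a
  have h2 : Integrable (fun s => b * g s) m := hg.const_mul b
  have h3 : Integrable (fun s => c * h s) m := hh.const_mul c
  have h12 : Integrable (fun s => a * f s + b * g s) m := h1.add h2
  rw [integral_add h12 h3, integral_add h1 h2, integral_const_mul, integral_const_mul,
    integral_const_mul]

/-- Every laminar wave has `T_00 = 1`, because `u_0 = -1` and `d_0 = 0`. -/
theorem integral_density_eq_zero {ρ : DefectDistribution} (hT : ρ.modeT = 0) :
    ∫ s, ρ.density s ∂ρ.measure = 0 := by
  have h : ρ.modeT 0 0 = 0 := by rw [hT]; rfl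
  rw [← h]
  simp [DefectDistribution.modeT, DefectDistribution.superpose, toC, WaveParam.energyMomentum]

section Lightlike

variable {k : Fin 4 → ℝ} (hk : mdot k k = 0) (h0 : k ≠ 0)

include hk h0

/-- Every transverse-traceless amplitude is produced by a vacuum mode. -/
theorem exists_mode {H : Matrix (Fin 4) (Fin 4) ℂ} (hH : H ∈ transverseTraceless k) :
    ∃ ρ : DefectDistribution, ρ.IsMode k ∧ ρ.modeT = 0 ∧ ρ.modeH = H := by
  have hae : ∀ P : (Fin 4 → ℝ) → Prop, P k → ∀ᵐ k' ∂(Measure.dirac k), P k' := fun P hP => by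
    rw [ae_dirac_eq]; exact hP
  obtain ⟨ρ, h1, -, h2⟩ := exists_defectDistribution (m := Measure.dirac k) (B := fun _ => H)
    (fun _ _ => measurable_const) (hae _ ⟨hk, h0⟩) (hae _ hH)
    (fun _ _ => integrable_const _) (fun μ ν => integrable_dirac enorm_lt_top)
  refine ⟨ρ, h1 (fun k' => k' = k) (measurableSet_singleton k) (hae _ rfl), ?_, ?_⟩
  · ext μ ν
    have := (h2 (fun _ => 1) measurable_const (by simp) μ ν).1
    simp only [one_mul] at this
    exact this
  · ext μ ν
    have := (h2 (fun _ => 1) measurable_const (by simp) μ ν).2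
    simp only [one_mul, integral_dirac] at this
    exact this

variable {ρ : DefectDistribution} (hρ : ρ.IsMode k) (hT : ρ.modeT = 0)

include hρ hT

/-- The metric perturbation of a lightlike vacuum mode in terms of its second moments. -/
theorem modeH_eq_polarizations {e₁ e₂ : Fin 3 → ℝ} (h11 : e₁ ⬝ᵥ e₁ = 1) (h22 : e₂ ⬝ᵥ e₂ = 1)
    (h12 : e₁ ⬝ᵥ e₂ = 0) (h1 : Fin.tail k ⬝ᵥ e₁ = 0) (h2 : Fin.tail k ⬝ᵥ e₂ = 0) :
    ρ.modeH = (1 / (2 * (Real.pi : ℂ) ^ 2 * (k 0 : ℂ) ^ 2)) •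
      (ρ.cosMoment e₁ e₂ • plusPol e₁ e₂ + ρ.sinMoment e₁ e₂ • crossPol e₁ e₂) := by
  have hint := integral_density_eq_zero hT
  have hbound : ∀ e : Fin 3 → ℝ, ∀ s : LaminarWave, |s.1.d ⬝ᵥ e| ≤ ∑ i, |e i| := by
    intro e s
    refine (Finset.abs_sum_le_sum_abs _ _).trans (Finset.sum_le_sum fun i _ => ?_)
    rw [abs_mul]
    exact mul_le_of_le_one_left (abs_nonneg _) (WaveParam.abs_d_le s.2 i)
  have hmeas : ∀ e : Fin 3 → ℝ, Measurable fun s : LaminarWave => s.1.d ⬝ᵥ e := fun e => by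
    simp only [dotProduct]; fun_prop
  have hprod : ∀ e e' : Fin 3 → ℝ, Integrable (fun s : LaminarWave =>
      ρ.density s * (((s.1.d ⬝ᵥ e) * (s.1.d ⬝ᵥ e') : ℝ) : ℂ)) ρ.measure := by
    intro e e'
    refine ρ.integrable.mul_bdd (c := (∑ i, |e i|) * ∑ i, |e' i|) ?_ ?_
    · exact (Complex.measurable_ofReal.comp ((hmeas e).mul (hmeas e'))).aestronglyMeasurable
    · refine Eventually.of_forall fun s => ?_
      rw [Complex.norm_real, Real.norm_eq_abs, abs_mul]
      exact mul_le_mul (hbound e s) (hbound e' s) (abs_nonneg _)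
        (Finset.sum_nonneg fun _ _ => abs_nonneg _)
  have hcos : Integrable (fun s : LaminarWave => ρ.density s *
      (((s.1.d ⬝ᵥ e₂) ^ 2 - (s.1.d ⬝ᵥ e₁) ^ 2 : ℝ) : ℂ)) ρ.measure :=
    ((hprod e₂ e₂).sub (hprod e₁ e₁)).congr (Eventually.of_forall fun s => by
      simp only [Pi.sub_apply]; push_cast; ring)
  have hsin : Integrable (fun s : LaminarWave => ρ.density s *
      ((-2 * (s.1.d ⬝ᵥ e₁) * (s.1.d ⬝ᵥ e₂) : ℝ) : ℂ)) ρ.measure :=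
    ((hprod e₁ e₂).const_mul (-2)).congr (Eventually.of_forall fun s => by push_cast; ring)
  have hK := tail_ne_zero_of_null hk h0
  have hk0 := zero_ne_zero_of_null hk h0
  have hk0' : (k 0 : ℂ) ≠ 0 := by exact_mod_cast hk0
  have hpi := pi_sq_ne_zero
  ext μ ν
  set c : ℂ := 1 / (2 * (Real.pi : ℂ) ^ 2 * (k 0 : ℂ) ^ 2) with hc
  set q : ℂ := ((fourVec 0 e₁ μ * fourVec 0 e₁ ν + fourVec 0 e₂ μ * fourVec 0 e₂ ν : ℝ) : ℂ)
  -- With `x = d·e₁`, `y = d·e₂` and `x² + y² = 1`, the tensor `P - d ⊗ d` is half of `P + (y² -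
  -- x²)(+) - 2xy (×)`. Here `y² - x² = cos 2φ` and `-2xy = sin 2φ`; the term with `P`, whose entry
  -- is `q`, integrates to zero with the total weight.
  have hpt : ∀ s : LaminarWave, s.1.wave = k → ρ.density s * toC s.1.metric μ ν =
      c / 2 * q * ρ.density s + c / 2 * plusPol e₁ e₂ μ ν * (ρ.density s *
        (((s.1.d ⬝ᵥ e₂) ^ 2 - (s.1.d ⬝ᵥ e₁) ^ 2 : ℝ) : ℂ)) + c / 2 * crossPol e₁ e₂ μ ν *
          (ρ.density s * ((-2 * (s.1.d ⬝ᵥ e₁) * (s.1.d ⬝ᵥ e₂) : ℝ) : ℂ)) := by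
    intro s hs
    have hsK : s.1.K = Fin.tail k := by rw [← hs]; rfl
    have hsω : s.1.ω = k 0 := by rw [← hs]; rfl
    have hR : s.1.metric μ ν = 1 / (2 * Real.pi ^ 2 * k 0 ^ 2) * (1 / 2) *
        (fourVec 0 e₁ μ * fourVec 0 e₁ ν + fourVec 0 e₂ μ * fourVec 0 e₂ ν +
        (fourVec 0 e₁ μ * fourVec 0 e₁ ν - fourVec 0 e₂ μ * fourVec 0 e₂ ν) *
          ((s.1.d ⬝ᵥ e₂) ^ 2 - (s.1.d ⬝ᵥ e₁) ^ 2) +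
        (fourVec 0 e₁ μ * fourVec 0 e₂ ν + fourVec 0 e₂ μ * fourVec 0 e₁ ν) *
          (-2 * (s.1.d ⬝ᵥ e₁) * (s.1.d ⬝ᵥ e₂))) := by
      rw [WaveParam.metric_of_null s.2 (by rw [hs]; exact hk)]
      refine Fin.cases ?_ (fun a => ?_) μ
      · simp
      refine Fin.cases ?_ (fun b => ?_) ν
      · simp
      have hcomp := frame_complete hK h11 h22 h12 h1 h2
      have hd : ∀ a, s.1.d a = (s.1.d ⬝ᵥ e₁) * e₁ a + (s.1.d ⬝ᵥ e₂) * e₂ a := by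
        intro a
        have hKd : Fin.tail k ⬝ᵥ s.1.d = 0 := by rw [← hsK]; exact s.2.2.2.1
        have : s.1.d a = ∑ b, (1 : Matrix (Fin 3) (Fin 3) ℝ) a b * s.1.d b := by
          simp [Matrix.one_apply]
        rw [this]
        simp only [← hcomp]
        calc _ = Fin.tail k a / (Fin.tail k ⬝ᵥ Fin.tail k) * (Fin.tail k ⬝ᵥ s.1.d) +
            ((s.1.d ⬝ᵥ e₁) * e₁ a + (s.1.d ⬝ᵥ e₂) * e₂ a) := by
              simp only [dotProduct, Fin.sum_univ_three]; ring
          _ = _ := by rw [hKd]; ring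
      have hnorm : (s.1.d ⬝ᵥ e₁) ^ 2 + (s.1.d ⬝ᵥ e₂) ^ 2 = 1 := by
        calc _ = ∑ a, s.1.d a * ((s.1.d ⬝ᵥ e₁) * e₁ a + (s.1.d ⬝ᵥ e₂) * e₂ a) := by
              simp only [dotProduct, Fin.sum_univ_three]; ring
          _ = s.1.d ⬝ᵥ s.1.d := by simp only [← hd]; rfl
          _ = 1 := s.2.2.1
      rw [WaveParam.nullMetric_succ, hsK, hsω, ← hcomp a b, hd a, hd b]
      simp only [fourVec_apply_succ]
      generalize s.1.d ⬝ᵥ e₁ = x at *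
      generalize s.1.d ⬝ᵥ e₂ = y at *
      linear_combination (-1 / (2 * (2 * Real.pi ^ 2 * k 0 ^ 2))) *
        (e₁ a * e₁ b + e₂ a * e₂ b) * hnorm
    simp only [toC, map_apply, hR, plusPol, crossPol, c, q]
    push_cast
    ring
  calc ρ.modeH μ ν = ∫ s, ρ.density s * toC s.1.metric μ ν ∂ρ.measure := rfl
    _ = ∫ s, (c / 2 * q * ρ.density s + c / 2 * plusPol e₁ e₂ μ ν * (ρ.density s *
        (((s.1.d ⬝ᵥ e₂) ^ 2 - (s.1.d ⬝ᵥ e₁) ^ 2 : ℝ) : ℂ)) + c / 2 * crossPol e₁ e₂ μ ν *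
          (ρ.density s * ((-2 * (s.1.d ⬝ᵥ e₁) * (s.1.d ⬝ᵥ e₂) : ℝ) : ℂ))) ∂ρ.measure :=
        integral_congr_ae (by filter_upwards [hρ] with s hs; exact hpt s hs)
    _ = _ := by
        rw [integral_linearCombination_three ρ.integrable hcos hsin, hint]
        simp only [Matrix.smul_apply, Matrix.add_apply, smul_eq_mul,
          DefectDistribution.cosMoment, DefectDistribution.sinMoment]
        ring

end Lightlike

/-- The metric perturbation of a lightlike vacuum mode is transverse-traceless. -/
theorem modeH_mem_transverseTraceless {k : Fin 4 → ℝ} (hk : mdot k k = 0) (h0 : k ≠ 0)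
    {ρ : DefectDistribution} (hρ : ρ.IsMode k) (hT : ρ.modeT = 0) :
    ρ.modeH ∈ transverseTraceless k := by
  have hK := tail_ne_zero_of_null hk h0
  rw [modeH_eq_polarizations hk h0 hρ hT (frameFst_dot_self (Fin.tail k)) (frameSnd_dot_self hK)
    (frameFst_dot_frameSnd _) (dot_frameFst _) (dot_frameSnd _)]
  exact Submodule.smul_mem _ _ (add_mem
    (Submodule.smul_mem _ _ (plusPol_mem_transverseTraceless (frameFst_dot_self _)
      (frameSnd_dot_self hK) (dot_frameFst _) (dot_frameSnd _)))
    (Submodule.smul_mem _ _ (crossPol_mem_transverseTraceless (frameFst_dot_frameSnd _)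
      (dot_frameFst _) (dot_frameSnd _))))

/-- Every pair of second moments occurs among the vacuum modes. -/
theorem exists_mode_moments {k : Fin 4 → ℝ} (hk : mdot k k = 0) (h0 : k ≠ 0) {e₁ e₂ : Fin 3 → ℝ}
    (h11 : e₁ ⬝ᵥ e₁ = 1) (h22 : e₂ ⬝ᵥ e₂ = 1) (h12 : e₁ ⬝ᵥ e₂ = 0)
    (h1 : Fin.tail k ⬝ᵥ e₁ = 0) (h2 : Fin.tail k ⬝ᵥ e₂ = 0) (a b : ℂ) :
    ∃ ρ : DefectDistribution, ρ.IsMode k ∧ ρ.modeT = 0 ∧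
      ρ.cosMoment e₁ e₂ = a ∧ ρ.sinMoment e₁ e₂ = b := by
  set c : ℂ := 1 / (2 * (Real.pi : ℂ) ^ 2 * (k 0 : ℂ) ^ 2) with hc
  have hc0 : c ≠ 0 := by
    have : (k 0 : ℂ) ≠ 0 := by exact_mod_cast zero_ne_zero_of_null hk h0
    exact one_div_ne_zero (mul_ne_zero (mul_ne_zero two_ne_zero pi_sq_ne_zero)
      (pow_ne_zero _ this))
  obtain ⟨ρ, hρ, hT, hH⟩ := exists_mode hk h0 (Submodule.smul_mem _ c (add_mem
    (Submodule.smul_mem _ a (plusPol_mem_transverseTraceless h11 h22 h1 h2))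
    (Submodule.smul_mem _ b (crossPol_mem_transverseTraceless h12 h1 h2))))
  refine ⟨ρ, hρ, hT, ?_⟩
  rw [modeH_eq_polarizations hk h0 hρ hT h11 h22 h12 h1 h2] at hH
  have hH' := smul_right_injective _ hc0 hH
  constructor
  · rw [← spatialForm_fst_fst h11 h12 (ρ.cosMoment e₁ e₂) (ρ.sinMoment e₁ e₂), hH',
      spatialForm_fst_fst h11 h12]
  · rw [← spatialForm_fst_snd h11 h22 h12 (ρ.cosMoment e₁ e₂) (ρ.sinMoment e₁ e₂), hH',
      spatialForm_fst_snd h11 h22 h12]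

/-- Every non-constant vacuum mode arises, up to gauge, from a vacuum distribution. -/
theorem exists_mode_add_gaugeMode {k : Fin 4 → ℝ} (h0 : k ≠ 0) {H : Matrix (Fin 4) (Fin 4) ℂ}
    (hs : H.IsSymm) (hE : linEinsteinMode k H = 0) :
    ∃ ρ : DefectDistribution, ρ.IsMode k ∧ ρ.modeT = 0 ∧
      ∃ ξ : Fin 4 → ℂ, H = ρ.modeH + gaugeMode k ξ := by
  have key : H = gaugeFixed k H + gaugeMode k (gaugeVec k H) := by
    rw [gaugeFixed, sub_add_cancel]
  by_cases hk : mdot k k = 0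
  · obtain ⟨ρ, hρ, hT, hH⟩ := exists_mode hk h0 (gaugeFixed_mem_transverseTraceless hk h0 hs
      (linRicciMode_eq_zero hE))
    exact ⟨ρ, hρ, hT, _, by rw [hH]; exact key⟩
  -- Off the cone a vacuum mode is pure gauge, so no defects are needed.
  · refine ⟨⟨0, 0, integrable_zero _ _ _⟩, ?_, ?_, gaugeVec k H, ?_⟩
    · simp [DefectDistribution.IsMode]
    · ext μ ν; simp [DefectDistribution.modeT, DefectDistribution.superpose]
    · rw [gaugeFixed_of_nonNull hk (linRicciMode_eq_zero hE)] at key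
      have : DefectDistribution.modeH ⟨0, 0, integrable_zero _ _ _⟩ = 0 := by
        ext μ ν; simp [DefectDistribution.modeH, DefectDistribution.superpose]
      rw [this]; exact key

/-! ### Superpositions of plane waves -/

theorem norm_phase (k x : Fin 4 → ℝ) : ‖phase k x‖ = 1 := by
  rw [phase]
  have : 2 * (Real.pi : ℂ) * Complex.I * (mdot k x : ℂ) =
      ((2 * Real.pi * mdot k x : ℝ) : ℂ) * Complex.I := by push_cast; ring
  rw [this, Complex.norm_exp_ofReal_mul_I]

theorem measurable_phase (x : Fin 4 → ℝ) : Measurable fun k => phase k x := by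
  simp only [phase, mdot_eq]
  fun_prop

theorem norm_phase_sub_one_le (k x : Fin 4 → ℝ) :
    ‖phase k x - 1‖ ≤ 2 * Real.pi * |mdot k x| := by
  have h := Real.norm_exp_I_mul_ofReal_sub_one_le (x := 2 * Real.pi * mdot k x)
  have h2 : phase k x = Complex.exp (Complex.I * ((2 * Real.pi * mdot k x : ℝ) : ℂ)) := by
    rw [phase]; congr 1; push_cast; ring
  rw [h2]
  refine h.trans_eq ?_
  rw [Real.norm_eq_abs, abs_mul, abs_of_pos (by positivity)]

/-- The coordinate `x^μ` as a complex-valued continuous linear map. -/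
def coordC (μ : Fin 4) : (Fin 4 → ℝ) →L[ℝ] ℂ :=
  Complex.ofRealCLM.comp (ContinuousLinearMap.proj μ)

theorem coordC_apply (μ : Fin 4) (x : Fin 4 → ℝ) : coordC μ x = (x μ : ℂ) := rfl

theorem mdot_eq_sum_coordC (k x : Fin 4 → ℝ) :
    (mdot k x : ℂ) = ∑ μ, (lower k μ : ℂ) * coordC μ x := by
  simp only [coordC_apply, mdot, dotProduct]; push_cast; rfl

theorem hasFDerivAt_phase (k x : Fin 4 → ℝ) : HasFDerivAt (phase k)
    (∑ μ, (2 * Real.pi * Complex.I * lower k μ * phase k x) • coordC μ) x := by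
  have h1 : HasFDerivAt (fun y => 2 * Real.pi * Complex.I * (mdot k y : ℂ))
      (∑ μ, (2 * Real.pi * Complex.I * lower k μ : ℂ) • coordC μ) x := by
    have : (fun y => 2 * Real.pi * Complex.I * (mdot k y : ℂ)) =
        ⇑(∑ μ, (2 * Real.pi * Complex.I * lower k μ : ℂ) • coordC μ) := by
      funext y
      rw [mdot_eq_sum_coordC, Finset.mul_sum]
      simp [mul_assoc]
    rw [this]
    exact ContinuousLinearMap.hasFDerivAt _
  have h2 := h1.cexp
  refine h2.congr_fderiv ?_
  rw [Finset.smul_sum]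
  refine Finset.sum_congr rfl fun μ _ => ?_
  rw [smul_smul]
  congr 1
  rw [phase]; ring

theorem measurable_lower (μ : Fin 4) : Measurable fun k => lower k μ := by
  simp only [lower_apply]; fun_prop

variable {m : Measure (Fin 4 → ℝ)}

theorem integrable_mul_phase {a : (Fin 4 → ℝ) → ℂ} (ha : Integrable a m) (x : Fin 4 → ℝ) :
    Integrable (fun k => a k * phase k x) m :=
  ha.mul_bdd (c := 1) (measurable_phase x).aestronglyMeasurable
    (Eventually.of_forall fun k => (norm_phase k x).le)

theorem integrable_lower_mul {a : (Fin 4 → ℝ) → ℂ} {μ : Fin 4}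
    (ha : Integrable (fun k => (k μ : ℂ) * a k) m) :
    Integrable (fun k => (lower k μ : ℂ) * a k) m := by
  refine (ha.const_mul (eta μ μ : ℂ)).congr (Eventually.of_forall fun k => ?_)
  simp only [lower_apply]; push_cast; ring

theorem continuous_integral_mul_phase {a : (Fin 4 → ℝ) → ℂ} (ha : Integrable a m) :
    Continuous fun x => ∫ k, a k * phase k x ∂m := by
  refine continuous_of_dominated (bound := fun k => ‖a k‖)
    (fun x => (integrable_mul_phase ha x).aestronglyMeasurable)
    (fun x => Eventually.of_forall fun k => ?_) ha.norm (Eventually.of_forall fun k => ?_)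
  · rw [norm_mul, norm_phase, mul_one]
  · exact continuous_const.mul
      (continuous_iff_continuousAt.mpr fun x => (hasFDerivAt_phase k x).continuousAt)

/-- Subtracting 1 from the phase gains a factor `k·x`. This is needed for the gauge field, whose
amplitude is of order `|A|/|k|`: it need not be integrable near `k = 0`, but its products with `k_μ`
are. -/
theorem integrable_mul_phase_sub_one {a : (Fin 4 → ℝ) → ℂ} (ham : AEStronglyMeasurable a m)
    (ha : ∀ μ, Integrable (fun k => (k μ : ℂ) * a k) m) (x : Fin 4 → ℝ) :
    Integrable (fun k => a k * (phase k x - 1)) m := by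
  have hb : Integrable (fun k => ∑ μ, 2 * Real.pi * |x μ| * ‖(k μ : ℂ) * a k‖) m :=
    integrable_finsetSum _ fun μ _ => (ha μ).norm.const_mul _
  refine hb.mono' (ham.mul ((measurable_phase x).sub measurable_const).aestronglyMeasurable)
    (Eventually.of_forall fun k => ?_)
  rw [norm_mul]
  have h1 := norm_phase_sub_one_le k x
  have h2 : |mdot k x| ≤ ∑ μ, |k μ| * |x μ| := by
    rw [mdot, dotProduct]
    refine (Finset.abs_sum_le_sum_abs _ _).trans_eq (Finset.sum_congr rfl fun μ _ => ?_)
    rw [abs_mul, abs_lower]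
  calc ‖a k‖ * ‖phase k x - 1‖ ≤ ‖a k‖ * (2 * Real.pi * ∑ μ, |k μ| * |x μ|) := by
        gcongr; exact h1.trans (by gcongr)
    _ = _ := by
        rw [Finset.mul_sum, Finset.mul_sum]
        refine Finset.sum_congr rfl fun μ _ => ?_
        rw [norm_mul, Complex.norm_real, Real.norm_eq_abs]; ring

/-- The differential of `a (e^{2πik·x} - 1)` with respect to `x`. -/
def phaseDeriv (a : ℂ) (k x : Fin 4 → ℝ) : (Fin 4 → ℝ) →L[ℝ] ℂ :=
  ∑ μ, ((2 * Real.pi * Complex.I * (lower k μ * a)) * phase k x) • coordC μ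

theorem hasFDerivAt_mul_phase_sub_one (a : ℂ) (k x : Fin 4 → ℝ) :
    HasFDerivAt (fun y => a * (phase k y - 1)) (phaseDeriv a k x) x := by
  have := ((hasFDerivAt_phase k x).sub_const 1).const_mul a
  refine this.congr_fderiv ?_
  rw [phaseDeriv, Finset.smul_sum]
  refine Finset.sum_congr rfl fun μ _ => ?_
  rw [smul_smul]
  congr 1
  ring

theorem norm_phaseDeriv_le (a : ℂ) (k x : Fin 4 → ℝ) : ‖phaseDeriv a k x‖ ≤
    ∑ μ, ‖2 * Real.pi * Complex.I * ((lower k μ : ℂ) * a)‖ * ‖coordC μ‖ := by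
  refine (norm_sum_le _ _).trans (Finset.sum_le_sum fun μ _ => ?_)
  rw [norm_smul, norm_mul _ (phase k x), norm_phase, mul_one]

theorem integrable_sum_smul {ι α E : Type*} [Fintype ι] [MeasurableSpace α] {m : Measure α}
    [NormedAddCommGroup E] [NormedSpace ℝ E] [NormedSpace ℂ E] {f : ι → α → ℂ}
    (hf : ∀ i, Integrable (f i) m) (v : ι → E) : Integrable (fun a => ∑ i, f i a • v i) m :=
  integrable_finsetSum _ fun i _ => (hf i).smul_const (v i)

theorem integral_sum_smul {ι α E : Type*} [Fintype ι] [MeasurableSpace α] {m : Measure α}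
    [NormedAddCommGroup E] [NormedSpace ℝ E] [NormedSpace ℂ E] [CompleteSpace E] {f : ι → α → ℂ}
    (hf : ∀ i, Integrable (f i) m) (v : ι → E) :
    ∫ a, ∑ i, f i a • v i ∂m = ∑ i, (∫ a, f i a ∂m) • v i := by
  rw [integral_finsetSum _ fun i _ => (hf i).smul_const (v i)]
  exact Finset.sum_congr rfl fun i _ => integral_smul_const _ _

/-- The superposition `∫ a (e^{2πik·x} - 1) dm` is differentiable as soon as `k a` is integrable. -/
theorem hasFDerivAt_integral_phase_sub_one {a : (Fin 4 → ℝ) → ℂ} (ham : AEStronglyMeasurable a m)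
    (ha : ∀ μ, Integrable (fun k => (k μ : ℂ) * a k) m) (x : Fin 4 → ℝ) :
    HasFDerivAt (fun x => ∫ k, a k * (phase k x - 1) ∂m)
      (∑ μ, (∫ k, (2 * Real.pi * Complex.I * (lower k μ * a k)) * phase k x ∂m) • coordC μ) x := by
  have hl : ∀ μ, Integrable (fun k => 2 * Real.pi * Complex.I * ((lower k μ : ℂ) * a k)) m :=
    fun μ => (integrable_lower_mul (ha μ)).const_mul _
  have hlp := fun μ => integrable_mul_phase (hl μ) x
  have hF : Integrable (fun k => phaseDeriv (a k) k x) m := integrable_sum_smul hlp coordC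
  have hF' : ∫ k, phaseDeriv (a k) k x ∂m =
      ∑ μ, (∫ k, (2 * Real.pi * Complex.I * (lower k μ * a k)) * phase k x ∂m) • coordC μ :=
    integral_sum_smul hlp coordC
  rw [← hF']
  exact hasFDerivAt_integral_of_dominated_of_fderiv_le (𝕜 := ℝ) (μ := m) (x₀ := x)
    (s := Set.univ) (F := fun x k => a k * (phase k x - 1))
    (F' := fun x k => phaseDeriv (a k) k x)
    (bound := fun k => ∑ μ, ‖2 * Real.pi * Complex.I * ((lower k μ : ℂ) * a k)‖ * ‖coordC μ‖)
    univ_mem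
    (Eventually.of_forall fun y => (integrable_mul_phase_sub_one ham ha y).aestronglyMeasurable)
    (integrable_mul_phase_sub_one ham ha x) hF.aestronglyMeasurable
    (Eventually.of_forall fun k y _ => norm_phaseDeriv_le (a k) k y)
    (integrable_finsetSum _ fun μ _ => (hl μ).norm.mul_const _)
    (Eventually.of_forall fun k y _ => hasFDerivAt_mul_phase_sub_one (a k) k y)

theorem sum_smul_coordC_single (c : Fin 4 → ℂ) (μ : Fin 4) :
    (∑ ν, c ν • coordC ν) (Pi.single μ 1) = c μ := by
  simp only [_root_.sum_apply, _root_.smul_apply, coordC_apply]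
  rw [Finset.sum_eq_single μ]
  · simp
  · intro ν _ h; simp [Pi.single_eq_of_ne h]
  · simp

theorem pd_of_hasFDerivAt {f : (Fin 4 → ℝ) → ℂ} {c : Fin 4 → ℂ} {x : Fin 4 → ℝ}
    (h : HasFDerivAt f (∑ ν, c ν • coordC ν) x) (μ : Fin 4) : pd μ f x = c μ := by
  rw [pd, h.fderiv, sum_smul_coordC_single]

theorem contDiff_integral_phase_sub_one {a : (Fin 4 → ℝ) → ℂ} (ham : AEStronglyMeasurable a m)
    (ha : ∀ μ, Integrable (fun k => (k μ : ℂ) * a k) m) :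
    ContDiff ℝ 1 (fun x => ∫ k, a k * (phase k x - 1) ∂m) := by
  rw [contDiff_one_iff_fderiv]
  refine ⟨fun x => (hasFDerivAt_integral_phase_sub_one ham ha x).differentiableAt, ?_⟩
  have : fderiv ℝ (fun x => ∫ k, a k * (phase k x - 1) ∂m) = fun x =>
      ∑ μ, (∫ k, (2 * Real.pi * Complex.I * (lower k μ * a k)) * phase k x ∂m) • coordC μ :=
    funext fun x => (hasFDerivAt_integral_phase_sub_one ham ha x).fderiv
  rw [this]
  exact continuous_finsetSum _ fun μ _ => (continuous_integral_mul_phase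
    ((integrable_lower_mul (ha μ)).const_mul _)).smul continuous_const

theorem pd_integral_phase {a : (Fin 4 → ℝ) → ℂ} (ha0 : Integrable a m)
    (ha : ∀ μ, Integrable (fun k => (k μ : ℂ) * a k) m) (μ : Fin 4) (x : Fin 4 → ℝ) :
    pd μ (fun x => ∫ k, a k * phase k x ∂m) x =
      ∫ k, (2 * Real.pi * Complex.I * (lower k μ * a k)) * phase k x ∂m := by
  have h := (hasFDerivAt_integral_phase_sub_one ha0.aestronglyMeasurable ha x).add_const
    (∫ k, a k ∂m)
  have he : (fun x => (∫ k, a k * (phase k x - 1) ∂m) + ∫ k, a k ∂m) =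
      fun x => ∫ k, a k * phase k x ∂m := by
    funext y
    simp only [mul_sub, mul_one]
    rw [integral_sub (integrable_mul_phase ha0 y) ha0, sub_add_cancel]
  rw [he] at h
  exact pd_of_hasFDerivAt h μ

/-! ### Uniqueness of plane wave superpositions -/

/-- By nondegeneracy of `η`, the plane waves run through all characters of `ℝ⁴`, so results on
characteristic functions apply to `phase`. -/
theorem exists_mdot_eq (L : StrongDual ℝ (Fin 4 → ℝ)) :
    ∃ x, ∀ k, 2 * Real.pi * mdot k x = L k := by
  refine ⟨fun μ => eta μ μ * L (Pi.single μ 1) / (2 * Real.pi), fun k => ?_⟩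
  have hL : L k = ∑ μ, k μ * L (Pi.single μ 1) := by
    conv_lhs => rw [pi_eq_sum_univ' k]
    simp [map_sum]
  have hpi := Real.pi_ne_zero
  rw [hL, mdot, dotProduct, Finset.mul_sum]
  refine Finset.sum_congr rfl fun μ _ => ?_
  rw [lower_apply]
  have := eta_apply_self_mul_self μ
  field_simp
  linear_combination k μ * L (Pi.single μ 1) * this

/-- The positive and negative parts of `g` are densities of two finite measures with the same
characteristic function, hence of the same measure. Integrability of `g` is enough to compare the
densities; `m` need not be σ-finite. -/
theorem ae_eq_zero_of_integral_phase_real {g : (Fin 4 → ℝ) → ℝ} (hg : Integrable g m)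
    (h : ∀ x, ∫ k, (g k : ℂ) * phase k x ∂m = 0) : g =ᵐ[m] 0 := by
  have hm1 : AEMeasurable (fun k => ENNReal.ofReal (g k)) m := hg.aemeasurable.ennreal_ofReal
  have hm2 : AEMeasurable (fun k => ENNReal.ofReal (-g k)) m := hg.aemeasurable.neg.ennreal_ofReal
  have := isFiniteMeasure_withDensity_ofReal hg.2
  have := isFiniteMeasure_withDensity_ofReal hg.neg.2
  have heq : m.withDensity (fun k => ENNReal.ofReal (g k)) =
      m.withDensity (fun k => ENNReal.ofReal (-g k)) := by
    refine Measure.ext_of_charFunDual ?_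
    funext L
    obtain ⟨x, hx⟩ := exists_mdot_eq L
    have hph : ∀ k, Complex.exp (L k * Complex.I) = phase k x := fun k => by
      rw [phase, ← hx]; congr 1; push_cast; ring
    rw [charFunDual_apply, charFunDual_apply,
      integral_withDensity_eq_integral_toReal_smul₀ hm1 (Eventually.of_forall fun _ => by simp),
      integral_withDensity_eq_integral_toReal_smul₀ hm2 (Eventually.of_forall fun _ => by simp)]
    have i1 : Integrable (fun k => (ENNReal.ofReal (g k)).toReal • Complex.exp (L k * Complex.I)) m := by
      have := integrable_mul_phase (hg.pos_part.ofReal (𝕜 := ℂ)) x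
      refine this.congr (Eventually.of_forall fun k => ?_)
      simp only [hph, ENNReal.toReal_ofReal', Complex.real_smul]; rfl
    have i2 : Integrable (fun k => (ENNReal.ofReal (-g k)).toReal • Complex.exp (L k * Complex.I)) m := by
      have := integrable_mul_phase (hg.neg.pos_part.ofReal (𝕜 := ℂ)) x
      refine this.congr (Eventually.of_forall fun k => ?_)
      simp only [hph, ENNReal.toReal_ofReal', Complex.real_smul]; rfl
    rw [← sub_eq_zero, ← integral_sub i1 i2, ← h x]
    refine integral_congr_ae (Eventually.of_forall fun k => ?_)
    simp only [hph, ENNReal.toReal_ofReal', Complex.real_smul, ← sub_mul]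
    rw [← Complex.ofReal_sub]
    congr 2
    rcases le_total (g k) 0 with h0 | h0
    · rw [max_eq_right h0, max_eq_left (by linarith)]; ring
    · rw [max_eq_left h0, max_eq_right (by linarith)]; ring
  have hne : ∫⁻ k, ENNReal.ofReal (g k) ∂m ≠ ⊤ := hg.lintegral_lt_top.ne
  filter_upwards [(withDensity_eq_iff hm1 hm2 hne).mp heq] with k hk
  rcases le_total (g k) 0 with h0 | h0
  · rw [ENNReal.ofReal_of_nonpos h0] at hk
    have := ENNReal.ofReal_eq_zero.mp hk.symm
    exact le_antisymm h0 (neg_nonpos.mp this)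
  · rw [ENNReal.ofReal_of_nonpos (by linarith : -g k ≤ 0)] at hk
    exact le_antisymm (ENNReal.ofReal_eq_zero.mp hk) h0

theorem conj_phase (k x : Fin 4 → ℝ) : (starRingEnd ℂ) (phase k x) = phase k (-x) := by
  rw [phase, phase, ← Complex.exp_conj]
  congr 1
  have h2 : (starRingEnd ℂ) 2 = 2 := Complex.conj_ofNat 2
  have : mdot k (-x) = -mdot k x := by simp [mdot]
  rw [this]
  simp [h2]

/-- An integrable amplitude is determined almost everywhere by its superposition of plane waves. -/
theorem ae_eq_zero_of_integral_phase {G : (Fin 4 → ℝ) → ℂ} (hG : Integrable G m)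
    (h : ∀ x, ∫ k, G k * phase k x ∂m = 0) : G =ᵐ[m] 0 := by
  have hc : Integrable (fun k => (starRingEnd ℂ) (G k)) m :=
    hG.congr' (Complex.continuous_conj.comp_aestronglyMeasurable hG.1)
      (Eventually.of_forall fun k => by simp)
  -- Conjugation sends the phase at `x` to the phase at `-x`, so the conjugate amplitude also
  -- superposes to zero; the real and imaginary parts can then be treated separately.
  have hconj : ∀ x, ∫ k, (starRingEnd ℂ) (G k) * phase k x ∂m = 0 := by
    intro x
    have : ∀ k, (starRingEnd ℂ) (G k) * phase k x = (starRingEnd ℂ) (G k * phase k (-x)) := by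
      intro k; rw [map_mul, conj_phase, neg_neg]
    simp only [this]
    rw [integral_conj, h, map_zero]
  have hre : (fun k => (G k).re) =ᵐ[m] 0 := by
    refine ae_eq_zero_of_integral_phase_real hG.re fun x => ?_
    have : ∀ k, ((G k).re : ℂ) * phase k x =
        (1 / 2) * (G k * phase k x + (starRingEnd ℂ) (G k) * phase k x) := fun k => by
      rw [Complex.re_eq_add_conj]; ring
    simp only [this]
    rw [integral_const_mul, integral_add (integrable_mul_phase hG x) (integrable_mul_phase hc x), h,
      hconj]
    simp
  have him : (fun k => (G k).im) =ᵐ[m] 0 := by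
    refine ae_eq_zero_of_integral_phase_real hG.im fun x => ?_
    have : ∀ k, ((G k).im : ℂ) * phase k x =
        (1 / (2 * Complex.I)) * (G k * phase k x - (starRingEnd ℂ) (G k) * phase k x) := fun k => by
      rw [Complex.im_eq_sub_conj]; ring
    simp only [this]
    rw [integral_const_mul, integral_sub (integrable_mul_phase hG x) (integrable_mul_phase hc x), h,
      hconj]
    simp
  filter_upwards [hre, him] with k h1 h2
  exact Complex.ext h1 h2

/-! ### Vacuum solutions -/

section Vacuum

variable {m : Measure (Fin 4 → ℝ)} {A : (Fin 4 → ℝ) → Matrix (Fin 4) (Fin 4) ℂ}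

theorem sq_le_dotProduct_self {n : ℕ} (k : Fin n → ℝ) (i : Fin n) : k i ^ 2 ≤ k ⬝ᵥ k := by
  rw [sq]
  exact Finset.single_le_sum (f := fun i => k i * k i) (fun i _ => mul_self_nonneg _)
    (Finset.mem_univ i)

theorem dotProduct_self_nonneg {n : ℕ} (k : Fin n → ℝ) : 0 ≤ k ⬝ᵥ k :=
  Finset.sum_nonneg fun _ _ => mul_self_nonneg _

theorem integral_add_sub_sub {α : Type*} [MeasurableSpace α] {m : Measure α} {f g h l : α → ℂ}
    (hf : Integrable f m) (hg : Integrable g m) (hh : Integrable h m) (hl : Integrable l m) :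
    ∫ s, (f s + g s - h s - l s) ∂m = ∫ s, f s ∂m + ∫ s, g s ∂m - ∫ s, h s ∂m - ∫ s, l s ∂m := by
  have h1 : Integrable (fun s => f s + g s) m := hf.add hg
  have h2 : Integrable (fun s => f s + g s - h s) m := h1.sub hh
  rw [integral_sub h2 hl, integral_sub h1 hh, integral_add hf hg]

theorem abs_mul_apply_le (k : Fin 4 → ℝ) (μ ν : Fin 4) : |k μ * k ν| ≤ k ⬝ᵥ k := by
  have h1 := sq_le_dotProduct_self k μ
  have h2 := sq_le_dotProduct_self k ν
  rw [abs_le]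
  constructor <;> nlinarith [sq_nonneg (k μ + k ν), sq_nonneg (k μ - k ν)]

theorem measurable_dotProduct_self : Measurable fun k : Fin 4 → ℝ => k ⬝ᵥ k := by
  simp only [dotProduct]; fun_prop

/-- Intermediate moments of an amplitude with finite second moment. -/
theorem integrable_moment {a : (Fin 4 → ℝ) → ℂ} (h0 : Integrable a m)
    (h2 : Integrable (fun k => ((k ⬝ᵥ k : ℝ) : ℂ) * a k) m) {f : (Fin 4 → ℝ) → ℝ}
    (hf : Measurable f) (hb : ∀ k, |f k| ≤ 1 + k ⬝ᵥ k) :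
    Integrable (fun k => (f k : ℂ) * a k) m := by
  have h := (h0.add h2).bdd_mul (f := fun k => ((f k / (1 + k ⬝ᵥ k) : ℝ) : ℂ)) (c := 1)
    (Complex.measurable_ofReal.comp
      (hf.div (measurable_const.add measurable_dotProduct_self))).aestronglyMeasurable
    (Eventually.of_forall fun k => by
      have hN := dotProduct_self_nonneg k
      rw [Complex.norm_real, Real.norm_eq_abs, abs_div, abs_of_pos (by linarith : 0 < 1 + k ⬝ᵥ k)]
      exact div_le_one_of_le₀ (hb k) (by linarith))
  refine h.congr (Eventually.of_forall fun k => ?_)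
  have hN := dotProduct_self_nonneg k
  have hN1 : ((1 + k ⬝ᵥ k : ℝ) : ℂ) ≠ 0 := by
    exact_mod_cast (by linarith : (0 : ℝ) < 1 + k ⬝ᵥ k).ne'
  simp only [Pi.add_apply]
  push_cast at hN1 ⊢
  field_simp

theorem integrable_apply_mul {a : (Fin 4 → ℝ) → ℂ} (h0 : Integrable a m)
    (h2 : Integrable (fun k => ((k ⬝ᵥ k : ℝ) : ℂ) * a k) m) (μ : Fin 4) :
    Integrable (fun k => (k μ : ℂ) * a k) m := by
  refine integrable_moment h0 h2 (measurable_pi_apply μ) fun k => ?_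
  have h1 := sq_le_dotProduct_self k μ
  rw [abs_le]
  constructor <;> nlinarith [sq_nonneg (k μ - 1), sq_nonneg (k μ + 1)]

theorem integrable_apply_mul_apply_mul {a : (Fin 4 → ℝ) → ℂ} (h0 : Integrable a m)
    (h2 : Integrable (fun k => ((k ⬝ᵥ k : ℝ) : ℂ) * a k) m) (μ ν : Fin 4) :
    Integrable (fun k => (k μ : ℂ) * ((k ν : ℂ) * a k)) m := by
  refine (integrable_moment h0 h2 (f := fun k => k μ * k ν) (by fun_prop) fun k => ?_).congr
    (Eventually.of_forall fun k => by push_cast; ring)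
  linarith [abs_mul_apply_le k μ ν]

theorem integrable_lower_mul_lower_mul {a : (Fin 4 → ℝ) → ℂ} (h0 : Integrable a m)
    (h2 : Integrable (fun k => ((k ⬝ᵥ k : ℝ) : ℂ) * a k) m) (μ ν : Fin 4) :
    Integrable (fun k => (lower k μ : ℂ) * ((lower k ν : ℂ) * a k)) m := by
  refine (((integrable_apply_mul_apply_mul h0 h2 μ ν).const_mul (eta μ μ : ℂ)).const_mul
    (eta ν ν : ℂ)).congr (Eventually.of_forall fun k => ?_)
  simp only [lower_apply]; push_cast; ring

theorem pd_pd_integral_phase {a : (Fin 4 → ℝ) → ℂ} (h0 : Integrable a m)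
    (h2 : Integrable (fun k => ((k ⬝ᵥ k : ℝ) : ℂ) * a k) m) (μ ν : Fin 4) (x : Fin 4 → ℝ) :
    pd μ (pd ν fun x => ∫ k, a k * phase k x ∂m) x =
      -(4 * (Real.pi : ℂ) ^ 2) * ∫ k, (lower k μ * (lower k ν * a k)) * phase k x ∂m := by
  have h1 := integrable_apply_mul h0 h2
  have e1 : pd ν (fun x => ∫ k, a k * phase k x ∂m) = fun x =>
      ∫ k, (2 * Real.pi * Complex.I * (lower k ν * a k)) * phase k x ∂m :=
    funext fun y => pd_integral_phase h0 h1 ν y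
  rw [e1, pd_integral_phase ((integrable_lower_mul (h1 ν)).const_mul _) (fun β => ?_) μ x,
    ← integral_const_mul]
  · refine integral_congr_ae (Eventually.of_forall fun k => ?_)
    simp only
    linear_combination (4 * (Real.pi : ℂ) ^ 2 * lower k μ * lower k ν * a k * phase k x) *
      Complex.I_sq
  · refine ((integrable_apply_mul_apply_mul h0 h2 β ν).const_mul
      (2 * Real.pi * Complex.I * (eta ν ν : ℂ))).congr (Eventually.of_forall fun k => ?_)
    simp only [lower_apply]; push_cast; ring

/-- The mode tensor in the shape of `linRicci`, so that derivatives and amplitudes can be matched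
summand by summand. -/
theorem linRicciMode_eq_sum (k : Fin 4 → ℝ) (H : Matrix (Fin 4) (Fin 4) ℂ) (μ ν : Fin 4) :
    linRicciMode k H μ ν = ∑ α, -(2 * (Real.pi : ℂ) ^ 2) * (eta α α : ℂ) *
      (lower k α * (lower k μ * H α ν) + lower k α * (lower k ν * H α μ) -
        lower k α * (lower k α * H μ ν) - lower k μ * (lower k ν * H α α)) := by
  have h1 : ∀ ν, contract k H ν = ∑ α, (eta α α : ℂ) * (lower k α * H α ν) := fun ν => by
    rw [contract]
    refine Finset.sum_congr rfl fun α _ => ?_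
    rw [← eta_mul_lower k α]; push_cast; ring
  rw [linRicciMode, h1, h1, ← sum_eta_mul_lower_mul_lowerC, etaTrace]
  simp only [Fin.sum_univ_four]
  ring

/-- The linearized Ricci tensor of a superposition of plane waves. -/
theorem linRicci_superposition {h : (Fin 4 → ℝ) → Matrix (Fin 4) (Fin 4) ℂ}
    (h0 : ∀ μ ν, Integrable (fun k => A k μ ν) m)
    (h2 : ∀ μ ν, Integrable (fun k => ((k ⬝ᵥ k : ℝ) : ℂ) * A k μ ν) m)
    (hrep : ∀ x μ ν, h x μ ν = ∫ k, A k μ ν * phase k x ∂m) (x : Fin 4 → ℝ) (μ ν : Fin 4) :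
    Integrable (fun k => linRicciMode k (A k) μ ν) m ∧
    linRicci h x μ ν = ∫ k, linRicciMode k (A k) μ ν * phase k x ∂m := by
  have hi : ∀ β γ α δ, Integrable (fun k => (lower k β : ℂ) * (lower k γ * A k α δ)) m :=
    fun β γ α δ => integrable_lower_mul_lower_mul (h0 α δ) (h2 α δ) β γ
  have hpd : ∀ β γ α δ, pd β (pd γ fun y => h y α δ) x =
      -(4 * (Real.pi : ℂ) ^ 2) * ∫ k, (lower k β * (lower k γ * A k α δ)) * phase k x ∂m := by
    intro β γ α δ
    simp only [hrep]
    exact pd_pd_integral_phase (h0 α δ) (h2 α δ) β γ x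
  have hp : ∀ β γ α δ, Integrable (fun k => (lower k β : ℂ) * (lower k γ * A k α δ) *
      phase k x) m := fun β γ α δ => integrable_mul_phase (hi β γ α δ) x
  have hterm : ∀ α, Integrable (fun k => -(2 * (Real.pi : ℂ) ^ 2) * (eta α α : ℂ) *
      (lower k α * (lower k μ * A k α ν) + lower k α * (lower k ν * A k α μ) -
        lower k α * (lower k α * A k μ ν) - lower k μ * (lower k ν * A k α α))) m := fun α =>
    ((((hi α μ α ν).add (hi α ν α μ)).sub (hi α α μ ν)).sub (hi μ ν α α)).const_mul _
  refine ⟨?_, ?_⟩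
  · simp only [linRicciMode_eq_sum]
    exact integrable_finsetSum _ fun α _ => hterm α
  · simp only [linRicciMode_eq_sum, Finset.sum_mul]
    rw [integral_finsetSum _ fun α _ => integrable_mul_phase (hterm α) x, linRicci, Finset.mul_sum]
    refine Finset.sum_congr rfl fun α _ => ?_
    rw [hpd, hpd, hpd, hpd]
    have e : ∀ k, -(2 * (Real.pi : ℂ) ^ 2) * (eta α α : ℂ) *
        (lower k α * (lower k μ * A k α ν) + lower k α * (lower k ν * A k α μ) -
        lower k α * (lower k α * A k μ ν) - lower k μ * (lower k ν * A k α α)) * phase k x =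
        -(2 * (Real.pi : ℂ) ^ 2) * (eta α α : ℂ) *
        ((lower k α * (lower k μ * A k α ν) * phase k x +
          lower k α * (lower k ν * A k α μ) * phase k x -
          lower k α * (lower k α * A k μ ν) * phase k x) -
          lower k μ * (lower k ν * A k α α) * phase k x) := fun k => by ring
    simp only [e]
    rw [integral_const_mul,
      integral_add_sub_sub (hp α μ α ν) (hp α ν α μ) (hp α α μ ν) (hp μ ν α α)]
    ring

theorem linRicci_eq_zero {h : (Fin 4 → ℝ) → Matrix (Fin 4) (Fin 4) ℂ} {x : Fin 4 → ℝ}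
    (hE : linEinstein h x = 0) : linRicci h x = 0 := by
  have h1 : linRicci h x = ((1 / 2 : ℂ) * etaTrace (linRicci h x)) • toC eta := sub_eq_zero.mp hE
  have h2 := congrArg etaTrace h1
  rw [etaTrace_smul, etaTrace_toC_eta] at h2
  have ht : etaTrace (linRicci h x) = 0 := by linear_combination -h2
  rw [ht] at h1
  simpa using h1

/-- The gauge vector of an integrable amplitude, multiplied by `k`, is integrable. -/
theorem integrable_mul_lower_mul_gaugeVec {f : (Fin 4 → ℝ) → ℂ}
    (hf : ∀ μ ν, Integrable (fun k => f k * A k μ ν) m) (μ ν : Fin 4) :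
    Integrable (fun k => f k * (lower k μ * gaugeVec k (A k) ν)) m := by
  -- After multiplication by `k_μ`, the gauge covector involves `k` only through the ratios `k_α k_β
  -- / |k|²`, which are bounded by 1 (and equal 0 at `k = 0`).
  have hb : ∀ α β (k : Fin 4 → ℝ), |lower k α * lower k β / (k ⬝ᵥ k)| ≤ 1 := by
    intro α β k
    rw [abs_div, abs_of_nonneg (dotProduct_self_nonneg k), abs_mul, abs_lower, abs_lower,
      ← abs_mul]
    exact div_le_one_of_le₀ (abs_mul_apply_le k α β) (dotProduct_self_nonneg k)
  have hm : ∀ α β, Measurable fun k : Fin 4 → ℝ => lower k α * lower k β / (k ⬝ᵥ k) :=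
    fun α β => ((measurable_lower α).mul (measurable_lower β)).div measurable_dotProduct_self
  have hmul : ∀ {a : (Fin 4 → ℝ) → ℂ}, Integrable a m → ∀ α β,
      Integrable (fun k => ((lower k α * lower k β / (k ⬝ᵥ k) : ℝ) : ℂ) * a k) m :=
    fun ha α β => ha.bdd_mul (c := 1)
      (Complex.measurable_ofReal.comp (hm α β)).aestronglyMeasurable
      (Eventually.of_forall fun k => by rw [Complex.norm_real]; exact hb α β k)
  have h1 : Integrable (fun k => ∑ α, ((lower k α * lower k μ / (k ⬝ᵥ k) : ℝ) : ℂ) *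
      (f k * A k α ν)) m := integrable_finsetSum _ fun α _ => hmul (hf α ν) α μ
  have h2 : Integrable (fun k => ∑ α, ∑ β, ((lower k ν * lower k μ / (k ⬝ᵥ k) : ℝ) : ℂ) *
      (((lower k α * lower k β / (k ⬝ᵥ k) : ℝ) : ℂ) * (f k * A k α β))) m :=
    integrable_finsetSum _ fun α _ => integrable_finsetSum _ fun β _ =>
      hmul (hmul (hf α β) α β) ν μ
  refine (h1.sub (h2.const_mul (1 / 2))).congr (Eventually.of_forall fun k => ?_)
  simp only [Pi.sub_apply, gaugeVec, mul_sub, Finset.mul_sum]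
  congr 1
  · refine Finset.sum_congr rfl fun α _ => ?_
    push_cast; ring
  · refine Finset.sum_congr rfl fun α _ => Finset.sum_congr rfl fun β _ => ?_
    push_cast; ring

theorem measurable_gaugeVec (hA : ∀ μ ν, Measurable fun k => A k μ ν) (ν : Fin 4) :
    Measurable fun k => gaugeVec k (A k) ν := by
  have h1 := measurable_dotProduct_self
  have h2 := fun μ => measurable_lower μ
  unfold gaugeVec
  fun_prop

theorem measurable_gaugeFixed (hA : ∀ μ ν, Measurable fun k => A k μ ν) (μ ν : Fin 4) :
    Measurable fun k => gaugeFixed k (A k) μ ν := by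
  have h1 := measurable_gaugeVec hA
  have h2 := fun μ => measurable_lower μ
  simp only [gaugeFixed, gaugeMode, Matrix.sub_apply]
  fun_prop

theorem integrable_mul_gaugeMode {f : (Fin 4 → ℝ) → ℂ}
    (hf : ∀ μ ν, Integrable (fun k => f k * A k μ ν) m) (μ ν : Fin 4) :
    Integrable (fun k => f k * gaugeMode k (gaugeVec k (A k)) μ ν) m := by
  refine ((integrable_mul_lower_mul_gaugeVec hf μ ν).add
    (integrable_mul_lower_mul_gaugeVec hf ν μ)).congr (Eventually.of_forall fun k => ?_)
  simp only [Pi.add_apply, gaugeMode]; ring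

theorem integrable_mul_gaugeFixed {f : (Fin 4 → ℝ) → ℂ}
    (hf : ∀ μ ν, Integrable (fun k => f k * A k μ ν) m) (μ ν : Fin 4) :
    Integrable (fun k => f k * gaugeFixed k (A k) μ ν) m := by
  refine ((hf μ ν).sub (integrable_mul_gaugeMode hf μ ν)).congr (Eventually.of_forall fun k => ?_)
  simp only [Pi.sub_apply, gaugeFixed, Matrix.sub_apply]; ring

theorem phase_zero_left (x : Fin 4 → ℝ) : phase 0 x = 1 := by
  simp [phase, mdot_eq]

/-- Vacuum superpositions with measurable amplitudes, split into a vacuum distribution and a gauge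
term. -/
theorem exists_distribution_of_superposition {h : (Fin 4 → ℝ) → Matrix (Fin 4) (Fin 4) ℂ}
    (hA : ∀ μ ν, Measurable fun k => A k μ ν) (hs : ∀ᵐ k ∂m, (A k).IsSymm)
    (h0 : ∀ μ ν, Integrable (fun k => A k μ ν) m)
    (h2 : ∀ μ ν, Integrable (fun k => ((k ⬝ᵥ k : ℝ) : ℂ) * A k μ ν) m)
    (hrep : ∀ x μ ν, h x μ ν = ∫ k, A k μ ν * phase k x ∂m)
    (hR : ∀ᵐ k ∂m, linRicciMode k (A k) = 0) :
    ∃ ρ : DefectDistribution, (∀ᵐ s ∂ρ.measure, mdot s.1.wave s.1.wave = 0) ∧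
      ρ.HasMetric ∧ (∀ x, ρ.fieldT x = 0) ∧
      ∃ ξ : Fin 4 → (Fin 4 → ℝ) → ℂ, (∀ μ, ContDiff ℝ 1 (ξ μ)) ∧
        ∀ x μ ν, h x μ ν = ρ.fieldH x μ ν + pd μ (ξ ν) x + pd ν (ξ μ) x := by
  set C : Set (Fin 4 → ℝ) := {k | mdot k k = 0 ∧ k ≠ 0} with hC
  have hCm : MeasurableSet C := measurableSet_cone
  set B : (Fin 4 → ℝ) → Matrix (Fin 4) (Fin 4) ℂ := fun k => gaugeFixed k (A k) with hB
  have hBm : ∀ μ ν, Measurable fun k => B k μ ν := measurable_gaugeFixed hA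
  have h0' : ∀ μ ν, Integrable (fun k => (fun _ => (1 : ℂ)) k * A k μ ν) m := by simpa using h0
  have hBi : ∀ μ ν, Integrable (fun k => B k μ ν) m := fun μ ν => by
    simpa using integrable_mul_gaugeFixed h0' μ ν
  have hk2 : ∀ μ ν, Integrable (fun k => (k 0 : ℂ) ^ 2 * A k μ ν) m := fun μ ν =>
    (integrable_apply_mul_apply_mul (h0 μ ν) (h2 μ ν) 0 0).congr
      (Eventually.of_forall fun k => by ring)
  have hBi2 : ∀ μ ν, Integrable (fun k => (k 0 : ℂ) ^ 2 * B k μ ν) m :=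
    integrable_mul_gaugeFixed hk2
  have hTT : ∀ᵐ k ∂m.restrict C, B k ∈ transverseTraceless k := by
    rw [ae_restrict_iff' hCm]
    filter_upwards [hs, hR] with k hks hkR hkC
    exact gaugeFixed_mem_transverseTraceless hkC.1 hkC.2 hks hkR
  have hmC : ∀ᵐ k ∂m.restrict C, mdot k k = 0 ∧ k ≠ 0 := ae_restrict_mem hCm
  obtain ⟨ρ, hρ1, hρ2, hρ3⟩ := exists_defectDistribution hBm hmC hTT
    (fun μ ν => (hBi μ ν).restrict) (fun μ ν => (hBi2 μ ν).restrict)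
  -- Off the cone non-null modes have gauge-fixed part zero, so only a possible atom at `k = 0` is
  -- left. There `gaugeVec` is zero and the amplitude survives as a constant field.
  set c : Fin 4 → Fin 4 → ℂ := fun μ ν => ∫ k in Cᶜ, B k μ ν ∂m with hc
  have hcs : ∀ μ ν, c μ ν = c ν μ := by
    intro μ ν
    refine integral_congr_ae (ae_restrict_of_ae ?_)
    filter_upwards [hs] with k hk
    exact (hk.sub (gaugeMode_isSymm k _)).apply ν μ
  set a : Fin 4 → (Fin 4 → ℝ) → ℂ := fun ν k =>
    (2 * Real.pi * Complex.I)⁻¹ * gaugeVec k (A k) ν with ha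
  have ham : ∀ ν, Measurable (a ν) := fun ν => (measurable_gaugeVec hA ν).const_mul _
  have hla : ∀ μ ν, Integrable (fun k => (lower k μ : ℂ) * gaugeVec k (A k) ν) m := fun μ ν => by
    simpa using integrable_mul_lower_mul_gaugeVec h0' μ ν
  have hka : ∀ ν μ, Integrable (fun k => (k μ : ℂ) * a ν k) m := fun ν μ => by
    refine ((hla μ ν).const_mul ((eta μ μ : ℂ) * (2 * Real.pi * Complex.I)⁻¹)).congr
      (Eventually.of_forall fun k => ?_)
    have : (k μ : ℂ) = (eta μ μ : ℂ) * (lower k μ : ℂ) := by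
      rw [← eta_mul_lower k μ]; push_cast; rfl
    simp only [ha, this]; ring
  -- The integral with `phase - 1` differentiates to the gauge part of the amplitude, the factor
  -- `2πi` being cancelled in `a`. The linear term, with symmetric coefficients `c/2`, accounts for
  -- the constant field.
  set ξ : Fin 4 → (Fin 4 → ℝ) → ℂ := fun ν x => (∫ k, a ν k * (phase k x - 1) ∂m) +
    (∑ μ, (c μ ν / 2) • coordC μ) x with hξ
  have hpd : ∀ μ ν x, pd μ (ξ ν) x =
      (∫ k, (lower k μ * gaugeVec k (A k) ν) * phase k x ∂m) + c μ ν / 2 := by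
    intro μ ν x
    have hd := (hasFDerivAt_integral_phase_sub_one (ham ν).aestronglyMeasurable (hka ν) x).add
      (∑ μ, (c μ ν / 2) • coordC μ : (Fin 4 → ℝ) →L[ℝ] ℂ).hasFDerivAt
    have hd' := hd.fderiv
    have : pd μ (ξ ν) x = (fderiv ℝ (ξ ν) x) (Pi.single μ 1) := rfl
    rw [this]
    refine (congrArg (fun L : (Fin 4 → ℝ) →L[ℝ] ℂ => L (Pi.single μ 1)) hd').trans ?_
    simp only [_root_.add_apply]
    rw [sum_smul_coordC_single, sum_smul_coordC_single]
    congr 1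
    refine integral_congr_ae (Eventually.of_forall fun k => ?_)
    have h2pi : (2 * Real.pi * Complex.I : ℂ) ≠ 0 := Complex.two_pi_I_ne_zero
    simp only [ha]
    field_simp
  refine ⟨ρ, ?_, hρ2, fun x => ?_, ξ, fun ν => ?_, fun x μ ν => ?_⟩
  · exact hρ1 (fun k => mdot k k = 0) (measurable_mdot_self (measurableSet_singleton 0))
      (hmC.mono fun k hk => hk.1)
  · ext μ ν
    exact (hρ3 (fun k => phase k x) (measurable_phase x) (fun k => (norm_phase k x).le) μ ν).1
  · exact (contDiff_integral_phase_sub_one (ham ν).aestronglyMeasurable (hka ν)).add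
      (ContinuousLinearMap.contDiff _)
  · have hH : ρ.fieldH x μ ν = ∫ k in C, B k μ ν * phase k x ∂m := by
      refine (hρ3 (fun k => phase k x) (measurable_phase x)
        (fun k => (norm_phase k x).le) μ ν).2.trans ?_
      simp only [mul_comm]
    have hCc : ∫ k in Cᶜ, B k μ ν * phase k x ∂m = c μ ν := by
      refine integral_congr_ae ?_
      rw [EventuallyEq, ae_restrict_iff' hCm.compl]
      filter_upwards [hR] with k hk hkC
      by_cases hk0 : k = 0
      · rw [hk0, phase_zero_left, mul_one]
      · have hkk : mdot k k ≠ 0 := fun h => hkC ⟨h, hk0⟩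
        have : B k = 0 := gaugeFixed_of_nonNull hkk hk
        rw [this]; simp
    have hsplit := integral_add_compl hCm (integrable_mul_phase (hBi μ ν) x)
    have hAB : ∀ k, A k μ ν * phase k x = 1 * (B k μ ν * phase k x) +
        1 * ((lower k μ * gaugeVec k (A k) ν) * phase k x) +
          1 * ((lower k ν * gaugeVec k (A k) μ) * phase k x) := fun k => by
      simp only [hB, gaugeFixed, gaugeMode, Matrix.sub_apply]; ring
    have i1 := integrable_mul_phase (hla μ ν) x
    have i2 := integrable_mul_phase (hla ν μ) x
    rw [hrep, hpd, hpd, hH]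
    simp only [hAB]
    rw [integral_linearCombination_three (integrable_mul_phase (hBi μ ν) x) i1 i2, ← hsplit, hCc, hcs ν μ]
    ring

/-- Every vacuum superposition of plane waves is, up to gauge, the field of a vacuum
distribution of lightlike waves. -/
theorem exists_distribution_of_vacuum {h : (Fin 4 → ℝ) → Matrix (Fin 4) (Fin 4) ℂ}
    (hh : IsPlaneWaveSuperposition h) (hE : ∀ x, linEinstein h x = 0) :
    ∃ ρ : DefectDistribution, (∀ᵐ s ∂ρ.measure, mdot s.1.wave s.1.wave = 0) ∧
      ρ.HasMetric ∧ (∀ x, ρ.fieldT x = 0) ∧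
      ∃ ξ : Fin 4 → (Fin 4 → ℝ) → ℂ, (∀ μ, ContDiff ℝ 1 (ξ μ)) ∧
        ∀ x μ ν, h x μ ν = ρ.fieldH x μ ν + pd μ (ξ ν) x + pd ν (ξ μ) x := by
  obtain ⟨m, A, hs, h0, h2, hrep⟩ := hh
  have hR : ∀ᵐ k ∂m, linRicciMode k (A k) = 0 := by
    have : ∀ μ ν, ∀ᵐ k ∂m, linRicciMode k (A k) μ ν = 0 := by
      intro μ ν
      refine ae_eq_zero_of_integral_phase (linRicci_superposition h0 h2 hrep 0 μ ν).1 fun x => ?_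
      rw [← (linRicci_superposition h0 h2 hrep x μ ν).2, linRicci_eq_zero (hE x)]
      rfl
    filter_upwards [ae_all_iff.mpr fun μ => ae_all_iff.mpr (this μ)] with k hk
    ext μ ν
    exact hk μ ν
  -- The amplitude is only almost everywhere measurable, whereas the density of `ρ` evaluates it
  -- along wave vectors. It is replaced by a measurable version, which is symmetric and solves the
  -- mode equation almost everywhere.
  set A' : (Fin 4 → ℝ) → Matrix (Fin 4) (Fin 4) ℂ := fun k => Matrix.of fun μ ν =>
    (h0 μ ν).1.mk _ k with hA'
  have hAA : ∀ᵐ k ∂m, A k = A' k := by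
    filter_upwards [ae_all_iff.mpr fun μ => ae_all_iff.mpr fun ν => (h0 μ ν).1.ae_eq_mk] with k hk
    ext μ ν
    exact hk μ ν
  have hcongr : ∀ μ ν, ∀ᵐ k ∂m, A k μ ν = A' k μ ν := fun μ ν => hAA.mono fun k hk => by rw [hk]
  refine exists_distribution_of_superposition (A := A') (m := m)
    (fun μ ν => (h0 μ ν).1.stronglyMeasurable_mk.measurable) ?_
    (fun μ ν => (h0 μ ν).congr (hcongr μ ν)) (fun μ ν => (h2 μ ν).congr ?_) (fun x μ ν => ?_) ?_
  · filter_upwards [hAA] with k hk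
    rw [← hk]; exact hs k
  · filter_upwards [hcongr μ ν] with k hk
    rw [hk]
  · rw [hrep]
    refine integral_congr_ae ?_
    filter_upwards [hcongr μ ν] with k hk
    rw [hk]
  · filter_upwards [hAA, hR] with k hk hkR
    rw [← hk]; exact hkR

end Vacuum

end LineDefects

end

theorem mainTheorem6 :
    -- the metric perturbation of a defect distribution solves the linearized Einstein equation
    (∀ (k : Fin 4 → ℝ) (ρ : LineDefects.DefectDistribution), ρ.IsMode k →
      ρ.modeH.IsSymm ∧ LineDefects.contract k ρ.modeH = 0 ∧
        LineDefects.linEinsteinMode k ρ.modeH = ρ.modeT) ∧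
    -- non-null modes: the energy-momentum determines the metric perturbation
    (∀ (k : Fin 4 → ℝ), LineDefects.mdot k k ≠ 0 →
      ∀ ρ : LineDefects.DefectDistribution, ρ.IsMode k →
        (∀ H : Matrix (Fin 4) (Fin 4) ℂ, H.IsSymm → LineDefects.contract k H = 0 →
          LineDefects.linEinsteinMode k H = ρ.modeT → H = ρ.modeH) ∧
        (∀ ρ' : LineDefects.DefectDistribution, ρ'.IsMode k →
          ρ'.modeT = ρ.modeT → ρ'.modeH = ρ.modeH)) ∧
    -- lightlike laminar waves: the defining limit exists, and any other limit of spacelike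
    -- physical waves differs from it by a residual gauge term
    (∀ s : LineDefects.LaminarWave, LineDefects.mdot s.1.wave s.1.wave = 0 →
      Tendsto (fun t : ℝ => (s.1.stretch t).metric) (𝓝[>] 1) (𝓝 s.1.metric) ∧
      ∀ σ : ℕ → LineDefects.LaminarWave,
        (∀ n, 0 < LineDefects.mdot (σ n).1.wave (σ n).1.wave) →
        Tendsto σ atTop (𝓝 s) →
        ∀ H : Matrix (Fin 4) (Fin 4) ℝ, Tendsto (fun n => (σ n).1.metric) atTop (𝓝 H) →
          ∃ ξ : Fin 4 → ℂ, ∑ α, (s.1.wave α : ℂ) * ξ α = 0 ∧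
            LineDefects.toC H =
              LineDefects.toC s.1.metric + LineDefects.gaugeMode s.1.wave ξ) ∧
    -- lightlike modes: vacuum distributions produce exactly the two polarizations
    (∀ (k : Fin 4 → ℝ), LineDefects.mdot k k = 0 → k ≠ 0 →
      {H : Matrix (Fin 4) (Fin 4) ℂ | ∃ ρ : LineDefects.DefectDistribution,
          ρ.IsMode k ∧ ρ.modeT = 0 ∧ ρ.modeH = H} =
        (LineDefects.transverseTraceless k : Set (Matrix (Fin 4) (Fin 4) ℂ)) ∧
      Module.finrank ℂ (LineDefects.transverseTraceless k) = 2 ∧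
      ∀ e₁ e₂ : Fin 3 → ℝ, e₁ ⬝ᵥ e₁ = 1 → e₂ ⬝ᵥ e₂ = 1 → e₁ ⬝ᵥ e₂ = 0 →
        Fin.tail k ⬝ᵥ e₁ = 0 → Fin.tail k ⬝ᵥ e₂ = 0 →
        (∀ ρ : LineDefects.DefectDistribution, ρ.IsMode k → ρ.modeT = 0 →
          ρ.modeH = (1 / (2 * (Real.pi : ℂ) ^ 2 * (k 0 : ℂ) ^ 2)) •
            (ρ.cosMoment e₁ e₂ • LineDefects.plusPol e₁ e₂ +
              ρ.sinMoment e₁ e₂ • LineDefects.crossPol e₁ e₂)) ∧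
        (∀ a b : ℂ, ∃ ρ : LineDefects.DefectDistribution, ρ.IsMode k ∧ ρ.modeT = 0 ∧
          ρ.cosMoment e₁ e₂ = a ∧ ρ.sinMoment e₁ e₂ = b)) ∧
    -- every non-constant vacuum mode arises, up to gauge, from a vacuum defect distribution
    (∀ (k : Fin 4 → ℝ), k ≠ 0 → ∀ H : Matrix (Fin 4) (Fin 4) ℂ, H.IsSymm →
      LineDefects.linEinsteinMode k H = 0 →
      ∃ ρ : LineDefects.DefectDistribution, ρ.IsMode k ∧ ρ.modeT = 0 ∧
        ∃ ξ : Fin 4 → ℂ, H = ρ.modeH + LineDefects.gaugeMode k ξ) ∧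
    -- every vacuum solution arises, up to gauge, from a vacuum defect distribution
    (∀ h : (Fin 4 → ℝ) → Matrix (Fin 4) (Fin 4) ℂ, LineDefects.IsPlaneWaveSuperposition h →
      (∀ x, LineDefects.linEinstein h x = 0) →
      ∃ ρ : LineDefects.DefectDistribution,
        (∀ᵐ s ∂ρ.measure, LineDefects.mdot s.1.wave s.1.wave = 0) ∧
        ρ.HasMetric ∧ (∀ x, ρ.fieldT x = 0) ∧
        ∃ ξ : Fin 4 → (Fin 4 → ℝ) → ℂ, (∀ μ, ContDiff ℝ 1 (ξ μ)) ∧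
          ∀ x μ ν, h x μ ν =
            ρ.fieldH x μ ν + LineDefects.pd μ (ξ ν) x + LineDefects.pd ν (ξ μ) x) := by
  refine ⟨fun k ρ h => ⟨ρ.modeH_isSymm, LineDefects.DefectDistribution.contract_modeH h,
      LineDefects.DefectDistribution.linEinsteinMode_modeH h⟩,
    fun k hk ρ h => ⟨fun H _ hc hE => LineDefects.DefectDistribution.eq_modeH hk h hc hE,
      fun ρ' h' hT => LineDefects.DefectDistribution.eq_modeH hk h
        (LineDefects.DefectDistribution.contract_modeH h')
        ((LineDefects.DefectDistribution.linEinsteinMode_modeH h').trans hT)⟩,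
    fun s hk => ⟨LineDefects.WaveParam.tendsto_stretch_metric s.2 hk, fun σ hσ hlim H hH =>
      LineDefects.WaveParam.limit_metric_eq_add_gaugeMode s hk σ hσ hlim H hH⟩,
    fun k hk h0 => ⟨?_, LineDefects.finrank_transverseTraceless hk h0,
      fun e₁ e₂ h11 h22 h12 h1 h2 => ⟨fun ρ hρ hT =>
        LineDefects.modeH_eq_polarizations hk h0 hρ hT h11 h22 h12 h1 h2, fun a b =>
        LineDefects.exists_mode_moments hk h0 h11 h22 h12 h1 h2 a b⟩⟩,
    fun k h0 H hs hE => LineDefects.exists_mode_add_gaugeMode h0 hs hE,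
    fun h hh hE => LineDefects.exists_distribution_of_vacuum hh hE⟩
  ext H
  constructor
  · rintro ⟨ρ, hρ, hT, rfl⟩
    exact LineDefects.modeH_mem_transverseTraceless hk h0 hρ hT
  · exact fun hH => LineDefects.exists_mode hk h0 hH
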